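/- Let $d\ge 6$, $p_c=\frac{d+2}{d-2}$, and let $W(x)=\bigl(1+\frac{|x|^2}{d(d-2)}\bigr)^{-\frac{d-2}{2}}$ on $\mathbb R^d$. Consider the focusing energy-critical equation $$ i u_t+\Delta u+|u|^{\frac{4}{d-2}}u=0 .\qquad (\mathrm{NLS})$$ A solution on a time interval $I$ is a function $u\in C(I;\dot H^1(\mathbb R^d))$ with $u\in L^{2(d+2)/(d-2)}_{t,x}(K\times\mathbb R^d)$ for every compact $K\subset I$ which satisfies (NLS) in the sense of distributions. Let $$\mathcal L v=-i\Delta v-i\tfrac{p_c+1}{2}W^{p_c-1}v-i\tfrac{p_c-1}{2}W^{p_c-1}\bar v$$ be the linearized operator at $W$, and let $e_0>0$ and $0\neq\mathcal Y_+\in\mathcal S(\mathbb R^d)$ satisfy $\mathcal L\mathcal Y_+=e_0\mathcal Y_+$. Let $a\in\mathbb R$, and let $(\Phi_j^a)_{j\ge1}$ be functions in $\mathcal S(\mathbb R^d)$ with $\Phi_1^a=a\mathcal Y_+$ such that for every $k\ge1$ the function $$W_k^a(t,x)=W(x)+\sum_{j=1}^k e^{-je_0t}\Phi_j^a(x)$$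 is a near solution of (NLS): the error $\varepsilon_k^a=(i\partial_t+\Delta)W_k^a+|W_k^a|^{\frac4{d-2}}W_k^a$ satisfies, for all integers $J,M\ge0$, with a constant $C=C_{k,J,M}$, $$\langle x\rangle^M|\nabla^J\varepsilon_k^a(t,x)|\le C e^{-(k+1)e_0t}\qquad\text{for all large } t \text{ and all } x\in\mathbb R^d,$$ where $\langle x\rangle=(1+|x|^2)^{1/2}$. For an integer $m$ put $$\|f\|_{H^{m,m}}=\sum_{0\le j\le m}\|\langle x\rangle^{m-j}\nabla^jf\|_{L^2(\mathbb R^d)} .$$ Fix an integer $m\ge 3d$. Then there exist an integer $k_0>0$ and a unique solution $W^a$ of (NLS), defined on some interval $[T,\infty)$, with the following property: for every $k\ge k_0$ there exists $t_k\ge0$ such that $$\|W^a(t)-W_k^a(t)\|_{H^{m,m}}\le e^{-(k+\frac12)e_0t}\qquad\text{for all } t\ge t_k .$$ Here uniqueness means that every solution of (NLS) on an interval $[T',\infty)$ with this property agrees with $W^a$ at all times $t\ge\max(T,T')$. Moreover, for all sufficiently large $t$, $$\|W^a(t)-W-ae^{-e_0t}\mathcal Y_+\|_{H^{m,m}}\le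 e^{-\frac32e_0t}.$$ -/

import Mathlib

open MeasureTheory Filter Topology
open scoped ENNReal ContDiff SchwartzMap Laplacian ComplexConjugate

namespace EnergyCriticalNLS

/-- Euclidean space `ℝ^d`. -/
abbrev E (d : ℕ) : Type := EuclideanSpace ℝ (Fin d)

/-! ### Weak derivatives, weighted Sobolev norms, the homogeneous Sobolev space -/

/-- The iterated partial derivative `∂_{s 0} ⋯ ∂_{s (j-1)} φ` of a smooth function. -/
noncomputable def iterPartial {d j : ℕ} (s : Fin j → Fin d) (φ : E d → ℂ) (x : E d) : ℂ :=
  iteratedFDeriv ℝ j φ x fun l => EuclideanSpace.single (s l) (1 : ℝ)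

/-- `φ` is a test function: smooth with compact support. -/
def IsTest {d : ℕ} (φ : E d → ℂ) : Prop :=
  ContDiff ℝ ∞ φ ∧ HasCompactSupport φ

/-- `g` is the weak partial derivative `∂_{s 0} ⋯ ∂_{s (j-1)} f` on `ℝ^d`. -/
def IsWeakDeriv {d j : ℕ} (s : Fin j → Fin d) (f g : E d → ℂ) : Prop :=
  LocallyIntegrable f volume ∧ LocallyIntegrable g volume ∧
    ∀ φ : E d → ℂ, IsTest φ →
      ∫ x, g x * φ x = (-1) ^ j * ∫ x, f x * iterPartial s φ x

/-- `‖ρ ∇^j f‖_{L²}`, where `∇^j f` is the tensor of all weak partial derivatives of order `j`,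
with pointwise length `(∑ |∂_{s 0} ⋯ ∂_{s (j-1)} f|²)^{1/2}`. Weak derivatives are unique up to null
sets, so the infimum is over equal numbers; it is `∞` if some weak derivative does not exist. -/
noncomputable def gradNorm {d : ℕ} (ρ : E d → ℝ) (j : ℕ) (f : E d → ℂ) : ℝ≥0∞ :=
  ⨅ (G : (Fin j → Fin d) → E d → ℂ) (_ : ∀ s, IsWeakDeriv s f (G s)),
    eLpNorm (fun x => ρ x * √(∑ s, ‖G s x‖ ^ 2)) 2 volume

/-- The Japanese bracket `⟨x⟩ = (1 + |x|²)^{1/2}`. -/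
noncomputable def bracket {d : ℕ} (x : E d) : ℝ := √(1 + ‖x‖ ^ 2)

/-- The norm of `H^{m,m}`: `∑_{0 ≤ j ≤ m} ‖⟨x⟩^{m-j} ∇^j f‖_{L²}`, with value `∞` off `H^{m,m}`. -/
noncomputable def hmmNorm {d : ℕ} (m : ℕ) (f : E d → ℂ) : ℝ≥0∞ :=
  ∑ j ∈ Finset.range (m + 1), gradNorm (fun x => bracket x ^ (m - j)) j f

/-- The norm `‖∇f‖_{L²}` of the homogeneous Sobolev space of order one. -/
noncomputable def hDotNorm {d : ℕ} (f : E d → ℂ) : ℝ≥0∞ := gradNorm (fun _ => 1) 1 f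

/-- The homogeneous Sobolev space of order one on `ℝ^d`, `d ≥ 3`: the functions in
`L^{2d/(d-2)}` whose weak gradient is in `L²`. -/
def MemHDot {d : ℕ} (f : E d → ℂ) : Prop :=
  MemLp f (ENNReal.ofReal (2 * d / ((d : ℝ) - 2))) volume ∧ hDotNorm f < ⊤

/-! ### The equation -/

/-- The total power `p_c = (d+2)/(d-2)` of the nonlinearity. -/
noncomputable def pc (d : ℕ) : ℝ := ((d : ℝ) + 2) / ((d : ℝ) - 2)

/-- The focusing energy-critical nonlinearity `|z|^{4/(d-2)} z`. -/
noncomputable def nonlin (d : ℕ) (z : ℂ) : ℂ := ((‖z‖ ^ (4 / ((d : ℝ) - 2)) : ℝ) : ℂ) * z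

/-- `u` is a (strong) solution of `i u_t + Δ u + |u|^{4/(d-2)} u = 0` on the time interval `I`:
it is continuous in time with values in the homogeneous Sobolev space of order one, has finite
`L^{2(d+2)/(d-2)}_{t,x}` norm on compact subintervals of `I`, and solves the equation in the sense
of distributions, in time-integrated form. -/
structure IsSolutionOn {d : ℕ} (I : Set ℝ) (u : ℝ → E d → ℂ) : Prop where
  mem : ∀ t ∈ I, MemHDot (u t)
  cont : ∀ t₀ ∈ I, Tendsto (fun t => hDotNorm (u t - u t₀)) (𝓝[I] t₀) (𝓝 0)
  scattering_size : ∀ K ⊆ I, IsCompact K →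
    ∫⁻ t in K, ∫⁻ x, ‖u t x‖ₑ ^ (2 * ((d : ℝ) + 2) / ((d : ℝ) - 2)) < ⊤
  equation : ∀ φ : E d → ℂ, IsTest φ → ∀ t₁ ∈ I, ∀ t₂ ∈ I,
    Complex.I * ((∫ x, u t₂ x * φ x) - ∫ x, u t₁ x * φ x)
      + ∫ t in t₁..t₂, ((∫ x, u t x * (Δ φ) x) + ∫ x, nonlin d (u t x) * φ x) = 0

/-! ### The ground state, the linearized operator, the near solutions -/

/-- The ground state `W(x) = (1 + |x|²/(d(d-2)))^{-(d-2)/2}`. -/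
noncomputable def W (d : ℕ) (x : E d) : ℝ :=
  (1 + ‖x‖ ^ 2 / ((d : ℝ) * ((d : ℝ) - 2))) ^ (-(((d : ℝ) - 2) / 2))

/-- The linearized operator
`𝓛 v = -iΔv - i (p_c+1)/2 W^{p_c-1} v - i (p_c-1)/2 W^{p_c-1} v̄`. -/
noncomputable def linOp {d : ℕ} (v : E d → ℂ) (x : E d) : ℂ :=
  -Complex.I * (Δ v) x
    - Complex.I * (((pc d + 1) / 2 * W d x ^ (pc d - 1) : ℝ) : ℂ) * v x
    - Complex.I * (((pc d - 1) / 2 * W d x ^ (pc d - 1) : ℝ) : ℂ) * conj (v x)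

/-- `Y` is a Schwartz eigenfunction of `𝓛` with the real eigenvalue `e₀ > 0`. (Then `Ȳ` is an
eigenfunction with eigenvalue `-e₀`.) -/
structure IsUnstableMode {d : ℕ} (e₀ : ℝ) (Y : 𝓢(E d, ℂ)) : Prop where
  pos : 0 < e₀
  ne_zero : Y ≠ 0
  eigen : ∀ x, linOp Y x = (e₀ : ℂ) * Y x

/-- `W_k(t,x) = W(x) + ∑_{j=1}^k e^{-j e₀ t} Φ_j(x)`. -/
noncomputable def Wk {d : ℕ} (e₀ : ℝ) (Φ : ℕ → 𝓢(E d, ℂ)) (k : ℕ) (t : ℝ) (x : E d) : ℂ :=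
  (W d x : ℂ) + ∑ j ∈ Finset.Icc 1 k, ((Real.exp (-(j * e₀ * t)) : ℝ) : ℂ) * Φ j x

/-- The error `ε_k = (i∂_t + Δ) W_k + |W_k|^{4/(d-2)} W_k`. -/
noncomputable def nearError {d : ℕ} (e₀ : ℝ) (Φ : ℕ → 𝓢(E d, ℂ)) (k : ℕ) (t : ℝ) (x : E d) : ℂ :=
  Complex.I * deriv (fun s => Wk e₀ Φ k s x) t + (Δ (Wk e₀ Φ k t)) x + nonlin d (Wk e₀ Φ k t x)

/-- The Schwartz functions `Φ_1, Φ_2, …` generate near solutions `W_k` with leading term `a Y`: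
`Φ_1 = a Y`, and for every `k` the error `ε_k(t)` is `O(e^{-(k+1) e₀ t})` in the Schwartz space as
`t → +∞`. The value `Φ_0` plays no role. -/
structure IsNearSolutionFamily {d : ℕ} (e₀ : ℝ) (Y : 𝓢(E d, ℂ)) (a : ℝ) (Φ : ℕ → 𝓢(E d, ℂ)) :
    Prop where
  first : Φ 1 = (a : ℂ) • Y
  error : ∀ k : ℕ, 1 ≤ k → ∀ J M : ℕ, ∃ C : ℝ, ∀ᶠ t : ℝ in atTop, ∀ x,
    bracket x ^ M * ‖iteratedFDeriv ℝ J (nearError e₀ Φ k t) x‖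
      ≤ C * Real.exp (-((k + 1) * e₀ * t))

/-- For every `k ≥ k₀` there is `t_k ≥ 0` with
`‖u(t) - W_k(t)‖_{H^{m,m}} ≤ e^{-(k+1/2) e₀ t}` for all `t ≥ t_k`. -/
def IsApproximated {d : ℕ} (m : ℕ) (e₀ : ℝ) (Φ : ℕ → 𝓢(E d, ℂ)) (k₀ : ℕ) (u : ℝ → E d → ℂ) :
    Prop :=
  ∀ k ≥ k₀, ∃ tk : ℝ, 0 ≤ tk ∧ ∀ t ≥ tk,
    hmmNorm m (u t - Wk e₀ Φ k t) ≤ ENNReal.ofReal (Real.exp (-((k + 1 / 2) * e₀ * t)))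

end EnergyCriticalNLS

set_option linter.all false
set_option linter.deprecated false

namespace EnergyCriticalNLS

open scoped LineDeriv FourierTransform

variable {d : ℕ}

/-! ### Weighted Sobolev seminorms on Schwartz functions -/

/-! The perturbation is sought relative to the ground state. The nonlinearity `F(z) = |z|^α z`, `α =
4/(d-2)`, is not smooth at zero, but `W` never vanishes: for `h = f/W` small, `F(W + f) - F(W) =
W^{α+1} ((1 + h)^{1+α/2} (1 + conj h)^{α/2} - 1)` is a convergent power series in `h` and `conj h`.
To exploit this, `f` is measured by `q n`, the sum of the `L²` norms of all words of length `n` in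
derivatives and coordinates. Since `1/W` grows only polynomially, weighted Sobolev embedding gives
`q n (f g / W) ≤ C q n f q n g` for large `n` (`exists_q_mulWt_smul'_le`). The functions `c + f/W`
therefore complete to a Banach algebra `Alg`, on which the nonlinearity `nlA` is real analytic near
zero, hence locally Lipschitz (`nlA_analyticAt`, `fn_nlA`).

In this norm the free group grows polynomially in time, because `x_j e^{itΔ} = e^{itΔ} (x_j -
2it∂_j)` (`q_grp_le`). No dispersive estimate is needed: the Duhamel integral over `(t, ∞)` sends
sources of size `e^{-γt}` to solutions of size `e^{-γt}` with a constant proportional to `1/(γ-1)`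
(`norm_profile_le`). With `u = W_k + v` and `γ = (k + 1/2) e₀`, the terms linear in `v` are left in
the Lipschitz source, and a large `k` makes the Duhamel map a contraction (`exists_duhamel`,
`exists_algSolution`). The source at `v = 0` is the error of `W_k`, which must be small in the norm
of the algebra. As a function of `s = e^{-e₀t}` it is analytic, so it vanishes identically or to an
exact integer order; the pointwise bound on the error forces that order to be at least `k + 1`
(`exists_errA_bound`), since an element of the algebra is determined by its constant and its
function (`eq_zero_of_fn_eq_zero`).

Uniqueness concerns all solutions continuous in the homogeneous Sobolev space, so the competitor
need not live in the algebra. If `w = v - u` is a difference of solutions and `|u| ≤ B`, the mass of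
`w` changes at rate at most `2 B^α`, because `|Im ((F(v) - F(u)) conj(v - u))| ≤ |u|^α |v - u|²`
when `α ≤ 1`, that is, `d ≥ 6` (`abs_im_nonlin_sub_le`). As `w(t)` is not known to be in `L²`, the
mass is localized by cutoffs at radius `n + 1`, at the price of an error of size `(n + 1)⁻²`
(`abs_re_flux_le`, `exists_mass_le`). First `n`, then the final time tends to infinity; decay at
rate `(k₀ + 1/2) e₀` beats the growth for `k₀` large (`eq_of_decay`). Testing the equation with the
localized difference itself rests on density of test functions (`exists_seq_schwartz`,
`IsGrad.exists_seq`) and the Sobolev inequality (`IsGrad.norm_le`).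

Finally, the solution built at a level `k ≥ k₀` is also close to `W_{k₀}`, so by uniqueness it is
the solution built at level `k₀`. This yields the approximation at every level, and comparison with
`W_1` gives the first-order expansion. -/

/-- The elementary operators: identity, partial derivatives, multiplication by coordinates. -/
noncomputable def op : Option (Fin d ⊕ Fin d) → 𝓢(E d, ℂ) →L[ℂ] 𝓢(E d, ℂ)
  | none => ContinuousLinearMap.id ℂ _
  | some (.inl j) => LineDeriv.lineDerivOpCLM ℂ 𝓢(E d, ℂ) (EuclideanSpace.single j (1 : ℝ))
  | some (.inr j) => SchwartzMap.smulLeftCLM ℂ (fun x : E d => ((x j : ℝ) : ℂ))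

/-- The partial derivative `∂_j` on Schwartz functions. -/
noncomputable abbrev der (j : Fin d) : 𝓢(E d, ℂ) →L[ℂ] 𝓢(E d, ℂ) := op (some (.inl j))

/-- Multiplication by the coordinate `x_j` on Schwartz functions. -/
noncomputable abbrev pos (j : Fin d) : 𝓢(E d, ℂ) →L[ℂ] 𝓢(E d, ℂ) := op (some (.inr j))

theorem coord_temperate (j : Fin d) :
    Function.HasTemperateGrowth (fun x : E d => ((x j : ℝ) : ℂ)) := by
  have : (fun x : E d => ((x j : ℝ) : ℂ)) =
      (Complex.ofRealCLM.comp (EuclideanSpace.proj j : E d →L[ℝ] ℝ)) := by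
    ext x; simp
  rw [this]; exact ContinuousLinearMap.hasTemperateGrowth _

theorem pos_apply (j : Fin d) (f : 𝓢(E d, ℂ)) (x : E d) : pos j f x = ((x j : ℝ) : ℂ) * f x := by
  simp [pos, op, SchwartzMap.smulLeftCLM_apply_apply (coord_temperate j)]

theorem der_eq (j : Fin d) (f : 𝓢(E d, ℂ)) :
    der j f = ∂_{EuclideanSpace.single j (1 : ℝ)} f := rfl

theorem der_apply (j : Fin d) (f : 𝓢(E d, ℂ)) (x : E d) :
    der j f x = fderiv ℝ f x (EuclideanSpace.single j 1) := by
  rw [der_eq, SchwartzMap.lineDerivOp_apply_eq_fderiv]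

/-- The seminorm `q n f = ∑ ‖w f‖_{L²}`, the sum over all words `w` of length `n` in the elementary
operators. -/
noncomputable def q : ℕ → Seminorm ℂ 𝓢(E d, ℂ)
  | 0 => (normSeminorm ℂ (Lp ℂ 2 (volume : Measure (E d)))).comp
      (SchwartzMap.toLpCLM ℂ ℂ 2 volume).toLinearMap
  | n + 1 => ∑ l, (q n).comp (op l).toLinearMap

theorem q_zero_apply (f : 𝓢(E d, ℂ)) : q 0 f = ‖f.toLp 2 volume‖ := rfl

theorem q_succ_sum (n : ℕ) (f : 𝓢(E d, ℂ)) : q (n + 1) f = ∑ l, q n (op l f) := by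
  have h : ∀ s : Finset (Option (Fin d ⊕ Fin d)),
      (∑ l ∈ s, (q n).comp (op l).toLinearMap) f = ∑ l ∈ s, q n (op l f) := by
    intro s
    induction s using Finset.induction_on with
    | empty => simp
    | insert a s ha ih => rw [Finset.sum_insert ha, Finset.sum_insert ha, Seminorm.add_apply, ih]; rfl
  exact h _

theorem q_succ (n : ℕ) (f : 𝓢(E d, ℂ)) :
    q (n + 1) f = q n f + (∑ j, q n (der j f) + ∑ j, q n (pos j f)) := by
  rw [q_succ_sum, Fintype.sum_option, Fintype.sum_sum_type]; rfl

theorem q_op_le (n : ℕ) (l) (f : 𝓢(E d, ℂ)) : q n (op l f) ≤ q (n + 1) f := by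
  rw [q_succ_sum]
  exact Finset.single_le_sum (f := fun l => q n (op l f)) (fun _ _ => apply_nonneg _ _)
    (Finset.mem_univ l)

/-- The identity is one of the letters, so words of length `n` are among those of length `n + 1`. -/
theorem q_le_succ (n : ℕ) (f : 𝓢(E d, ℂ)) : q n f ≤ q (n + 1) f := q_op_le n none f

theorem q_mono {m n : ℕ} (h : m ≤ n) (f : 𝓢(E d, ℂ)) : q m f ≤ q n f :=
  monotone_nat_of_le_succ (f := fun n => q n f) (fun n => q_le_succ n f) h

/-- `‖f‖_{L²}` is bounded by pointwise domination. -/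
theorem q_zero_le_of_norm_le {f g : 𝓢(E d, ℂ)} {C : ℝ}
    (h : ∀ x, ‖f x‖ ≤ C * ‖g x‖) : q 0 f ≤ C * q 0 g := by
  rw [q_zero_apply, q_zero_apply]
  refine Lp.norm_le_mul_norm_of_ae_le_mul ?_
  filter_upwards [f.coeFn_toLp 2 volume, g.coeFn_toLp 2 volume] with x hf hg
  rw [hf, hg]; exact h x

/-! ### Pointwise products -/

/-- The pointwise product of Schwartz functions. -/
noncomputable def smul' (f g : 𝓢(E d, ℂ)) : 𝓢(E d, ℂ) :=
  SchwartzMap.pairing (ContinuousLinearMap.mul ℂ ℂ) f g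

theorem smul'_apply (f g : 𝓢(E d, ℂ)) (x : E d) : smul' f g x = f x * g x := by
  simp [smul']

theorem pos_smul' (j : Fin d) (f g : 𝓢(E d, ℂ)) : pos j (smul' f g) = smul' (pos j f) g := by
  ext x; simp only [smul'_apply, pos_apply]; ring

theorem der_smul' (j : Fin d) (f g : 𝓢(E d, ℂ)) :
    der j (smul' f g) = smul' (der j f) g + smul' f (der j g) := by
  ext x
  rw [der_apply]
  have e : (smul' f g : E d → ℂ) = (f : E d → ℂ) * (g : E d → ℂ) := by
    funext y; simp [smul'_apply]
  rw [e, ((f.hasFDerivAt x).mul (g.hasFDerivAt x)).fderiv]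
  simp only [_root_.add_apply, smul'_apply, der_apply]
  simp
  ring

/-! ### The weights -/

/-- The weight `(1 + |x|²/(d(d-2)))^r`. -/
noncomputable def wt (d : ℕ) (r : ℝ) (x : E d) : ℝ := (1 + ‖x‖ ^ 2 / ((d : ℝ) * ((d : ℝ) - 2))) ^ r

section

variable [hd : Fact (6 ≤ d)]

theorem six_le_cast : (6 : ℝ) ≤ d := by exact_mod_cast hd.out

theorem cc_pos : 0 < (d : ℝ) * ((d : ℝ) - 2) := by
  have := six_le_cast (d := d); nlinarith

theorem one_le_base (x : E d) : 1 ≤ 1 + ‖x‖ ^ 2 / ((d : ℝ) * ((d : ℝ) - 2)) := by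
  have := cc_pos (d := d)
  have : 0 ≤ ‖x‖ ^ 2 / ((d : ℝ) * ((d : ℝ) - 2)) := by positivity
  linarith

theorem wt_pos (r : ℝ) (x : E d) : 0 < wt d r x :=
  Real.rpow_pos_of_pos (by linarith [one_le_base x]) _

theorem wt_add (r s : ℝ) (x : E d) : wt d (r + s) x = wt d r x * wt d s x :=
  Real.rpow_add (by linarith [one_le_base x]) _ _

theorem wt_mono {r s : ℝ} (h : r ≤ s) (x : E d) : wt d r x ≤ wt d s x :=
  Real.rpow_le_rpow_of_exponent_le (one_le_base x) h

theorem wt_zero (x : E d) : wt d 0 x = 1 := by simp [wt]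

theorem wt_rpow (r s : ℝ) (x : E d) : wt d r x ^ s = wt d (r * s) x :=
  (Real.rpow_mul (by linarith [one_le_base x]) _ _).symm

theorem wt_hasFDerivAt (r : ℝ) (x : E d) :
    HasFDerivAt (wt d r) ((2 * r / ((d : ℝ) * ((d : ℝ) - 2)) * wt d (r - 1) x) •
      innerSL ℝ x) x := by
  have h1 : HasFDerivAt (fun y : E d => 1 + ‖y‖ ^ 2 / ((d : ℝ) * ((d : ℝ) - 2)))
      ((((d : ℝ) * ((d : ℝ) - 2))⁻¹) • (2 • innerSL ℝ x)) x := by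
    have := ((hasStrictFDerivAt_norm_sq x).hasFDerivAt.const_mul
      (((d : ℝ) * ((d : ℝ) - 2))⁻¹)).const_add 1
    refine this.congr_of_eventuallyEq (Eventually.of_forall fun y => ?_)
    simp only [div_eq_inv_mul]
  have h2 := h1.rpow_const (p := r) (Or.inl (by linarith [one_le_base x]))
  refine h2.congr_fderiv ?_
  ext v
  simp only [wt, smul_apply, innerSL_apply_apply, smul_eq_mul, nsmul_eq_mul, div_eq_mul_inv]
  push_cast
  ring

theorem wt_temperate (r : ℝ) : Function.HasTemperateGrowth (wt d r) := by
  have hc := cc_pos (d := d)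
  set s : ℝ := (√((d : ℝ) * ((d : ℝ) - 2)))⁻¹ with hs
  have h := (Function.hasTemperateGrowth_one_add_norm_sq_rpow (H := E d) r).comp
    ((s • ContinuousLinearMap.id ℝ (E d)).hasTemperateGrowth)
  have e : wt d r = (fun x => (1 + ‖x‖ ^ 2) ^ r) ∘ ⇑(s • ContinuousLinearMap.id ℝ (E d)) := by
    funext x
    simp only [wt, Function.comp, smul_apply, ContinuousLinearMap.id_apply,
      norm_smul, mul_pow, hs, norm_inv, Real.norm_eq_abs, inv_pow, sq_abs]
    rw [Real.sq_sqrt hc.le, div_eq_inv_mul]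
  rw [e]; exact h

theorem wt_temperate' (r : ℝ) : Function.HasTemperateGrowth (fun x => ((wt d r x : ℝ) : ℂ)) :=
  Function.Complex.hasTemperateGrowth_ofReal.comp (wt_temperate r)

/-- Multiplication by the weight on Schwartz functions. -/
noncomputable def mulWt (r : ℝ) : 𝓢(E d, ℂ) →L[ℂ] 𝓢(E d, ℂ) :=
  SchwartzMap.smulLeftCLM ℂ (fun x => ((wt d r x : ℝ) : ℂ))

theorem mulWt_apply (r : ℝ) (f : 𝓢(E d, ℂ)) (x : E d) :
    mulWt r f x = ((wt d r x : ℝ) : ℂ) * f x := by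
  simp [mulWt, SchwartzMap.smulLeftCLM_apply_apply (wt_temperate' r)]

theorem mulWt_mulWt (r s : ℝ) (f : 𝓢(E d, ℂ)) : mulWt r (mulWt s f) = mulWt (r + s) f := by
  ext x; simp only [mulWt_apply, wt_add]; push_cast; ring

theorem mulWt_zero (f : 𝓢(E d, ℂ)) : mulWt 0 f = f := by
  ext x; simp [mulWt_apply, wt_zero]

theorem pos_mulWt (r : ℝ) (j : Fin d) (f : 𝓢(E d, ℂ)) :
    pos j (mulWt r f) = mulWt r (pos j f) := by
  ext x; simp only [mulWt_apply, pos_apply]; ring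

/-- Commuting a derivative past a weight lowers the exponent by one and leaves a coordinate, which
is again a single letter. Inductions on word length therefore close up to a change of exponent. -/
theorem der_mulWt (r : ℝ) (j : Fin d) (f : 𝓢(E d, ℂ)) :
    der j (mulWt r f) = mulWt r (der j f) +
      ((2 * r / ((d : ℝ) * ((d : ℝ) - 2)) : ℝ) : ℂ) • mulWt (r - 1) (pos j f) := by
  ext x
  rw [der_apply]
  have h := ((Complex.ofRealCLM.hasFDerivAt (x := wt d r x)).comp x (wt_hasFDerivAt r x)).mul
    (f.hasFDerivAt x)
  have e : (mulWt r f : E d → ℂ) = (Complex.ofRealCLM ∘ wt d r) * (f : E d → ℂ) := by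
    funext y; simp [mulWt_apply]
  rw [e, h.fderiv]
  simp only [_root_.add_apply, _root_.smul_apply, mulWt_apply, pos_apply, der_apply]
  have hin : inner ℝ x (EuclideanSpace.single j (1 : ℝ)) = x j := by
    rw [EuclideanSpace.inner_single_right]; simp
  simp [hin]
  ring

end

end EnergyCriticalNLS

namespace EnergyCriticalNLS

open scoped LineDeriv FourierTransform

variable {d : ℕ}

/-! ### Sobolev embedding and weighted product estimates -/

theorem q_sum_le {ι : Type*} (n : ℕ) (s : Finset ι) (f : ι → 𝓢(E d, ℂ)) :
    q n (∑ i ∈ s, f i) ≤ ∑ i ∈ s, q n (f i) :=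
  Finset.le_sum_of_subadditive (q n) (map_zero _).le (fun _ _ => map_add_le_add _ _ _) s f

theorem laplacian_eq_der (f : 𝓢(E d, ℂ)) : Δ f = ∑ j, der j (der j f) := by
  rw [SchwartzMap.laplacian_eq_sum (EuclideanSpace.basisFun (Fin d) ℝ)]
  simp [der_eq]

theorem q_laplacian_le (n : ℕ) (f : 𝓢(E d, ℂ)) : q n (Δ f) ≤ q (n + 2) f := by
  rw [laplacian_eq_der]
  calc q n (∑ j, der j (der j f)) ≤ ∑ j, q n (der j (der j f)) := q_sum_le _ _ _
    _ ≤ ∑ j, q (n + 1) (der j f) := Finset.sum_le_sum fun j _ => q_op_le n _ _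
    _ ≤ q (n + 2) f := by
      rw [q_succ (n + 1)]
      have h1 : 0 ≤ q (n + 1) f := apply_nonneg _ _
      have h2 : 0 ≤ ∑ j, q (n + 1) (pos j f) := Finset.sum_nonneg fun _ _ => apply_nonneg _ _
      linarith

/-- The operator `1 - Δ/(4π²)` on Schwartz functions. -/
noncomputable def bessel (f : 𝓢(E d, ℂ)) : 𝓢(E d, ℂ) :=
  f - (((2 * Real.pi) ^ 2)⁻¹ : ℝ) • Δ f

theorem q_bessel_le (n : ℕ) (f : 𝓢(E d, ℂ)) : q n (bessel f) ≤ 2 * q (n + 2) f := by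
  have h1 : q n f ≤ q (n + 2) f := q_mono (by omega) f
  have h2 := q_laplacian_le n f
  have hpi : (((2 * Real.pi) ^ 2)⁻¹ : ℝ) ≤ 1 := by
    apply inv_le_one_of_one_le₀
    nlinarith [Real.pi_gt_three]
  have h3 : q n ((((2 * Real.pi) ^ 2)⁻¹ : ℝ) • Δ f) ≤ q n (Δ f) := by
    have : (((2 * Real.pi) ^ 2)⁻¹ : ℝ) • Δ f = ((((2 * Real.pi) ^ 2)⁻¹ : ℝ) : ℂ) • Δ f := by
      ext x; simp
    rw [this, map_smul_eq_mul]
    have h4 : 0 ≤ q n (Δ f) := apply_nonneg _ _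
    have h5 : ‖((((2 * Real.pi) ^ 2)⁻¹ : ℝ) : ℂ)‖ = ((2 * Real.pi) ^ 2)⁻¹ := by
      rw [Complex.norm_real, Real.norm_of_nonneg (by positivity)]
    rw [h5]
    nlinarith
  calc q n (bessel f) ≤ q n f + q n ((((2 * Real.pi) ^ 2)⁻¹ : ℝ) • Δ f) := map_sub_le_add _ _ _
    _ ≤ _ := by linarith

/-- The factor `(2π)⁻²` in `bessel` matches the convention `e^{-2πi x·ξ}` and makes the symbol
exactly `1 + |ξ|²`. -/
theorem fourier_bessel_apply (f : 𝓢(E d, ℂ)) (ξ : E d) :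
    𝓕 (bessel f) ξ = ((1 + ‖ξ‖ ^ 2 : ℝ) : ℂ) * 𝓕 f ξ := by
  have hpi : ((2 * Real.pi) ^ 2 : ℝ) ≠ 0 := by positivity
  have h1 : 𝓕 (Δ f) = -(2 * Real.pi) ^ 2 • SchwartzMap.smulLeftCLM ℂ (fun x : E d => ‖x‖ ^ 2) (𝓕 f) := by
    rw [SchwartzMap.laplacian_eq_fourierMultiplierCLM, SchwartzMap.fourierMultiplierCLM_apply]
    rw [← FourierTransform.fourierInv_smul, FourierTransform.fourier_fourierInv_eq]
  have h2 : 𝓕 (bessel f) = 𝓕 f - (((2 * Real.pi) ^ 2)⁻¹ : ℝ) • 𝓕 (Δ f) := by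
    rw [bessel, sub_eq_add_neg, sub_eq_add_neg, ← neg_smul, ← neg_smul, FourierTransform.fourier_add,
      FourierTransform.fourier_smul]
  rw [h2, h1, smul_smul]
  simp only [_root_.sub_apply, _root_.smul_apply]
  rw [SchwartzMap.smulLeftCLM_apply_apply (by fun_prop)]
  rw [mul_neg, inv_mul_cancel₀ hpi]
  simp
  ring

theorem q_bessel_iterate_le (k : ℕ) (f : 𝓢(E d, ℂ)) (n : ℕ) :
    q n (bessel^[k] f) ≤ 2 ^ k * q (n + 2 * k) f := by
  induction k generalizing n with
  | zero => simp
  | succ k ih =>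
    rw [Function.iterate_succ_apply']
    calc q n (bessel (bessel^[k] f)) ≤ 2 * q (n + 2) (bessel^[k] f) := q_bessel_le _ _
      _ ≤ 2 * (2 ^ k * q (n + 2 + 2 * k) f) := by gcongr; exact ih _
      _ = _ := by rw [pow_succ]; ring_nf

theorem fourier_bessel_iterate_apply (k : ℕ) (f : 𝓢(E d, ℂ)) (ξ : E d) :
    𝓕 (bessel^[k] f) ξ = ((1 + ‖ξ‖ ^ 2 : ℝ) : ℂ) ^ k * 𝓕 f ξ := by
  induction k with
  | zero => simp
  | succ k ih => rw [Function.iterate_succ_apply', fourier_bessel_apply, ih, pow_succ]; ring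

/-- Sobolev embedding `sup |f| ≤ C q_{2d}(f)`. -/
theorem exists_norm_le_q (hd : 0 < d) :
    ∃ C, 0 ≤ C ∧ ∀ (f : 𝓢(E d, ℂ)) (x : E d), ‖f x‖ ≤ C * q (2 * d) f := by
  -- The Fourier transform of `f` is `g` times that of `bessel^[d] f`. As `g` is in `L²`,
  -- Cauchy–Schwarz and Plancherel bound its `L¹` norm, hence the supremum of `f`, using `2 d`
  -- derivatives.
  set g : E d → ℂ := fun ξ => (((1 + ‖ξ‖ ^ 2 : ℝ) : ℂ) ^ d)⁻¹ with hg
  have hgc : Continuous g := by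
    rw [hg]
    refine Continuous.inv₀ (by fun_prop) fun x => pow_ne_zero _ ?_
    exact_mod_cast (by positivity : (1 + ‖x‖ ^ 2 : ℝ) ≠ 0)
  have hgL : MemLp g 2 volume := by
    rw [memLp_two_iff_integrable_sq_norm hgc.aestronglyMeasurable]
    have h := integrable_rpow_neg_one_add_norm_sq (E := E d) (μ := volume) (r := 4 * d) (by
      simp; linarith [(Nat.cast_pos (α := ℝ)).mpr hd])
    refine h.congr (Eventually.of_forall fun ξ => ?_)
    have : (0 : ℝ) < 1 + ‖ξ‖ ^ 2 := by positivity
    simp only [hg, norm_inv, norm_pow, Complex.norm_real, Real.norm_of_nonneg this.le]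
    rw [inv_pow, ← pow_mul, ← Real.rpow_natCast _ (d * 2), ← Real.rpow_neg this.le]
    congr 1
    push_cast; ring
  refine ⟨(eLpNorm g 2 volume).toReal * 2 ^ d, by positivity, fun f x => ?_⟩
  have h1 : ‖f x‖ ≤ ∫ ξ, ‖𝓕 f ξ‖ := by
    have : f x = 𝓕⁻ (𝓕 f) x := by rw [FourierTransform.fourierInv_fourier_eq]
    rw [this, SchwartzMap.fourierInv_apply_eq]
    simp only [SchwartzMap.compCLMOfContinuousLinearEquiv_apply, Function.comp]
    refine (SchwartzMap.norm_fourier_apply_le_toLp_one _ _).trans ?_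
    rw [SchwartzMap.norm_toLp_one]
  have h2 : ENNReal.ofReal (∫ ξ, ‖𝓕 f ξ‖) ≤
      eLpNorm g 2 volume * eLpNorm (𝓕 (bessel^[d] f) : 𝓢(E d, ℂ)) 2 volume := by
    rw [ofReal_integral_norm_eq_lintegral_enorm (𝓕 f).integrable, ← eLpNorm_one_eq_lintegral_enorm]
    have e : ((𝓕 f : 𝓢(E d, ℂ)) : E d → ℂ) = g • ((𝓕 (bessel^[d] f) : 𝓢(E d, ℂ)) : E d → ℂ) := by
      funext ξ
      have h0 : ((1 + ‖ξ‖ ^ 2 : ℝ) : ℂ) ^ d ≠ 0 := pow_ne_zero _ (by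
        exact_mod_cast (by positivity : (1 + ‖ξ‖ ^ 2 : ℝ) ≠ 0))
      simp only [Pi.smul_apply', hg, smul_eq_mul, fourier_bessel_iterate_apply]
      field_simp
    rw [e]
    exact eLpNorm_smul_le_mul_eLpNorm (SchwartzMap.continuous _).aestronglyMeasurable
      hgc.aestronglyMeasurable
  have h3 : ∫ ξ, ‖𝓕 f ξ‖ ≤ (eLpNorm g 2 volume).toReal * q 0 (bessel^[d] f) := by
    rw [q_zero_apply, ← SchwartzMap.norm_fourier_toL2_eq, SchwartzMap.norm_toLp, ← ENNReal.toReal_mul]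
    rw [← ENNReal.toReal_ofReal (integral_nonneg fun ξ => norm_nonneg (𝓕 f ξ))]
    refine ENNReal.toReal_mono ?_ h2
    exact ENNReal.mul_ne_top hgL.eLpNorm_ne_top (SchwartzMap.eLpNorm_lt_top _ _ _).ne
  refine h1.trans (h3.trans ?_)
  rw [mul_assoc]
  gcongr
  simpa using q_bessel_iterate_le d f 0

section

variable [hd : Fact (6 ≤ d)]

/-- Multiplication by a bounded weight. -/
theorem exists_q_mulWt_le (n : ℕ) : ∀ r ≤ (0 : ℝ), ∃ C, 0 ≤ C ∧ ∀ f : 𝓢(E d, ℂ),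
    q n (mulWt r f) ≤ C * q n f := by
  induction n with
  | zero =>
    refine fun r hr => ⟨1, zero_le_one, fun f => q_zero_le_of_norm_le fun x => ?_⟩
    rw [mulWt_apply, norm_mul, Complex.norm_real, Real.norm_of_nonneg (wt_pos r x).le]
    gcongr
    exact (wt_mono hr x).trans (wt_zero x).le
  | succ n ih =>
    intro r hr
    obtain ⟨C, hC, h⟩ := ih r hr
    -- The commutator with a derivative carries the exponent `r - 1`, still nonpositive, so the
    -- induction runs over all exponents at once.
    obtain ⟨C', hC', h'⟩ := ih (r - 1) (by linarith)
    set k : ℂ := ((2 * r / ((d : ℝ) * ((d : ℝ) - 2)) : ℝ) : ℂ) with hk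
    refine ⟨C + ‖k‖ * C', by positivity, fun f => ?_⟩
    rw [q_succ, q_succ]
    have e1 : ∑ j, q n (der j (mulWt r f)) ≤ ∑ j, (C * q n (der j f) + ‖k‖ * C' * q n (pos j f)) := by
      refine Finset.sum_le_sum fun j _ => ?_
      rw [der_mulWt]
      refine (map_add_le_add _ _ _).trans ?_
      rw [map_smul_eq_mul, mul_assoc]
      gcongr
      · exact h _
      · exact h' _
    have e2 : ∑ j, q n (pos j (mulWt r f)) ≤ ∑ j, C * q n (pos j f) := by
      refine Finset.sum_le_sum fun j _ => ?_
      rw [pos_mulWt]; exact h _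
    rw [Finset.sum_add_distrib, ← Finset.mul_sum, ← Finset.mul_sum] at e1
    rw [← Finset.mul_sum] at e2
    have p1 : 0 ≤ ∑ j, q n (der j f) := Finset.sum_nonneg fun _ _ => apply_nonneg _ _
    have p2 : 0 ≤ ∑ j, q n (pos j f) := Finset.sum_nonneg fun _ _ => apply_nonneg _ _
    have p3 : 0 ≤ q n f := apply_nonneg _ _
    have := h f
    have p4 : 0 ≤ ‖k‖ * C' := by positivity
    nlinarith [mul_nonneg p4 p1, mul_nonneg p4 p3]

theorem q_mulWt_one_le (n : ℕ) (f : 𝓢(E d, ℂ)) : q n (mulWt 1 f) ≤ 2 * q (n + 2) f := by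
  have hc := cc_pos (d := d)
  set k : ℂ := ((((d : ℝ) * ((d : ℝ) - 2))⁻¹ : ℝ) : ℂ) with hk
  have hk1 : ‖k‖ ≤ 1 := by
    rw [hk, Complex.norm_real, Real.norm_of_nonneg (by positivity)]
    apply inv_le_one_of_one_le₀
    have := six_le_cast (d := d); nlinarith
  have e : mulWt 1 f = f + k • ∑ j, pos j (pos j f) := by
    ext x
    simp only [_root_.add_apply, _root_.smul_apply, mulWt_apply, wt, Real.rpow_one, hk,
      SchwartzMap.sum_apply, pos_apply, EuclideanSpace.norm_sq_eq, Real.norm_eq_abs, sq_abs]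
    simp only [smul_eq_mul, ← mul_assoc, ← Finset.sum_mul]
    push_cast
    simp only [pow_two]
    ring
  rw [e]
  have h1 : q n f ≤ q (n + 2) f := q_mono (by omega) f
  have h2 : q n (∑ j, pos j (pos j f)) ≤ q (n + 2) f := by
    calc q n (∑ j, pos j (pos j f)) ≤ ∑ j, q n (pos j (pos j f)) := q_sum_le _ _ _
      _ ≤ ∑ j, q (n + 1) (pos j f) := Finset.sum_le_sum fun j _ => q_op_le n _ _
      _ ≤ q (n + 2) f := by
        rw [q_succ (n + 1)]
        have h1 : 0 ≤ q (n + 1) f := apply_nonneg _ _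
        have h2 : 0 ≤ ∑ j, q (n + 1) (der j f) := Finset.sum_nonneg fun _ _ => apply_nonneg _ _
        linarith
  have h3 := map_add_le_add (q n) f (k • ∑ j, pos j (pos j f))
  rw [map_smul_eq_mul] at h3
  have h4 : 0 ≤ q n (∑ j, pos j (pos j f)) := apply_nonneg _ _
  nlinarith [norm_nonneg k]

theorem q_mulWt_nat_le (k n : ℕ) (f : 𝓢(E d, ℂ)) :
    q n (mulWt k f) ≤ 2 ^ k * q (n + 2 * k) f := by
  induction k generalizing n with
  | zero => simp [mulWt_zero]
  | succ k ih =>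
    have : mulWt ((k + 1 : ℕ) : ℝ) f = mulWt 1 (mulWt k f) := by
      rw [mulWt_mulWt]; push_cast; ring_nf
    rw [this]
    calc q n (mulWt 1 (mulWt k f)) ≤ 2 * q (n + 2) (mulWt k f) := q_mulWt_one_le _ _
      _ ≤ 2 * (2 ^ k * q (n + 2 + 2 * k) f) := by gcongr; exact ih _
      _ = _ := by rw [pow_succ]; ring_nf

/-- Weighted Sobolev embedding. -/
theorem exists_wt_norm_le_q : ∃ C, 0 ≤ C ∧ ∀ r ≤ (d : ℝ), ∀ (f : 𝓢(E d, ℂ)) (x : E d),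
    wt d r x * ‖f x‖ ≤ C * q (4 * d) f := by
  obtain ⟨C, hC, h⟩ := exists_norm_le_q (d := d) (by have := hd.out; omega)
  refine ⟨C * 2 ^ d, by positivity, fun r hr f x => ?_⟩
  -- Of the `4 d` letters, `2 d` pay for the embedding and `2 d` for the weight.
  have h1 := h (mulWt d f) x
  rw [mulWt_apply, norm_mul, Complex.norm_real, Real.norm_of_nonneg (wt_pos _ x).le] at h1
  calc wt d r x * ‖f x‖ ≤ wt d d x * ‖f x‖ := by gcongr; exact wt_mono hr x
    _ ≤ C * q (2 * d) (mulWt d f) := h1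
    _ ≤ C * (2 ^ d * q (2 * d + 2 * d) f) := by gcongr; exact q_mulWt_nat_le _ _ _
    _ = _ := by ring_nf

/-- The right-hand side of the tame product estimate with loss `4 d`. -/
noncomputable def tame (n : ℕ) (f g : 𝓢(E d, ℂ)) : ℝ :=
  ∑ p ∈ Finset.HasAntidiagonal.antidiagonal n,
    min (q (p.1 + 4 * d) f * q p.2 g) (q p.1 f * q (p.2 + 4 * d) g)

theorem tame_op_left (n : ℕ) (l) (f g : 𝓢(E d, ℂ)) : tame n (op l f) g ≤ tame (n + 1) f g := by
  unfold tame
  rw [Finset.Nat.sum_antidiagonal_succ]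
  refine le_trans ?_ (le_add_of_nonneg_left (le_min
    (mul_nonneg (apply_nonneg _ _) (apply_nonneg _ _))
    (mul_nonneg (apply_nonneg _ _) (apply_nonneg _ _))))
  refine Finset.sum_le_sum fun p _ => min_le_min ?_ ?_
  · refine mul_le_mul_of_nonneg_right ?_ (apply_nonneg _ _)
    have := q_op_le (p.1 + 4 * d) l f
    rwa [add_right_comm] at this
  · exact mul_le_mul_of_nonneg_right (q_op_le _ _ _) (apply_nonneg _ _)

theorem tame_op_right (n : ℕ) (l) (f g : 𝓢(E d, ℂ)) : tame n f (op l g) ≤ tame (n + 1) f g := by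
  unfold tame
  rw [Finset.Nat.sum_antidiagonal_succ']
  refine le_trans ?_ (le_add_of_nonneg_left (le_min
    (mul_nonneg (apply_nonneg _ _) (apply_nonneg _ _))
    (mul_nonneg (apply_nonneg _ _) (apply_nonneg _ _))))
  refine Finset.sum_le_sum fun p _ => min_le_min ?_ ?_
  · exact mul_le_mul_of_nonneg_left (q_op_le _ _ _) (apply_nonneg _ _)
  · refine mul_le_mul_of_nonneg_left ?_ (apply_nonneg _ _)
    have := q_op_le (p.2 + 4 * d) l g
    rwa [add_right_comm] at this

/-- Each letter falls on one of the two factors or on the weight, whose exponent only decreases.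
When no letter is left, the weighted supremum may be taken on either factor; hence the minimum in
`tame`. -/
theorem exists_q_mulWt_smul'_le_tame (n : ℕ) : ∀ r ≤ (d : ℝ), ∃ C, 0 ≤ C ∧
    ∀ f g : 𝓢(E d, ℂ), q n (mulWt r (smul' f g)) ≤ C * tame n f g := by
  induction n with
  | zero =>
    intro r hr
    obtain ⟨C, hC, h⟩ := exists_wt_norm_le_q (d := d)
    refine ⟨C, hC, fun f g => ?_⟩
    simp only [tame, Finset.Nat.antidiagonal_zero, Finset.sum_singleton, zero_add]
    rw [mul_min_of_nonneg _ _ hC]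
    refine le_min ?_ ?_
    · rw [← mul_assoc]
      refine q_zero_le_of_norm_le fun x => ?_
      rw [mulWt_apply, smul'_apply, norm_mul, norm_mul, Complex.norm_real,
        Real.norm_of_nonneg (wt_pos _ x).le, ← mul_assoc]
      exact mul_le_mul_of_nonneg_right (h r hr f x) (norm_nonneg _)
    · rw [mul_left_comm, mul_comm]
      refine q_zero_le_of_norm_le fun x => ?_
      rw [mulWt_apply, smul'_apply, norm_mul, norm_mul, Complex.norm_real,
        Real.norm_of_nonneg (wt_pos _ x).le, mul_comm ‖f x‖, ← mul_assoc]
      exact mul_le_mul_of_nonneg_right (h r hr g x) (norm_nonneg _)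
  | succ n ih =>
    intro r hr
    obtain ⟨C, hC, h⟩ := ih r hr
    obtain ⟨C', hC', h'⟩ := ih (r - 1) (by linarith)
    set k : ℂ := ((2 * r / ((d : ℝ) * ((d : ℝ) - 2)) : ℝ) : ℂ) with hk
    refine ⟨C + (d * (C + C + ‖k‖ * C') + d * C), by positivity, fun f g => ?_⟩
    rw [q_succ]
    set B := tame (n + 1) f g
    have b1 : ∀ l, tame n (op l f) g ≤ B := fun l => tame_op_left n l f g
    have b2 : ∀ l, tame n f (op l g) ≤ B := fun l => tame_op_right n l f g
    have e0 : q n (mulWt r (smul' f g)) ≤ C * B :=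
      (h f g).trans (mul_le_mul_of_nonneg_left (b1 none) hC)
    have e1 : ∑ j, q n (der j (mulWt r (smul' f g))) ≤ ∑ _j : Fin d, (C + C + ‖k‖ * C') * B := by
      refine Finset.sum_le_sum fun j _ => ?_
      rw [der_mulWt, der_smul', map_add (mulWt r), pos_smul']
      refine (map_add_le_add _ _ _).trans ?_
      rw [map_smul_eq_mul, add_mul, add_mul, mul_assoc]
      refine add_le_add ((map_add_le_add _ _ _).trans (add_le_add ?_ ?_)) ?_
      · exact (h _ _).trans (mul_le_mul_of_nonneg_left (b1 _) hC)
      · exact (h _ _).trans (mul_le_mul_of_nonneg_left (b2 _) hC)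
      · exact mul_le_mul_of_nonneg_left ((h' _ _).trans (mul_le_mul_of_nonneg_left (b1 _) hC'))
          (norm_nonneg _)
    have e2 : ∑ j, q n (pos j (mulWt r (smul' f g))) ≤ ∑ _j : Fin d, C * B := by
      refine Finset.sum_le_sum fun j _ => ?_
      rw [pos_mulWt, pos_smul']
      exact (h _ _).trans (mul_le_mul_of_nonneg_left (b1 _) hC)
    simp only [Finset.sum_const, Finset.card_univ, Fintype.card_fin, nsmul_eq_mul] at e1 e2
    calc _ ≤ C * B + (d * ((C + C + ‖k‖ * C') * B) + d * (C * B)) := add_le_add e0 (add_le_add e1 e2)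
      _ = _ := by ring

/-- The weighted algebra property: `q_n(P f g) ≤ C q_n(f) q_n(g)` for `n ≥ 8 d`. -/
theorem exists_q_mulWt_smul'_le {n : ℕ} (hn : 8 * d ≤ n) {r : ℝ} (hr : r ≤ d) : ∃ C, 0 ≤ C ∧
    ∀ f g : 𝓢(E d, ℂ), q n (mulWt r (smul' f g)) ≤ C * (q n f * q n g) := by
  obtain ⟨C, hC, h⟩ := exists_q_mulWt_smul'_le_tame (d := d) n r hr
  refine ⟨C * (n + 1), by positivity, fun f g => (h f g).trans ?_⟩
  rw [mul_assoc]
  refine mul_le_mul_of_nonneg_left ?_ hC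
  calc tame n f g ≤ ∑ p ∈ Finset.HasAntidiagonal.antidiagonal n, q n f * q n g := by
        refine Finset.sum_le_sum fun p hp => ?_
        have hp' := Finset.HasAntidiagonal.mem_antidiagonal.mp hp
        -- The factor with fewer letters takes the supremum norm: it has at most `n / 2` of them,
        -- and `n / 2 + 4 d ≤ n` is the origin of the threshold `8 d`.
        rcases le_total p.1 p.2 with h1 | h1
        · exact (min_le_left _ _).trans (mul_le_mul (q_mono (by omega) f) (q_mono (by omega) g)
            (apply_nonneg _ _) (apply_nonneg _ _))
        · exact (min_le_right _ _).trans (mul_le_mul (q_mono (by omega) f) (q_mono (by omega) g)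
            (apply_nonneg _ _) (apply_nonneg _ _))
    _ = _ := by simp

end

end EnergyCriticalNLS

namespace EnergyCriticalNLS

open scoped LineDeriv FourierTransform

variable {d : ℕ}

/-! ### The free Schrödinger group on Schwartz functions -/

/-- The phase `-4π²t|ξ|²`. -/
noncomputable def phase (t : ℝ) (ξ : E d) : ℝ := -((2 * Real.pi) ^ 2 * t * ‖ξ‖ ^ 2)

/-- The symbol `e^{-4π²it|ξ|²}` of `e^{itΔ}`. -/
noncomputable def symb (t : ℝ) (ξ : E d) : ℂ := Complex.exp (Complex.I * phase t ξ)

theorem norm_symb (t : ℝ) (ξ : E d) : ‖symb t ξ‖ = 1 := by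
  rw [symb, mul_comm]; exact Complex.norm_exp_ofReal_mul_I _

theorem symb_add (s t : ℝ) (ξ : E d) : symb (s + t) ξ = symb s ξ * symb t ξ := by
  rw [symb, symb, symb, ← Complex.exp_add]; congr 1; simp only [phase]; push_cast; ring

theorem phase_hasFDerivAt (t : ℝ) (ξ : E d) :
    HasFDerivAt (phase (d := d) t) ((-((2 * Real.pi) ^ 2 * t)) • (2 • innerSL ℝ ξ)) ξ := by
  refine ((hasStrictFDerivAt_norm_sq ξ).hasFDerivAt.const_mul
    (-((2 * Real.pi) ^ 2 * t))).congr_of_eventuallyEq (Eventually.of_forall fun y => ?_)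
  simp only [phase]; ring

theorem symb_hasFDerivAt (t : ℝ) (ξ : E d) :
    HasFDerivAt (symb (d := d) t) (symb t ξ • (Complex.I •
      (Complex.ofRealCLM.comp ((-((2 * Real.pi) ^ 2 * t)) • (2 • innerSL ℝ ξ))))) ξ :=
  ((((Complex.ofRealCLM.hasFDerivAt (x := phase t ξ)).comp ξ
    (phase_hasFDerivAt t ξ)).const_mul Complex.I)).cexp

theorem expI_temperate : Function.HasTemperateGrowth (fun s : ℝ => Complex.exp (Complex.I * s)) := by
  have hd : ∀ s : ℝ, HasDerivAt (fun s : ℝ => Complex.exp (Complex.I * s))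
      (Complex.I * Complex.exp (Complex.I * s)) s := by
    intro s
    have := (((Complex.ofRealCLM.hasDerivAt (x := s)).const_mul Complex.I)).cexp
    simpa [mul_comm] using this
  have hc : ContDiff ℝ ∞ (fun s : ℝ => Complex.exp (Complex.I * s)) := by
    refine ContDiff.cexp (contDiff_const.mul Complex.ofRealCLM.contDiff)
  have hi : ∀ n : ℕ, iteratedDeriv n (fun s : ℝ => Complex.exp (Complex.I * s)) =
      fun s : ℝ => Complex.I ^ n * Complex.exp (Complex.I * s) := by
    intro n
    induction n with
    | zero => simp
    | succ n ih =>
      rw [iteratedDeriv_succ, ih]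
      funext s
      rw [((hd s).const_mul _).deriv, pow_succ]; ring
  refine ⟨hc, fun n => ⟨0, 1, fun x => ?_⟩⟩
  rw [norm_iteratedFDeriv_eq_norm_iteratedDeriv, hi]
  simp [mul_comm Complex.I, Complex.norm_exp_ofReal_mul_I]

theorem symb_temperate (t : ℝ) : Function.HasTemperateGrowth (symb (d := d) t) := by
  have h : Function.HasTemperateGrowth (phase (d := d) t) := by
    unfold phase; fun_prop
  exact expI_temperate.comp h

/-- The free Schrödinger group `e^{itΔ}` on Schwartz functions. -/
noncomputable def grp (t : ℝ) : 𝓢(E d, ℂ) →L[ℂ] 𝓢(E d, ℂ) :=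
  SchwartzMap.fourierMultiplierCLM ℂ (symb t)

theorem fourier_grp (t : ℝ) (f : 𝓢(E d, ℂ)) :
    𝓕 (grp t f) = SchwartzMap.smulLeftCLM ℂ (symb t) (𝓕 f) := by
  rw [grp, SchwartzMap.fourierMultiplierCLM_apply, FourierTransform.fourier_fourierInv_eq]

theorem fourier_grp_apply (t : ℝ) (f : 𝓢(E d, ℂ)) (ξ : E d) :
    𝓕 (grp t f) ξ = symb t ξ * 𝓕 f ξ := by
  rw [fourier_grp, SchwartzMap.smulLeftCLM_apply_apply (symb_temperate t), smul_eq_mul]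

theorem fourier_inj {f g : 𝓢(E d, ℂ)} (h : ∀ ξ, 𝓕 f ξ = 𝓕 g ξ) : f = g := by
  have : 𝓕 f = 𝓕 g := by ext ξ; exact h ξ
  have h2 : 𝓕⁻ (𝓕 f : 𝓢(E d, ℂ)) = 𝓕⁻ (𝓕 g : 𝓢(E d, ℂ)) := by rw [this]
  rwa [FourierTransform.fourierInv_fourier_eq, FourierTransform.fourierInv_fourier_eq] at h2

theorem grp_grp (s t : ℝ) (f : 𝓢(E d, ℂ)) : grp s (grp t f) = grp (s + t) f :=
  fourier_inj fun ξ => by simp only [fourier_grp_apply, symb_add, mul_assoc]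

theorem grp_zero (f : 𝓢(E d, ℂ)) : grp 0 f = f :=
  fourier_inj fun ξ => by simp [fourier_grp_apply, symb, phase]

theorem fourier_der_apply (j : Fin d) (f : 𝓢(E d, ℂ)) (ξ : E d) :
    𝓕 (der j f) ξ = 2 * Real.pi * Complex.I * (ξ j * 𝓕 f ξ) := by
  rw [der_eq, SchwartzMap.fourier_lineDerivOp_eq]
  rw [_root_.smul_apply, SchwartzMap.smulLeftCLM_apply_apply (by fun_prop),
    EuclideanSpace.inner_single_right]
  simp

theorem fourier_pos_apply (j : Fin d) (f : 𝓢(E d, ℂ)) (ξ : E d) :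
    der j (𝓕 f) ξ = -(2 * Real.pi * Complex.I) * 𝓕 (pos j f) ξ := by
  rw [der_eq, SchwartzMap.lineDerivOp_fourier_eq]
  have : SchwartzMap.smulLeftCLM ℂ (fun x : E d => inner ℝ x (EuclideanSpace.single j (1 : ℝ))) f
      = pos j f := by
    ext x
    rw [SchwartzMap.smulLeftCLM_apply_apply (by fun_prop), pos_apply,
      EuclideanSpace.inner_single_right]
    simp
  rw [this, FourierTransform.fourier_smul, _root_.smul_apply, smul_eq_mul]

theorem grp_der (t : ℝ) (j : Fin d) (f : 𝓢(E d, ℂ)) : der j (grp t f) = grp t (der j f) :=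
  fourier_inj fun ξ => by simp only [fourier_der_apply, fourier_grp_apply]; ring

/-- `x_j e^{itΔ} = e^{itΔ} (x_j - 2it∂_j)`. -/
theorem grp_pos (t : ℝ) (j : Fin d) (f : 𝓢(E d, ℂ)) :
    pos j (grp t f) = grp t (pos j f) + (-(2 * Complex.I * t)) • grp t (der j f) := by
  refine fourier_inj fun ξ => ?_
  have hpi : (2 * Real.pi * Complex.I : ℂ) ≠ 0 := by simp [Real.pi_ne_zero]
  -- On the Fourier side a coordinate is a derivative; the product rule applied to the symbol
  -- produces the extra term.
  have h1 := fourier_pos_apply j (grp t f) ξ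
  have h2 := fourier_pos_apply j f ξ
  have e : ((𝓕 (grp t f) : 𝓢(E d, ℂ)) : E d → ℂ) = symb t * ((𝓕 f : 𝓢(E d, ℂ)) : E d → ℂ) := by
    funext y; exact fourier_grp_apply t f y
  rw [der_apply, e, ((symb_hasFDerivAt t ξ).mul ((𝓕 f).hasFDerivAt ξ)).fderiv] at h1
  rw [der_apply] at h2
  have hin : inner ℝ ξ (EuclideanSpace.single j (1 : ℝ)) = ξ j := by
    rw [EuclideanSpace.inner_single_right]; simp
  simp only [_root_.add_apply, _root_.smul_apply, h2, ContinuousLinearMap.comp_apply,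
    innerSL_apply_apply, hin, smul_eq_mul, nsmul_eq_mul, Complex.ofRealCLM_apply] at h1
  rw [FourierTransform.fourier_add, FourierTransform.fourier_smul, _root_.add_apply,
    _root_.smul_apply, fourier_grp_apply, fourier_grp_apply, fourier_der_apply]
  apply mul_left_cancel₀ (neg_ne_zero.mpr hpi)
  rw [← h1]
  push_cast
  rw [smul_eq_mul]
  ring_nf
  simp only [Complex.I_sq, Complex.I_pow_three]
  ring

theorem q_zero_eq_fourier (f : 𝓢(E d, ℂ)) : q 0 f = q 0 (𝓕 f) := by
  rw [q_zero_apply, q_zero_apply, SchwartzMap.norm_fourier_toL2_eq]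

theorem q_zero_grp_le (t : ℝ) (f : 𝓢(E d, ℂ)) : q 0 (grp t f) ≤ q 0 f := by
  rw [q_zero_eq_fourier, q_zero_eq_fourier f, ← one_mul (q 0 (𝓕 f))]
  refine q_zero_le_of_norm_le fun ξ => ?_
  rw [fourier_grp_apply, norm_mul, norm_symb]

/-- Derivatives commute with the group, and each coordinate costs at most a further `2|t|` times a
derivative. The growth is only polynomial in time, which is what lets Duhamel integrals from
infinity converge against exponentially decaying sources. -/
theorem q_grp_le (n : ℕ) (t : ℝ) (f : 𝓢(E d, ℂ)) :
    q n (grp t f) ≤ (1 + 2 * |t|) ^ n * q n f := by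
  induction n generalizing f with
  | zero => simpa using q_zero_grp_le t f
  | succ n ih =>
    rw [q_succ, q_succ]
    have hk : ‖(-(2 * Complex.I * t) : ℂ)‖ = 2 * |t| := by simp
    have e1 : ∑ j, q n (der j (grp t f)) ≤ (1 + 2 * |t|) ^ n * ∑ j, q n (der j f) := by
      rw [Finset.mul_sum]
      refine Finset.sum_le_sum fun j _ => ?_
      rw [grp_der]; exact ih _
    have e2 : ∑ j, q n (pos j (grp t f)) ≤ (1 + 2 * |t|) ^ n * (∑ j, q n (pos j f) +
        2 * |t| * ∑ j, q n (der j f)) := by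
      rw [Finset.mul_sum, ← Finset.sum_add_distrib, Finset.mul_sum]
      refine Finset.sum_le_sum fun j _ => ?_
      rw [grp_pos]
      refine (map_add_le_add _ _ _).trans ?_
      rw [map_smul_eq_mul, hk, mul_add, mul_left_comm]
      gcongr
      · exact ih _
      · exact ih _
    have e0 := ih f
    have a1 : 0 ≤ ∑ j, q n (der j f) := Finset.sum_nonneg fun _ _ => apply_nonneg _ _
    have a2 : 0 ≤ ∑ j, q n (pos j f) := Finset.sum_nonneg fun _ _ => apply_nonneg _ _
    have a3 : 0 ≤ q n f := apply_nonneg _ _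
    have a4 : 0 ≤ 2 * |t| := by positivity
    have a5 : 0 ≤ (1 + 2 * |t|) ^ n := by positivity
    calc _ ≤ (1 + 2 * |t|) ^ n * (q n f + (∑ j, q n (der j f) + (∑ j, q n (pos j f) +
        2 * |t| * ∑ j, q n (der j f)))) := by
          rw [mul_add, mul_add]; exact add_le_add e0 (add_le_add e1 e2)
      _ ≤ (1 + 2 * |t|) ^ n * ((1 + 2 * |t|) * (q n f + (∑ j, q n (der j f) + ∑ j, q n (pos j f)))) := by
          gcongr
          nlinarith [mul_nonneg a4 a2, mul_nonneg a4 a3]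
      _ = _ := by rw [pow_succ]; ring

theorem fourier_laplacian_apply (f : 𝓢(E d, ℂ)) (ξ : E d) :
    𝓕 (Δ f) ξ = -((2 * Real.pi) ^ 2 * ‖ξ‖ ^ 2 : ℝ) * 𝓕 f ξ := by
  rw [SchwartzMap.laplacian_eq_fourierMultiplierCLM, SchwartzMap.fourierMultiplierCLM_apply,
    ← FourierTransform.fourierInv_smul, FourierTransform.fourier_fourierInv_eq, _root_.smul_apply,
    SchwartzMap.smulLeftCLM_apply_apply (by fun_prop)]
  simp; ring

/-- First order Taylor bound for the group in `L²`. -/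
theorem q_zero_grp_sub_le (t : ℝ) (f : 𝓢(E d, ℂ)) : q 0 (grp t f - f) ≤ |t| * q 0 (Δ f) := by
  rw [q_zero_eq_fourier, q_zero_eq_fourier (Δ f)]
  refine q_zero_le_of_norm_le fun ξ => ?_
  rw [sub_eq_add_neg, ← neg_one_smul ℂ f, FourierTransform.fourier_add,
    FourierTransform.fourier_smul, _root_.add_apply, _root_.smul_apply, fourier_grp_apply,
    fourier_laplacian_apply, smul_eq_mul, ← add_mul, norm_mul, norm_mul, norm_neg, ← mul_assoc,
    Complex.norm_real, ← sub_eq_add_neg]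
  gcongr
  refine Real.norm_exp_I_mul_ofReal_sub_one_le.trans (le_of_eq ?_)
  rw [phase, norm_neg, ← Real.norm_eq_abs, ← norm_mul]
  congr 1; ring

theorem norm_exp_I_mul_sub_le (θ : ℝ) :
    ‖Complex.exp (Complex.I * θ) - 1 - Complex.I * θ‖ ≤ 2 * θ ^ 2 := by
  have h0 : ‖Complex.I * (θ : ℂ)‖ = |θ| := by simp
  rcases le_total |θ| 1 with h | h
  · have := Complex.norm_exp_sub_one_sub_id_le (x := Complex.I * θ) (by rw [h0]; exact h)
    rw [h0, sq_abs] at this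
    nlinarith [sq_nonneg θ]
  · have h1 := Real.norm_exp_I_mul_ofReal_sub_one_le (x := θ)
    have h2 := norm_sub_le (Complex.exp (Complex.I * θ) - 1) (Complex.I * θ)
    rw [h0] at h2
    rw [Real.norm_eq_abs] at h1
    have h3 : |θ| ≤ θ ^ 2 := by rw [← sq_abs]; nlinarith
    linarith

/-- Second order Taylor bound for the group in `L²`. -/
theorem q_zero_grp_sub_sub_le (t : ℝ) (f : 𝓢(E d, ℂ)) :
    q 0 (grp t f - f - (Complex.I * t) • Δ f) ≤ 2 * t ^ 2 * q 0 (Δ (Δ f)) := by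
  rw [q_zero_eq_fourier, q_zero_eq_fourier (Δ (Δ f))]
  refine q_zero_le_of_norm_le fun ξ => ?_
  have e : grp t f - f - (Complex.I * t) • Δ f =
      grp t f + ((-1 : ℂ) • f + (-(Complex.I * t)) • Δ f) := by
    rw [neg_one_smul, neg_smul]; abel
  rw [e, FourierTransform.fourier_add, FourierTransform.fourier_add, FourierTransform.fourier_smul,
    FourierTransform.fourier_smul, _root_.add_apply, _root_.add_apply, _root_.smul_apply,
    _root_.smul_apply, fourier_grp_apply, fourier_laplacian_apply, fourier_laplacian_apply,
    fourier_laplacian_apply, smul_eq_mul, smul_eq_mul]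
  have e2 : symb t ξ * 𝓕 f ξ + (-1 * 𝓕 f ξ + -(Complex.I * t) *
      (-((2 * Real.pi) ^ 2 * ‖ξ‖ ^ 2 : ℝ) * 𝓕 f ξ)) =
      (symb t ξ - 1 - Complex.I * (phase t ξ : ℝ)) * 𝓕 f ξ := by
    simp only [phase]; push_cast; ring
  rw [e2, norm_mul, norm_mul, norm_mul, norm_neg, ← mul_assoc, ← mul_assoc, Complex.norm_real]
  gcongr
  refine (norm_exp_I_mul_sub_le _).trans (le_of_eq ?_)
  rw [mul_assoc (2 * t ^ 2), ← norm_mul, Real.norm_of_nonneg (by positivity), phase]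
  ring

/-- By induction on letters: the commutator of a coordinate with the group carries an explicit
factor `t`, which tends to zero. -/
theorem tendsto_q_grp_sub (n : ℕ) (f : 𝓢(E d, ℂ)) :
    Tendsto (fun t => q n (grp t f - f)) (𝓝 0) (𝓝 0) := by
  induction n generalizing f with
  | zero =>
    refine squeeze_zero (fun t => apply_nonneg _ _) (fun t => q_zero_grp_sub_le t f) ?_
    have : Tendsto (fun t : ℝ => |t| * q 0 (Δ f)) (𝓝 0) (𝓝 (|0| * q 0 (Δ f))) :=
      (continuous_abs.mul continuous_const).tendsto 0
    simpa using this
  | succ n ih =>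
    have hb : ∀ t, q (n + 1) (grp t f - f) ≤ q n (grp t f - f) + (∑ j, q n (grp t (der j f) - der j f)
        + ∑ j, (q n (grp t (pos j f) - pos j f) + 2 * |t| * ((1 + 2 * |t|) ^ n * q n (der j f)))) := by
      intro t
      rw [q_succ]
      gcongr with j _ j _
      · rw [map_sub, grp_der]
      · rw [map_sub, grp_pos, add_sub_right_comm]
        refine (map_add_le_add _ _ _).trans ?_
        rw [map_smul_eq_mul]
        have hk : ‖(-(2 * Complex.I * t) : ℂ)‖ = 2 * |t| := by simp
        rw [hk]
        gcongr
        exact q_grp_le _ _ _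
    refine squeeze_zero (fun t => apply_nonneg _ _) hb ?_
    have h2 : ∀ j, Tendsto (fun t : ℝ => 2 * |t| * ((1 + 2 * |t|) ^ n * q n (der j f))) (𝓝 0) (𝓝 0) := by
      intro j
      have : Continuous (fun t : ℝ => 2 * |t| * ((1 + 2 * |t|) ^ n * q n (der j f))) := by fun_prop
      simpa using this.tendsto 0
    have := (ih f).add ((tendsto_finsetSum Finset.univ fun j _ => ih (der j f)).add
      (tendsto_finsetSum Finset.univ fun j _ => (ih (pos j f)).add (h2 j)))
    simpa using this

/-- The group is symmetric for the bilinear pairing. -/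
theorem integral_grp_mul (t : ℝ) (f g : 𝓢(E d, ℂ)) :
    ∫ x, grp t f x * g x = ∫ x, f x * grp t g x := by
  -- `R` is the reflection `x ↦ -x`. The inverse Fourier transform is `R` after the Fourier
  -- transform and the symbol is even, so in the definition of the group the two transforms may be
  -- exchanged; then `∫ 𝓕f g = ∫ f 𝓕g` moves the multiplier across.
  set R := SchwartzMap.compCLMOfContinuousLinearEquiv (F := ℂ) ℂ
    (ContinuousLinearEquiv.neg ℝ (M := E d)) with hR
  have hR_apply : ∀ (h : 𝓢(E d, ℂ)) x, R h x = h (-x) := fun h x => by simp [hR]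
  have hinv : ∀ h : 𝓢(E d, ℂ), 𝓕⁻ h = R (𝓕 h) := fun h => by
    ext x; rw [hR_apply, SchwartzMap.fourierInv_apply_eq]; simp
  have hFR : ∀ h : 𝓢(E d, ℂ), 𝓕 (R h) = R (𝓕 h) := fun h => by
    obtain ⟨k, rfl⟩ : ∃ k : 𝓢(E d, ℂ), 𝓕 k = h := ⟨𝓕⁻ h, FourierTransform.fourier_fourierInv_eq h⟩
    rw [← hinv k, ← hinv, FourierTransform.fourier_fourierInv_eq,
      FourierTransform.fourierInv_fourier_eq]
  have hm : ∀ h : 𝓢(E d, ℂ), SchwartzMap.smulLeftCLM ℂ (symb t) (R h) =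
      R (SchwartzMap.smulLeftCLM ℂ (symb t) h) := fun h => by
    ext x
    rw [hR_apply, SchwartzMap.smulLeftCLM_apply_apply (symb_temperate t),
      SchwartzMap.smulLeftCLM_apply_apply (symb_temperate t), hR_apply]
    simp [symb, phase]
  have key : grp t g = 𝓕 (SchwartzMap.smulLeftCLM ℂ (symb t) (𝓕⁻ g)) := by
    rw [hinv, hm, hFR, ← hinv]; rfl
  rw [key, ← SchwartzMap.integral_fourier_mul_eq]
  have : ∫ x, grp t f x * g x = ∫ x, (SchwartzMap.smulLeftCLM ℂ (symb t) (𝓕 f)) x * 𝓕⁻ g x :=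
    SchwartzMap.integral_fourierInv_mul_eq _ _
  rw [this]
  congr 1
  funext x
  rw [SchwartzMap.smulLeftCLM_apply_apply (symb_temperate t),
      SchwartzMap.smulLeftCLM_apply_apply (symb_temperate t), smul_eq_mul, smul_eq_mul]
  ring

/-! ### Complex conjugation -/

/-- Complex conjugation on Schwartz functions. -/
noncomputable def conjS : 𝓢(E d, ℂ) →L[ℝ] 𝓢(E d, ℂ) :=
  SchwartzMap.postcompCLM (Complex.conjCLE : ℂ →L[ℝ] ℂ)

theorem conjS_apply (f : 𝓢(E d, ℂ)) (x : E d) : conjS f x = conj (f x) := by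
  simp [conjS]

theorem conjS_conjS (f : 𝓢(E d, ℂ)) : conjS (conjS f) = f := by
  ext x; simp [conjS_apply]

theorem conjS_pos (j : Fin d) (f : 𝓢(E d, ℂ)) : pos j (conjS f) = conjS (pos j f) := by
  ext x; simp [conjS_apply, pos_apply]

theorem conjS_der (j : Fin d) (f : 𝓢(E d, ℂ)) : der j (conjS f) = conjS (der j f) := by
  ext x
  rw [conjS_apply, der_apply, der_apply]
  have e : (conjS f : E d → ℂ) = (Complex.conjCLE : ℂ →L[ℝ] ℂ) ∘ f := by
    funext y; simp [conjS_apply]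
  rw [e, ((Complex.conjCLE : ℂ →L[ℝ] ℂ).hasFDerivAt.comp x (f.hasFDerivAt x)).fderiv]
  simp

theorem q_conjS_le (n : ℕ) (f : 𝓢(E d, ℂ)) : q n (conjS f) ≤ q n f := by
  induction n generalizing f with
  | zero =>
    rw [← one_mul (q 0 f)]
    exact q_zero_le_of_norm_le fun x => by simp [conjS_apply]
  | succ n ih =>
    rw [q_succ, q_succ]
    gcongr with j _ j _
    · exact ih f
    · rw [conjS_der]; exact ih _
    · rw [conjS_pos]; exact ih _

end EnergyCriticalNLS

namespace EnergyCriticalNLS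

variable {d : ℕ}

/-! ### The Banach algebra of relative perturbations of the ground state -/

/-- The functions of the form `c + h` with `h` Schwartz, together with the constant `c`. -/
def preAlg (d : ℕ) : Subalgebra ℂ (ℂ × (E d → ℂ)) where
  carrier := {p | ∃ h : 𝓢(E d, ℂ), ∀ x, p.2 x = p.1 + h x}
  mul_mem' := by
    rintro p p' ⟨h, hh⟩ ⟨h', hh'⟩
    refine ⟨p.1 • h' + p'.1 • h + smul' h h', fun x => ?_⟩
    simp only [Prod.snd_mul, Pi.mul_apply, hh, hh', Prod.fst_mul, _root_.add_apply,
      _root_.smul_apply, smul'_apply, smul_eq_mul]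
    ring
  add_mem' := by
    rintro p p' ⟨h, hh⟩ ⟨h', hh'⟩
    refine ⟨h + h', fun x => ?_⟩
    simp only [Prod.snd_add, Pi.add_apply, hh, hh', Prod.fst_add, _root_.add_apply]
    ring
  algebraMap_mem' := fun c => ⟨0, fun x => by simp [Prod.algebraMap_apply]⟩

/-- The Schwartz part of an element of `preAlg`. -/
noncomputable def part (p : preAlg d) : 𝓢(E d, ℂ) := p.2.choose

theorem part_spec (p : preAlg d) (x : E d) : p.1.2 x = p.1.1 + part p x := p.2.choose_spec x

theorem part_apply (p : preAlg d) (x : E d) : part p x = p.1.2 x - p.1.1 := by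
  rw [part_spec]; ring

theorem part_add (p p' : preAlg d) : part (p + p') = part p + part p' := by
  ext x; simp only [part_apply, _root_.add_apply]
  simp; ring

theorem part_smul (c : ℂ) (p : preAlg d) : part (c • p) = c • part p := by
  ext x; simp only [part_apply, _root_.smul_apply]
  simp; ring

theorem part_mul (p p' : preAlg d) :
    part (p * p') = p.1.1 • part p' + p'.1.1 • part p + smul' (part p) (part p') := by
  ext x; simp only [part_apply, _root_.add_apply, _root_.smul_apply, smul'_apply]
  simp; ring

theorem preAlg_ext {p p' : preAlg d} (h1 : p.1.1 = p'.1.1) (h2 : part p = part p') : p = p' := by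
  apply Subtype.ext
  refine Prod.ext h1 (funext fun x => ?_)
  rw [part_spec, part_spec, h1, h2]

/-- The exponent of the ground state as a weight. -/
noncomputable def gsExp (d : ℕ) : ℝ := -(((d : ℝ) - 2) / 2)

theorem W_eq_wt (x : E d) : W d x = wt d (gsExp d) x := rfl

/-- The number of operators in the norm. -/
def reg (d m : ℕ) : ℕ := 8 * d + 3 * m

section

variable [hd : Fact (6 ≤ d)] (m : ℕ)

/-- In terms of `W f` and `W g`, the relative product `f g` corresponds to `(W f)(W g)/W`. The
weight `1/W` has exponent `(d-2)/2 ≤ d`, which the product estimate admits. -/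
theorem exists_algConst : ∃ K : ℝ, 1 ≤ K ∧ ∀ f g : 𝓢(E d, ℂ),
    q (reg d m) (mulWt (gsExp d) (smul' f g)) ≤
      K * (q (reg d m) (mulWt (gsExp d) f) * q (reg d m) (mulWt (gsExp d) g)) := by
  have h6 := six_le_cast (d := d)
  obtain ⟨C, hC, h⟩ := exists_q_mulWt_smul'_le (d := d) (n := reg d m) (by unfold reg; omega)
    (r := -gsExp d) (by unfold gsExp; linarith)
  -- A constant at least one ensures that the rescaled norm still dominates `q`.
  refine ⟨C + 1, by linarith, fun f g => ?_⟩
  have e : mulWt (gsExp d) (smul' f g) =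
      mulWt (-gsExp d) (smul' (mulWt (gsExp d) f) (mulWt (gsExp d) g)) := by
    ext x
    have h1 := wt_add (-gsExp d) (gsExp d) x
    rw [neg_add_cancel, wt_zero] at h1
    have h2 : ((wt d (-gsExp d) x : ℝ) : ℂ) * ((wt d (gsExp d) x : ℝ) : ℂ) = 1 := by
      rw [← Complex.ofReal_mul, ← h1]; simp
    simp only [mulWt_apply, smul'_apply]
    linear_combination (-((wt d (gsExp d) x : ℝ) : ℂ) * (f x * g x)) * h2
  rw [e]
  refine (h _ _).trans ?_
  have : 0 ≤ q (reg d m) (mulWt (gsExp d) f) * q (reg d m) (mulWt (gsExp d) g) :=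
    mul_nonneg (apply_nonneg _ _) (apply_nonneg _ _)
  nlinarith

/-- The normalising constant making the norm submultiplicative. -/
noncomputable def algConst (d m : ℕ) [Fact (6 ≤ d)] : ℝ := (exists_algConst (d := d) m).choose

theorem one_le_algConst : 1 ≤ algConst d m := (exists_algConst (d := d) m).choose_spec.1

/-- The norm of relative perturbations. -/
noncomputable def relNorm (f : 𝓢(E d, ℂ)) : ℝ :=
  algConst d m * q (reg d m) (mulWt (gsExp d) f)

theorem relNorm_nonneg (f : 𝓢(E d, ℂ)) : 0 ≤ relNorm m f :=
  mul_nonneg (by linarith [one_le_algConst (d := d) m]) (apply_nonneg _ _)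

theorem relNorm_mul (f g : 𝓢(E d, ℂ)) : relNorm m (smul' f g) ≤ relNorm m f * relNorm m g := by
  have h := (exists_algConst (d := d) m).choose_spec.2 f g
  change _ ≤ algConst d m * _ at h
  have h1 := one_le_algConst (d := d) m
  unfold relNorm
  calc _ ≤ algConst d m * (algConst d m * (q (reg d m) (mulWt (gsExp d) f) *
        q (reg d m) (mulWt (gsExp d) g))) := by gcongr
    _ = _ := by ring

theorem relNorm_add (f g : 𝓢(E d, ℂ)) : relNorm m (f + g) ≤ relNorm m f + relNorm m g := by
  have h1 := one_le_algConst (d := d) m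
  unfold relNorm
  rw [map_add (mulWt (gsExp d)), ← mul_add]
  gcongr
  exact map_add_le_add _ _ _

theorem relNorm_smul (c : ℂ) (f : 𝓢(E d, ℂ)) : relNorm m (c • f) = ‖c‖ * relNorm m f := by
  unfold relNorm
  rw [map_smul (mulWt (gsExp d)), map_smul_eq_mul]; ring

theorem q_eq_zero {n : ℕ} {f : 𝓢(E d, ℂ)} (h : q n f = 0) : f = 0 := by
  have h0 : q 0 f = 0 := le_antisymm (h ▸ q_mono (Nat.zero_le n) f) (apply_nonneg _ _)
  rw [q_zero_apply, norm_eq_zero] at h0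
  have : f.toLp 2 volume = (0 : 𝓢(E d, ℂ)).toLp 2 volume := by
    rw [h0]; exact (map_zero (SchwartzMap.toLpCLM ℂ ℂ 2 volume)).symm
  exact SchwartzMap.injective_toLp 2 volume this

theorem relNorm_eq_zero {f : 𝓢(E d, ℂ)} (h : relNorm m f = 0) : f = 0 := by
  have h1 := one_le_algConst (d := d) m
  have h2 := q_eq_zero ((mul_eq_zero.mp h).resolve_left (by linarith))
  have h3 : mulWt (-gsExp d) (mulWt (gsExp d) f) = 0 := by rw [h2, map_zero]
  rwa [mulWt_mulWt, neg_add_cancel, mulWt_zero] at h3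

/-- The relative perturbations `c + h`, as a normed algebra. -/
def RelAlg (d m : ℕ) : Type := preAlg d

noncomputable instance : CommRing (RelAlg d m) := inferInstanceAs (CommRing (preAlg d))
noncomputable instance : Algebra ℂ (RelAlg d m) := inferInstanceAs (Algebra ℂ (preAlg d))

/-- The constant part of an element of `RelAlg`. -/
noncomputable def cpart {m : ℕ} (p : RelAlg d m) : ℂ := Prod.fst (Subtype.val (p : preAlg d))

/-- The Schwartz part of an element of `RelAlg`. -/
noncomputable def spart {m : ℕ} (p : RelAlg d m) : 𝓢(E d, ℂ) := part (d := d) p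

variable {m}

theorem cpart_zero : cpart (0 : RelAlg d m) = 0 := rfl
theorem cpart_add (p p' : RelAlg d m) : cpart (p + p') = cpart p + cpart p' := rfl
theorem cpart_smul (c : ℂ) (p : RelAlg d m) : cpart (c • p) = c * cpart p := rfl
theorem cpart_mul (p p' : RelAlg d m) : cpart (p * p') = cpart p * cpart p' := rfl
theorem spart_add (p p' : RelAlg d m) : spart (p + p') = spart p + spart p' :=
  part_add (d := d) p p'
theorem spart_smul (c : ℂ) (p : RelAlg d m) : spart (c • p) = c • spart p :=
  part_smul (d := d) c p
theorem spart_mul (p p' : RelAlg d m) :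
    spart (p * p') = cpart p • spart p' + cpart p' • spart p + smul' (spart p) (spart p') :=
  part_mul (d := d) p p'
theorem spart_zero : spart (0 : RelAlg d m) = 0 := by
  have := spart_smul (0 : ℂ) (0 : RelAlg d m)
  rwa [zero_smul, zero_smul] at this
theorem spart_one : spart (1 : RelAlg d m) = 0 := by
  ext x
  refine (part_apply (d := d) 1 x).trans ?_
  simp
theorem relAlg_ext {p p' : RelAlg d m} (h1 : cpart p = cpart p') (h2 : spart p = spart p') :
    p = p' := preAlg_ext (d := d) h1 h2

variable (m)

/-- The norm `|c| + K q(W h)`. -/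
noncomputable def relRingNorm : RingNorm (RelAlg d m) where
  toFun p := ‖cpart p‖ + relNorm m (spart p)
  map_zero' := by
    rw [cpart_zero, spart_zero]; simp [relNorm]
  add_le' p p' := by
    rw [spart_add, cpart_add]
    have := relNorm_add m (spart p) (spart p')
    have h2 := norm_add_le (cpart p) (cpart p')
    linarith
  neg' p := by
    have h : -p = (-1 : ℂ) • p := by simp
    rw [h, spart_smul, cpart_smul, relNorm_smul]; simp
  mul_le' p p' := by
    rw [spart_mul, cpart_mul]
    have h1 := relNorm_add m (cpart p • spart p' + cpart p' • spart p) (smul' (spart p) (spart p'))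
    have h2 := relNorm_add m (cpart p • spart p') (cpart p' • spart p)
    have h3 := relNorm_mul m (spart p) (spart p')
    rw [relNorm_smul, relNorm_smul] at h2
    rw [norm_mul]
    nlinarith
  eq_zero_of_map_eq_zero' p h := by
    have h1 := relNorm_nonneg m (spart p)
    have h2 := norm_nonneg (cpart p)
    have h3 : ‖cpart p‖ = 0 := by linarith
    have h4 : relNorm m (spart p) = 0 := by linarith
    refine relAlg_ext (by rw [cpart_zero]; simpa using h3) ?_
    rw [relNorm_eq_zero m h4, spart_zero]

noncomputable instance : NormedCommRing (RelAlg d m) :=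
  { (relRingNorm (d := d) m).toNormedRing, (inferInstance : CommRing (RelAlg d m)) with }

theorem relAlg_norm_def (p : RelAlg d m) : ‖p‖ = ‖cpart p‖ + relNorm m (spart p) := rfl

noncomputable instance : NormedAlgebra ℂ (RelAlg d m) where
  norm_smul_le c p := by
    rw [relAlg_norm_def, relAlg_norm_def, cpart_smul, spart_smul, relNorm_smul]
    simp [mul_add]

/-- The completed Banach algebra. -/
def Alg (d m : ℕ) [Fact (6 ≤ d)] : Type := UniformSpace.Completion (RelAlg d m)

noncomputable instance : NormedCommRing (Alg d m) :=
  inferInstanceAs (NormedCommRing (UniformSpace.Completion (RelAlg d m)))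
noncomputable instance : NormedAlgebra ℂ (Alg d m) :=
  inferInstanceAs (NormedAlgebra ℂ (UniformSpace.Completion (RelAlg d m)))
instance : CompleteSpace (Alg d m) :=
  inferInstanceAs (CompleteSpace (UniformSpace.Completion (RelAlg d m)))

/-- The pair `(c, f)` as a pre-algebra element `c + f/W`. -/
noncomputable def mkRel (p : ℂ × 𝓢(E d, ℂ)) : RelAlg d m :=
  (⟨(p.1, fun x => p.1 + mulWt (-gsExp d) p.2 x), mulWt (-gsExp d) p.2, fun _ => rfl⟩ : preAlg d)

theorem cpart_mkRel (p : ℂ × 𝓢(E d, ℂ)) : cpart (mkRel m p) = p.1 := rfl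

theorem spart_mkRel (p : ℂ × 𝓢(E d, ℂ)) : spart (mkRel m p) = mulWt (-gsExp d) p.2 := by
  ext x
  refine (part_apply (d := d) (mkRel m p) x).trans ?_
  simp [mkRel]

/-- The dense embedding `(c, f) ↦ c + f/W`. -/
noncomputable def emb : (ℂ × 𝓢(E d, ℂ)) →ₗ[ℂ] Alg d m where
  toFun p := ((mkRel m p : RelAlg d m) : UniformSpace.Completion (RelAlg d m))
  map_add' p p' := by
    have : mkRel m (p + p') = mkRel m p + mkRel m p' := by
      refine relAlg_ext rfl ?_
      rw [spart_mkRel, spart_add, spart_mkRel, spart_mkRel, Prod.snd_add, map_add]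
    rw [this]; exact UniformSpace.Completion.coe_add _ _
  map_smul' c p := by
    have : mkRel m (c • p) = c • mkRel m p := by
      refine relAlg_ext rfl ?_
      rw [spart_mkRel, spart_smul, spart_mkRel, Prod.smul_snd, map_smul]
    rw [this]; exact UniformSpace.Completion.coe_smul _ _

theorem norm_emb (p : ℂ × 𝓢(E d, ℂ)) : ‖emb m p‖ = ‖p.1‖ + algConst d m * q (reg d m) p.2 := by
  have h : ‖emb m p‖ = ‖mkRel m p‖ := UniformSpace.Completion.norm_coe _
  rw [h, relAlg_norm_def, spart_mkRel, relNorm, mulWt_mulWt, add_neg_cancel, mulWt_zero]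
  rfl

theorem emb_dense : DenseRange (emb (d := d) m) := by
  have h1 : Function.Surjective (mkRel (d := d) m) := by
    intro p
    refine ⟨(cpart p, mulWt (gsExp d) (spart p)), relAlg_ext rfl ?_⟩
    rw [spart_mkRel, mulWt_mulWt, neg_add_cancel, mulWt_zero]
  exact (UniformSpace.Completion.denseRange_coe (α := RelAlg d m)).comp h1.denseRange
    (UniformSpace.Completion.continuous_coe _)

theorem emb_mul (p p' : ℂ × 𝓢(E d, ℂ)) : emb m p * emb m p' =
    emb m (p.1 * p'.1, p.1 • p'.2 + p'.1 • p.2 + mulWt (-gsExp d) (smul' p.2 p'.2)) := by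
  have : mkRel m p * mkRel m p' =
      mkRel m (p.1 * p'.1, p.1 • p'.2 + p'.1 • p.2 + mulWt (-gsExp d) (smul' p.2 p'.2)) := by
    refine relAlg_ext rfl ?_
    rw [spart_mkRel, spart_mul, spart_mkRel, spart_mkRel, cpart_mkRel, cpart_mkRel]
    ext x
    simp only [_root_.add_apply, _root_.smul_apply, mulWt_apply, smul'_apply, smul_eq_mul]
    ring
  exact (UniformSpace.Completion.coe_mul _ _).symm.trans (congrArg _ this)

theorem emb_one : emb (d := d) m (1, 0) = 1 := by
  have : mkRel (d := d) m (1, 0) = 1 := by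
    refine relAlg_ext rfl ?_
    rw [spart_mkRel, spart_one, map_zero]
  exact (congrArg ((↑) : RelAlg d m → UniformSpace.Completion (RelAlg d m)) this).trans
    (UniformSpace.Completion.coe_one _)

instance : NormOneClass (Alg d m) where
  norm_one := by rw [← emb_one, norm_emb]; simp

/-- A Schwartz function `f` as the element `f/W`. -/
noncomputable def iota : 𝓢(E d, ℂ) →ₗ[ℂ] Alg d m := (emb m).comp (LinearMap.inr ℂ ℂ 𝓢(E d, ℂ))

theorem iota_apply (f : 𝓢(E d, ℂ)) : iota m f = emb m (0, f) := rfl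

theorem norm_iota (f : 𝓢(E d, ℂ)) : ‖iota m f‖ = algConst d m * q (reg d m) f := by
  rw [iota_apply, norm_emb]; simp

theorem q_le_norm_emb (p : ℂ × 𝓢(E d, ℂ)) : q (reg d m) p.2 ≤ ‖emb m p‖ := by
  rw [norm_emb]
  have h1 := one_le_algConst (d := d) m
  have h2 : 0 ≤ q (reg d m) p.2 := apply_nonneg _ _
  have h3 := norm_nonneg p.1
  nlinarith

/-! ### Extension by density, the constant part, and pointwise evaluation -/

section lift

variable {Y : Type*} [NormedAddCommGroup Y] [NormedSpace ℂ Y] [CompleteSpace Y]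

/-- The extension to the algebra of a map on Schwartz functions bounded by the norm; it kills
constants. -/
noncomputable def lift (T : 𝓢(E d, ℂ) →ₗ[ℂ] Y) : Alg d m →L[ℂ] Y :=
  (T.comp (LinearMap.snd ℂ ℂ 𝓢(E d, ℂ))).extendOfNorm (emb m)

variable {m} {T : 𝓢(E d, ℂ) →ₗ[ℂ] Y} {C : ℝ}

theorem lift_bound (hC : 0 ≤ C) (hT : ∀ f, ‖T f‖ ≤ C * q (reg d m) f) (p : ℂ × 𝓢(E d, ℂ)) :
    ‖(T.comp (LinearMap.snd ℂ ℂ 𝓢(E d, ℂ))) p‖ ≤ C * ‖emb m p‖ :=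
  (hT p.2).trans (mul_le_mul_of_nonneg_left (q_le_norm_emb m p) hC)

theorem lift_emb (hC : 0 ≤ C) (hT : ∀ f, ‖T f‖ ≤ C * q (reg d m) f) (p : ℂ × 𝓢(E d, ℂ)) :
    lift m T (emb m p) = T p.2 :=
  LinearMap.extendOfNorm_eq (emb_dense m) ⟨C, lift_bound hC hT⟩ p

theorem norm_lift_le (hC : 0 ≤ C) (hT : ∀ f, ‖T f‖ ≤ C * q (reg d m) f) (a : Alg d m) :
    ‖lift m T a‖ ≤ C * ‖a‖ :=
  LinearMap.norm_extendOfNorm_apply_le (emb_dense m) C (lift_bound hC hT) a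

end lift

/-- The constant part. -/
noncomputable def cst : Alg d m →L[ℂ] ℂ := (LinearMap.fst ℂ ℂ 𝓢(E d, ℂ)).extendOfNorm (emb m)

theorem cst_bound (p : ℂ × 𝓢(E d, ℂ)) : ‖LinearMap.fst ℂ ℂ 𝓢(E d, ℂ) p‖ ≤ 1 * ‖emb m p‖ := by
  rw [norm_emb, one_mul]
  have h1 := one_le_algConst (d := d) m
  have h2 : 0 ≤ q (reg d m) p.2 := apply_nonneg _ _
  simp only [LinearMap.fst_apply]
  nlinarith

theorem cst_emb (p : ℂ × 𝓢(E d, ℂ)) : cst m (emb m p) = p.1 :=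
  LinearMap.extendOfNorm_eq (emb_dense m) ⟨1, cst_bound m⟩ p

theorem cst_iota (f : 𝓢(E d, ℂ)) : cst m (iota m f) = 0 := cst_emb m _

theorem cst_one : cst (d := d) m 1 = 1 := by rw [← emb_one, cst_emb]

theorem cst_mul (a b : Alg d m) : cst m (a * b) = cst m a * cst m b := by
  refine (emb_dense (d := d) m).induction_on₂ (p := fun a b => cst m (a * b) = cst m a * cst m b)
    (isClosed_eq (by fun_prop) (by fun_prop)) (fun p p' => ?_) a b
  rw [emb_mul, cst_emb, cst_emb, cst_emb]

/-- Pointwise evaluation of a Schwartz function. -/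
noncomputable def evalS (x : E d) : 𝓢(E d, ℂ) →ₗ[ℂ] ℂ where
  toFun f := f x
  map_add' _ _ := rfl
  map_smul' _ _ := rfl

theorem exists_evalConst : ∃ C, 0 ≤ C ∧ ∀ (f : 𝓢(E d, ℂ)) (x : E d),
    wt d d x * ‖f x‖ ≤ C * q (reg d m) f := by
  obtain ⟨C, hC, h⟩ := exists_wt_norm_le_q (d := d)
  exact ⟨C, hC, fun f x => (h d le_rfl f x).trans
    (mul_le_mul_of_nonneg_left (q_mono (by unfold reg; omega) f) hC)⟩

/-- The constant of the weighted Sobolev embedding. -/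
noncomputable def evalConst (d m : ℕ) [Fact (6 ≤ d)] : ℝ := (exists_evalConst (d := d) m).choose

theorem evalConst_nonneg : 0 ≤ evalConst d m := (exists_evalConst (d := d) m).choose_spec.1

theorem wt_mul_norm_le (f : 𝓢(E d, ℂ)) (x : E d) :
    wt d d x * ‖f x‖ ≤ evalConst d m * q (reg d m) f :=
  (exists_evalConst (d := d) m).choose_spec.2 f x

theorem one_le_wt {r : ℝ} (hr : 0 ≤ r) (x : E d) : 1 ≤ wt d r x :=
  (wt_zero x).symm.le.trans (wt_mono hr x)

theorem norm_evalS_le (x : E d) (f : 𝓢(E d, ℂ)) :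
    ‖evalS x f‖ ≤ evalConst d m * q (reg d m) f := by
  refine le_trans ?_ (wt_mul_norm_le m f x)
  have := one_le_wt (d := d) (Nat.cast_nonneg d) x
  change ‖f x‖ ≤ _
  nlinarith [norm_nonneg (f x)]

/-- The function represented by an element of the algebra: `f` for `c + f/W`. -/
noncomputable def fn (a : Alg d m) (x : E d) : ℂ := lift m (evalS x) a

theorem fn_emb (p : ℂ × 𝓢(E d, ℂ)) (x : E d) : fn m (emb m p) x = p.2 x :=
  lift_emb (evalConst_nonneg m) (norm_evalS_le m x) p

theorem fn_iota (f : 𝓢(E d, ℂ)) (x : E d) : fn m (iota m f) x = f x := fn_emb m _ x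

theorem fn_add (a b : Alg d m) (x : E d) : fn m (a + b) x = fn m a x + fn m b x := map_add _ _ _
theorem fn_sub (a b : Alg d m) (x : E d) : fn m (a - b) x = fn m a x - fn m b x := map_sub _ _ _
theorem fn_smul (c : ℂ) (a : Alg d m) (x : E d) : fn m (c • a) x = c * fn m a x := map_smul _ _ _

theorem continuous_fn (x : E d) : Continuous (fun a : Alg d m => fn m a x) :=
  (lift m (evalS x)).continuous

/-- The weighted embedding survives completion. The resulting decay is faster than that of `W`; it
gives integrability of `fn` and lets `W + f` be bounded by a multiple of `W`. -/
theorem wt_mul_norm_fn_le (a : Alg d m) (x : E d) :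
    wt d d x * ‖fn m a x‖ ≤ evalConst d m * ‖a‖ := by
  refine (emb_dense (d := d) m).induction_on (p := fun a => wt d d x * ‖fn m a x‖ ≤
    evalConst d m * ‖a‖) a ?_ fun p => ?_
  · exact isClosed_le (continuous_const.mul (continuous_fn m x).norm) (by fun_prop)
  · rw [fn_emb]
    exact (wt_mul_norm_le m p.2 x).trans
      (mul_le_mul_of_nonneg_left (q_le_norm_emb m p) (evalConst_nonneg m))

/-- This is `(c + f/W)(c' + f'/W)` with the denominator cleared; it makes evaluation of `c + f/W` at
a point multiplicative. -/
theorem fn_mul (a b : Alg d m) (x : E d) : (W d x : ℂ) * fn m (a * b) x =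
    (W d x : ℂ) * (cst m a * fn m b x + cst m b * fn m a x) + fn m a x * fn m b x := by
  have c1 := continuous_fn m x
  refine (emb_dense (d := d) m).induction_on₂ (p := fun a b => (W d x : ℂ) * fn m (a * b) x =
    (W d x : ℂ) * (cst m a * fn m b x + cst m b * fn m a x) + fn m a x * fn m b x)
    (isClosed_eq ?_ ?_) (fun p p' => ?_) a b
  · exact continuous_const.mul (c1.comp continuous_mul)
  · have h1 := c1.comp (continuous_fst (X := Alg d m) (Y := Alg d m))
    have h2 := c1.comp (continuous_snd (X := Alg d m) (Y := Alg d m))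
    have h3 := (cst m).continuous.comp (continuous_fst (X := Alg d m) (Y := Alg d m))
    have h4 := (cst m).continuous.comp (continuous_snd (X := Alg d m) (Y := Alg d m))
    exact (continuous_const.mul ((h3.mul h2).add (h4.mul h1))).add (h1.mul h2)
  · rw [emb_mul, fn_emb, fn_emb, fn_emb, cst_emb, cst_emb]
    have h1 := wt_add (gsExp d) (-gsExp d) x
    rw [add_neg_cancel, wt_zero] at h1
    have h2 : ((W d x : ℝ) : ℂ) * ((wt d (-gsExp d) x : ℝ) : ℂ) = 1 := by
      rw [W_eq_wt, ← Complex.ofReal_mul, ← h1]; simp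
    simp only [_root_.add_apply, _root_.smul_apply, mulWt_apply, smul'_apply, smul_eq_mul]
    linear_combination (p.2 x * p'.2 x) * h2

theorem W_pos (x : E d) : 0 < W d x := wt_pos _ x

/-- Pointwise evaluation `c + h ↦ c + h(x)` is a character of the algebra. -/
noncomputable def ev (x : E d) : Alg d m →ₐ[ℂ] ℂ :=
  AlgHom.ofLinearMap
    ((cst m + ((W d x : ℂ))⁻¹ • lift m (evalS x) : Alg d m →L[ℂ] ℂ) : Alg d m →ₗ[ℂ] ℂ)
    (by
      have h1 : lift (d := d) m (evalS x) 1 = 0 := by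
        rw [← emb_one, lift_emb (evalConst_nonneg m) (norm_evalS_le m x)]; rfl
      simp [h1, cst_one])
    (fun a b => by
      have h := fn_mul m a b x
      have hW : (W d x : ℂ) ≠ 0 := by exact_mod_cast (W_pos x).ne'
      change cst m (a * b) + (W d x : ℂ)⁻¹ * fn m (a * b) x =
        (cst m a + (W d x : ℂ)⁻¹ * fn m a x) * (cst m b + (W d x : ℂ)⁻¹ * fn m b x)
      rw [cst_mul]
      field_simp
      linear_combination h)

theorem ev_apply (x : E d) (a : Alg d m) : ev m x a = cst m a + (W d x : ℂ)⁻¹ * fn m a x := rfl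

end

end EnergyCriticalNLS

namespace EnergyCriticalNLS

variable {d : ℕ} [hd : Fact (6 ≤ d)] (m : ℕ)

/-! ### Operators on the algebra -/

/-- The lift of an operator on Schwartz functions. -/
noncomputable def liftOp (T : 𝓢(E d, ℂ) →ₗ[ℂ] 𝓢(E d, ℂ)) : Alg d m →L[ℂ] Alg d m :=
  lift m ((iota m).comp T)

variable {m} in
theorem liftOp_bound {T : 𝓢(E d, ℂ) →ₗ[ℂ] 𝓢(E d, ℂ)} {C : ℝ}
    (hT : ∀ f, q (reg d m) (T f) ≤ C * q (reg d m) f) (f : 𝓢(E d, ℂ)) :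
    ‖((iota m).comp T) f‖ ≤ algConst d m * C * q (reg d m) f := by
  have h1 := one_le_algConst (d := d) m
  rw [LinearMap.comp_apply, norm_iota, mul_assoc]
  gcongr
  exact hT f

variable {m} in
theorem liftOp_emb {T : 𝓢(E d, ℂ) →ₗ[ℂ] 𝓢(E d, ℂ)} {C : ℝ} (hC : 0 ≤ C)
    (hT : ∀ f, q (reg d m) (T f) ≤ C * q (reg d m) f) (p : ℂ × 𝓢(E d, ℂ)) :
    liftOp m T (emb m p) = iota m (T p.2) :=
  lift_emb (mul_nonneg (by linarith [one_le_algConst (d := d) m]) hC) (liftOp_bound hT) p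

variable {m} in
theorem norm_liftOp_le {T : 𝓢(E d, ℂ) →ₗ[ℂ] 𝓢(E d, ℂ)} {C : ℝ} (hC : 0 ≤ C)
    (hT : ∀ f, q (reg d m) (T f) ≤ C * q (reg d m) f) (a : Alg d m) :
    ‖liftOp m T a‖ ≤ algConst d m * C * ‖a‖ :=
  norm_lift_le (mul_nonneg (by linarith [one_le_algConst (d := d) m]) hC) (liftOp_bound hT) a

variable {m} in
theorem cst_liftOp {T : 𝓢(E d, ℂ) →ₗ[ℂ] 𝓢(E d, ℂ)} {C : ℝ} (hC : 0 ≤ C)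
    (hT : ∀ f, q (reg d m) (T f) ≤ C * q (reg d m) f) (a : Alg d m) :
    cst m (liftOp m T a) = 0 := by
  refine (emb_dense (d := d) m).induction_on (p := fun a => cst m (liftOp m T a) = 0) a
    (isClosed_eq (by fun_prop) (by fun_prop)) fun p => ?_
  rw [liftOp_emb hC hT, cst_iota]

/-- The Schrödinger group on the algebra. -/
noncomputable def grpA (t : ℝ) : Alg d m →L[ℂ] Alg d m := liftOp m (grp t).toLinearMap

theorem grpA_bound (t : ℝ) (f : 𝓢(E d, ℂ)) : q (reg d m) ((grp t).toLinearMap f) ≤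
    (1 + 2 * |t|) ^ reg d m * q (reg d m) f := q_grp_le _ _ _

theorem grpA_emb (t : ℝ) (p : ℂ × 𝓢(E d, ℂ)) : grpA m t (emb m p) = iota m (grp t p.2) :=
  liftOp_emb (by positivity) (grpA_bound m t) p

theorem grpA_iota (t : ℝ) (f : 𝓢(E d, ℂ)) : grpA m t (iota m f) = iota m (grp t f) :=
  grpA_emb m t _

theorem cst_grpA (t : ℝ) (a : Alg d m) : cst m (grpA m t a) = 0 :=
  cst_liftOp (by positivity) (grpA_bound m t) a

theorem norm_grpA_le' (t : ℝ) (a : Alg d m) :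
    ‖grpA m t a‖ ≤ algConst d m * (1 + 2 * |t|) ^ reg d m * ‖a‖ :=
  norm_liftOp_le (by positivity) (grpA_bound m t) a

/-- Polynomial growth is traded for `e^{|t|}`, so that any decay rate `γ > 1` suffices in the
Duhamel integrals. -/
theorem exists_norm_grpA_le : ∃ C, 0 < C ∧ ∀ t (a : Alg d m),
    ‖grpA m t a‖ ≤ C * Real.exp |t| * ‖a‖ := by
  have h1 := one_le_algConst (d := d) m
  set n := reg d m
  refine ⟨algConst d m * (2 ^ n * n.factorial * Real.exp (1 / 2)), by positivity, fun t a => ?_⟩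
  refine (norm_grpA_le' m t a).trans ?_
  -- The shift by `1/2` serves `(1 + 2|t|)^n = 2^n (|t| + 1/2)^n`, a multiple of a term of the
  -- exponential series.
  have h := Real.pow_div_factorial_le_exp (x := |t| + 1 / 2) (by positivity) n
  rw [div_le_iff₀ (by positivity), Real.exp_add] at h
  have e : (1 + 2 * |t|) ^ n = 2 ^ n * (|t| + 1 / 2) ^ n := by rw [← mul_pow]; congr 1; ring
  refine mul_le_mul_of_nonneg_right ?_ (norm_nonneg _)
  rw [e]
  calc algConst d m * (2 ^ n * (|t| + 1 / 2) ^ n)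
      ≤ algConst d m * (2 ^ n * (Real.exp |t| * Real.exp (1 / 2) * n.factorial)) := by gcongr
    _ = _ := by ring

theorem grpA_grpA (s t : ℝ) (a : Alg d m) : grpA m s (grpA m t a) = grpA m (s + t) a := by
  refine (emb_dense (d := d) m).induction_on
    (p := fun a => grpA m s (grpA m t a) = grpA m (s + t) a) a
    (isClosed_eq (by fun_prop) (by fun_prop)) fun p => ?_
  rw [grpA_emb, grpA_emb, grpA_iota, grp_grp]

theorem continuous_iota_grp (f : 𝓢(E d, ℂ)) : Continuous (fun t => iota m (grp t f)) := by
  rw [continuous_iff_continuousAt]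
  intro t₀
  rw [ContinuousAt, tendsto_iff_norm_sub_tendsto_zero]
  have e : ∀ t, ‖iota m (grp t f) - iota m (grp t₀ f)‖ =
      algConst d m * q (reg d m) (grp (t - t₀) (grp t₀ f) - grp t₀ f) := by
    intro t
    rw [← map_sub, norm_iota, grp_grp, sub_add_cancel]
  simp only [e]
  have h := (tendsto_q_grp_sub (reg d m) (grp t₀ f)).comp
    (tendsto_sub_nhds_zero_iff.mpr (tendsto_id (α := ℝ) (x := 𝓝 t₀)))
  simpa using h.const_mul (algConst d m)

/-- Strong continuity, jointly with the vector. -/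
theorem continuousOn_grpA {g : ℝ → Alg d m} {s : Set ℝ} (hg : ContinuousOn g s) :
    ContinuousOn (fun t => grpA m (-t) (g t)) s := by
  obtain ⟨C, hC, hb⟩ := exists_norm_grpA_le (d := d) m
  intro t₀ ht₀
  rw [ContinuousWithinAt, Metric.tendsto_nhds]
  intro ε hε
  set B := C * Real.exp (|t₀| + 1) with hB
  have hB0 : 0 < B := by positivity
  obtain ⟨p, hp⟩ := Metric.dense_iff.mp (emb_dense (d := d) m) (g t₀) (ε / (4 * B)) (by positivity)
  obtain ⟨hp, p, rfl⟩ := hp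
  rw [Metric.mem_ball, dist_eq_norm] at hp
  have c1 := (continuous_iota_grp m p.2).comp continuous_neg
  have h1 : ∀ᶠ t in 𝓝[s] t₀, dist (((fun t => iota m (grp t p.2)) ∘ Neg.neg) t)
      (((fun t => iota m (grp t p.2)) ∘ Neg.neg) t₀) < ε / 4 :=
    nhdsWithin_le_nhds (Metric.tendsto_nhds.mp (c1.continuousAt (x := t₀)) (ε / 4) (by positivity))
  have h2 := Metric.tendsto_nhds.mp (hg t₀ ht₀) (ε / (4 * B)) (by positivity)
  have h3 : ∀ᶠ t in 𝓝[s] t₀, |t| ≤ |t₀| + 1 := by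
    refine nhdsWithin_le_nhds ?_
    have := (continuous_abs (G := ℝ)).continuousAt (x := t₀) |>.eventually
      (eventually_le_nhds (show |t₀| < |t₀| + 1 by linarith))
    exact this
  filter_upwards [h1, h2, h3] with t h1 h2 h3
  have bd : ∀ t, |t| ≤ |t₀| + 1 → ∀ a : Alg d m, ‖grpA m (-t) a‖ ≤ B * ‖a‖ := by
    intro t ht a
    refine (hb (-t) a).trans ?_
    rw [hB, abs_neg]; gcongr
  rw [dist_eq_norm] at h2 ⊢
  rw [dist_eq_norm] at h1
  simp only [Function.comp] at h1
  -- Three of the four differences are small by the locally uniform bound on the group; the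
  -- remaining one by strong continuity on the dense vector `emb m p`.
  have e : grpA m (-t) (g t) - grpA m (-t₀) (g t₀) = grpA m (-t) (g t - g t₀) +
      grpA m (-t) (g t₀ - emb m p) + (iota m (grp (-t) p.2) - iota m (grp (-t₀) p.2)) +
      grpA m (-t₀) (emb m p - g t₀) := by
    simp only [map_sub, grpA_emb]; abel
  rw [e]
  have i1 := bd t h3 (g t - g t₀)
  have i2 := bd t h3 (g t₀ - emb m p)
  have i3 := bd t₀ (by linarith) (emb m p - g t₀)
  rw [norm_sub_rev (g t₀)] at i2
  have j1 : B * ‖g t - g t₀‖ < ε / 4 := by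
    rw [lt_div_iff₀ (by positivity)] at h2 ⊢; nlinarith
  have j2 : B * ‖emb m p - g t₀‖ < ε / 4 := by
    rw [lt_div_iff₀ (by positivity)] at hp ⊢; nlinarith
  have n1 := norm_add_le (grpA m (-t) (g t - g t₀) +
      grpA m (-t) (g t₀ - emb m p) + (iota m (grp (-t) p.2) - iota m (grp (-t₀) p.2)))
      (grpA m (-t₀) (emb m p - g t₀))
  have n2 := norm_add_le (grpA m (-t) (g t - g t₀) +
      grpA m (-t) (g t₀ - emb m p)) (iota m (grp (-t) p.2) - iota m (grp (-t₀) p.2))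
  have n3 := norm_add_le (grpA m (-t) (g t - g t₀)) (grpA m (-t) (g t₀ - emb m p))
  linarith

/-- Multiplication by `W^{p_c-1} = (1 + |x|²/(d(d-2)))^{-2}` on the algebra. -/
noncomputable def potA : Alg d m →L[ℂ] Alg d m := liftOp m (mulWt (-2)).toLinearMap

theorem exists_potA_bound : ∃ C, 0 ≤ C ∧ ∀ f : 𝓢(E d, ℂ),
    q (reg d m) ((mulWt (-2)).toLinearMap f) ≤ C * q (reg d m) f :=
  exists_q_mulWt_le (reg d m) (-2) (by norm_num)

theorem cst_potA (a : Alg d m) : cst m (potA m a) = 0 := by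
  obtain ⟨C, hC, h⟩ := exists_potA_bound (d := d) m
  exact cst_liftOp hC h a

theorem fn_potA (a : Alg d m) (x : E d) : fn m (potA m a) x = (wt d (-2) x : ℂ) * fn m a x := by
  obtain ⟨C, hC, h⟩ := exists_potA_bound (d := d) m
  refine (emb_dense (d := d) m).induction_on
    (p := fun a => fn m (potA m a) x = (wt d (-2) x : ℂ) * fn m a x) a
    (isClosed_eq ((continuous_fn m x).comp (potA m).continuous)
      (continuous_const.mul (continuous_fn m x))) fun p => ?_
  rw [potA, liftOp_emb hC h, fn_iota, fn_emb]
  exact mulWt_apply _ _ _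

/-- Conjugation of pairs, with values in the algebra. -/
noncomputable def preConj : (ℂ × 𝓢(E d, ℂ)) →ₛₗ[starRingEnd ℂ] Alg d m where
  toFun p := emb m (conj p.1, conjS p.2)
  map_add' p p' := by rw [← map_add]; congr 1; ext <;> simp
  map_smul' c p := by
    rw [← map_smul]; congr 1
    refine Prod.ext (by simp) ?_
    ext x
    simp [conjS_apply]

theorem preConj_bound (p : ℂ × 𝓢(E d, ℂ)) : ‖preConj m p‖ ≤ 1 * ‖emb m p‖ := by
  have h1 := one_le_algConst (d := d) m
  change ‖emb m (conj p.1, conjS p.2)‖ ≤ _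
  rw [norm_emb, norm_emb, one_mul]
  simp only [RCLike.norm_conj]
  gcongr
  exact q_conjS_le _ _

/-- Complex conjugation on the algebra. -/
noncomputable def conjA : Alg d m →SL[starRingEnd ℂ] Alg d m := (preConj m).extendOfNorm (emb m)

theorem conjA_emb (p : ℂ × 𝓢(E d, ℂ)) : conjA m (emb m p) = emb m (conj p.1, conjS p.2) :=
  LinearMap.extendOfNorm_eq (emb_dense m) ⟨1, preConj_bound m⟩ p

theorem norm_conjA_le (a : Alg d m) : ‖conjA m a‖ ≤ ‖a‖ := by
  rw [← one_mul ‖a‖]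
  exact LinearMap.norm_extendOfNorm_apply_le (emb_dense m) 1 (preConj_bound m) a

theorem cst_conjA (a : Alg d m) : cst m (conjA m a) = conj (cst m a) := by
  refine (emb_dense (d := d) m).induction_on
    (p := fun a => cst m (conjA m a) = conj (cst m a)) a
    (isClosed_eq (by fun_prop) (Complex.continuous_conj.comp (cst m).continuous)) fun p => ?_
  rw [conjA_emb, cst_emb, cst_emb]

theorem fn_conjA (a : Alg d m) (x : E d) : fn m (conjA m a) x = conj (fn m a x) := by
  refine (emb_dense (d := d) m).induction_on
    (p := fun a => fn m (conjA m a) x = conj (fn m a x)) a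
    (isClosed_eq ((continuous_fn m x).comp (conjA m).continuous)
      (Complex.continuous_conj.comp (continuous_fn m x))) fun p => ?_
  rw [conjA_emb, fn_emb, fn_emb, conjS_apply]

theorem ev_conjA (a : Alg d m) (x : E d) : ev m x (conjA m a) = conj (ev m x a) := by
  rw [ev_apply, ev_apply, cst_conjA, fn_conjA]; simp

/-- Conjugation as a real-linear map. -/
noncomputable def conjR : Alg d m →L[ℝ] Alg d m where
  toFun := conjA m
  map_add' := map_add _
  map_smul' r a := by
    rw [← Complex.coe_smul r a, map_smulₛₗ]
    simp
  cont := (conjA m).continuous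

/-! ### The nonlinearity on the algebra -/

/-- The power `(1 + h)^s` in the algebra, as a binomial series. -/
noncomputable def powA (s : ℂ) (h : Alg d m) : Alg d m := (binomialSeries (Alg d m) s).sum h

/-- The scalar coefficients are those of the complex binomial series, and since `‖1‖ = 1` the terms
have the same norms in both algebras. -/
theorem one_le_radius (s : ℂ) : 1 ≤ (binomialSeries (Alg d m) s).radius := by
  refine le_trans (binomialSeries_radius_ge_one (𝔸 := ℂ) (a := s)) ?_
  refine FormalMultilinearSeries.radius_le_of_le fun n => ?_
  rw [binomialSeries, binomialSeries, FormalMultilinearSeries.ofScalars_norm,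
    FormalMultilinearSeries.ofScalars_norm]

theorem powA_hasFPowerSeriesOnBall (s : ℂ) :
    HasFPowerSeriesOnBall (powA (d := d) m s) (binomialSeries (Alg d m) s) 0
      (binomialSeries (Alg d m) s).radius :=
  FormalMultilinearSeries.hasFPowerSeriesOnBall _ (lt_of_lt_of_le one_pos (one_le_radius m s))

theorem powA_analyticAt (s : ℂ) : AnalyticAt ℂ (powA (d := d) m s) 0 :=
  (powA_hasFPowerSeriesOnBall m s).analyticAt

theorem hasSum_powA (s : ℂ) {h : Alg d m} (hh : ‖h‖ < 1) :
    HasSum (fun n => Ring.choose s n • h ^ n) (powA m s h) := by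
  have := (powA_hasFPowerSeriesOnBall m s).hasSum (y := h) (by
    refine EMetric.mem_ball.mpr (lt_of_lt_of_le ?_ (one_le_radius m s))
    rw [edist_zero_right, ← ofReal_norm_eq_enorm]
    exact ENNReal.ofReal_lt_one.mpr hh)
  simpa using this

/-- Characters are contractive and continuous, so they carry the series in the algebra to the scalar
binomial series. Applied to pointwise evaluation and to the constant part, this identifies what
`powA` represents. -/
theorem char_powA (s : ℂ) {h : Alg d m} (hh : ‖h‖ < 1) (χ : Alg d m →ₐ[ℂ] ℂ) :
    χ (powA m s h) = (1 + χ h) ^ s := by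
  have hc : Continuous χ := map_continuous χ
  have h1 := (hasSum_powA m s hh).map χ hc
  have hz : ‖χ h‖ < 1 := (AlgHom.norm_apply_le_self χ h).trans_lt hh
  have h2 := Complex.one_add_cpow_hasFPowerSeriesOnBall_zero (a := s) |>.hasSum (y := χ h) (by
    refine EMetric.mem_ball.mpr ?_
    rw [edist_zero_right, ← ofReal_norm_eq_enorm]
    exact ENNReal.ofReal_lt_one.mpr hz)
  refine h1.unique ?_
  rw [zero_add] at h2
  have e : (⇑χ ∘ fun n => Ring.choose s n • h ^ n) =
      fun n => (binomialSeries ℂ s n) fun _ => χ h := by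
    funext n
    simp only [Function.comp, map_smul, map_pow]
    rw [binomialSeries, FormalMultilinearSeries.ofScalars_apply_eq]
  rw [e]; exact h2

/-- The exponent `α = 4/(d-2)`. -/
noncomputable def alpha (d : ℕ) : ℝ := 4 / ((d : ℝ) - 2)

theorem alpha_pos : 0 < alpha d := by
  have := six_le_cast (d := d)
  unfold alpha
  exact div_pos (by norm_num) (by linarith)

theorem alpha_le_one : alpha d ≤ 1 := by
  have := six_le_cast (d := d)
  unfold alpha
  rw [div_le_one (by linarith)]; linarith

theorem gsExp_mul_alpha : gsExp d * alpha d = -2 := by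
  have := six_le_cast (d := d)
  have h : (d : ℝ) - 2 ≠ 0 := by linarith
  unfold gsExp alpha
  field_simp; ring

theorem W_rpow_alpha (x : E d) : W d x ^ alpha d = wt d (-2) x := by
  rw [W_eq_wt, wt_rpow, gsExp_mul_alpha]

/-- The nonlinearity `F(W + f) - F(W)` in the algebra. -/
noncomputable def nlA (h : Alg d m) : Alg d m :=
  potA m (powA m ((1 + alpha d / 2 : ℝ) : ℂ) h * powA m ((alpha d / 2 : ℝ) : ℂ) (conjA m h) - 1)

/-- A product of a power series in `h` and one in `conj h`, followed by a bounded linear map.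
Conjugation restricts analyticity to real scalars. -/
theorem nlA_analyticAt : AnalyticAt ℝ (nlA (d := d) m) 0 := by
  have h1 : AnalyticAt ℝ (powA (d := d) m ((1 + alpha d / 2 : ℝ) : ℂ)) 0 :=
    (powA_analyticAt m _).restrictScalars
  have h2 : AnalyticAt ℝ (powA (d := d) m ((alpha d / 2 : ℝ) : ℂ)) (conjR m 0) := by
    rw [map_zero]; exact (powA_analyticAt m _).restrictScalars
  have h3 : AnalyticAt ℝ (fun h => powA (d := d) m ((alpha d / 2 : ℝ) : ℂ) (conjR m h)) 0 :=
    h2.comp ((conjR m).analyticAt 0)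
  exact (((potA m).restrictScalars ℝ).analyticAt _).comp ((h1.mul h3).sub analyticAt_const)

theorem cst_nlA (h : Alg d m) : cst m (nlA m h) = 0 := cst_potA m _

theorem exists_nlA_lipschitz : ∃ L δ : ℝ, 0 ≤ L ∧ 0 < δ ∧ δ < 1 ∧
    ∀ h h' : Alg d m, ‖h‖ ≤ δ → ‖h'‖ ≤ δ → ‖nlA m h - nlA m h'‖ ≤ L * ‖h - h'‖ := by
  obtain ⟨K, t, ht, hK⟩ := ((nlA_analyticAt (d := d) m).contDiffAt (n := 1)).exists_lipschitzOnWith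
  obtain ⟨ε, hε, hb⟩ := Metric.mem_nhds_iff.mp ht
  refine ⟨K, min (ε / 2) (1 / 2), K.2, by positivity, by
    exact lt_of_le_of_lt (min_le_right _ _) (by norm_num), fun h h' hh hh' => ?_⟩
  have i : ∀ h : Alg d m, ‖h‖ ≤ min (ε / 2) (1 / 2) → h ∈ t := fun h hh => hb (by
    rw [Metric.mem_ball, dist_zero_right]
    have := min_le_left (ε / 2) (1 / 2)
    linarith)
  have := hK.dist_le_mul h (i h hh) h' (i h' hh')
  rwa [dist_eq_norm, dist_eq_norm] at this

/-- The constant part as a character. -/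
noncomputable def cstHom : Alg d m →ₐ[ℂ] ℂ :=
  AlgHom.ofLinearMap (cst (d := d) m).toLinearMap (cst_one m) (cst_mul m)

/-- Positive real part keeps `w` away from the branch cut, where complex powers commute with
conjugation; the factors `w^{s/2}` and `conj w^{s/2}` then combine to `|w|^s`. -/
theorem cpow_mul_conj_cpow {w : ℂ} (hw : 0 < w.re) (s : ℝ) :
    w ^ ((1 + s / 2 : ℝ) : ℂ) * conj w ^ ((s / 2 : ℝ) : ℂ) = ((‖w‖ ^ s : ℝ) : ℂ) * w := by
  have h0 : w ≠ 0 := fun h => by simp [h] at hw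
  have harg : w.arg ≠ Real.pi := by
    intro h
    rw [Complex.arg_eq_pi_iff] at h
    linarith [h.1]
  have e1 : w ^ ((1 + s / 2 : ℝ) : ℂ) = w * w ^ ((s / 2 : ℝ) : ℂ) := by
    rw [Complex.ofReal_add, Complex.cpow_add _ _ h0]; simp
  rw [e1, Complex.conj_cpow _ _ harg, Complex.conj_ofReal, mul_assoc, Complex.mul_conj,
    mul_comm, Complex.normSq_eq_norm_sq]
  congr 2
  rw [Complex.norm_cpow_real, ← Real.rpow_natCast, ← Real.rpow_mul (norm_nonneg _)]
  congr 1; push_cast; ring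

theorem nonlin_eq (z : ℂ) : nonlin d z = ((‖z‖ ^ alpha d : ℝ) : ℂ) * z := rfl

/-- The algebra nonlinearity represents `F(W + f) - F(W)`. -/
theorem fn_nlA {h : Alg d m} (hh : ‖h‖ < 1) (h0 : cst m h = 0) (x : E d) :
    fn m (nlA m h) x = nonlin d ((W d x : ℂ) + fn m h x) - nonlin d (W d x : ℂ) := by
  have hh' : ‖conjA m h‖ < 1 := (norm_conjA_le m h).trans_lt hh
  have hW := W_pos (d := d) x
  have hW' : (W d x : ℂ) ≠ 0 := by exact_mod_cast hW.ne'
  set e := powA m ((1 + alpha d / 2 : ℝ) : ℂ) h * powA m ((alpha d / 2 : ℝ) : ℂ) (conjA m h) - 1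
    with he
  set w : ℂ := 1 + ev m x h with hw
  -- Evaluation is contractive, so `w` stays within distance less than one of `1`.
  have hre : 0 < w.re := by
    have := (AlgHom.norm_apply_le_self (ev m x) h).trans_lt hh
    have h2 := (abs_lt.mp ((Complex.abs_re_le_norm _).trans_lt this)).1
    rw [hw]; simp; linarith
  -- At the constant part both powers are powers of `1`. Hence `e` has no constant term and `fn m e`
  -- is `W` times its evaluation.
  have c0 : cst m e = 0 := by
    change cstHom m e = 0
    rw [he, map_sub, map_mul, char_powA m _ hh, char_powA m _ hh', map_one]
    have a1 : cstHom m h = 0 := h0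
    have a2 : cstHom m (conjA m h) = 0 := by
      change cst m (conjA m h) = 0
      rw [cst_conjA, h0, map_zero]
    rw [a1, a2]; simp
  have e0 : ev m x e = ((‖w‖ ^ alpha d : ℝ) : ℂ) * w - 1 := by
    rw [he, map_sub, map_mul, char_powA m _ hh, char_powA m _ hh', map_one, ev_conjA,
      ← cpow_mul_conj_cpow hre, hw]
    simp
  have f0 : fn m e x = (W d x : ℂ) * ev m x e := by
    rw [ev_apply, c0]; field_simp; ring
  have f1 : fn m h x = (W d x : ℂ) * (w - 1) := by
    rw [hw, ev_apply, h0]; field_simp; ring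
  change fn m (potA m e) x = _
  rw [fn_potA, f0, e0, f1, nonlin_eq, nonlin_eq, ← W_rpow_alpha]
  have e1 : (W d x : ℂ) + (W d x : ℂ) * (w - 1) = (W d x : ℂ) * w := by ring
  rw [e1, norm_mul, Complex.norm_real, Real.norm_of_nonneg hW.le,
    Real.mul_rpow hW.le (norm_nonneg _)]
  push_cast
  ring

/-! ### Injectivity of the representation -/

theorem integral_der_mul (j : Fin d) (f φ : 𝓢(E d, ℂ)) :
    ∫ x, der j f x * φ x = -∫ x, f x * der j φ x := by
  have := SchwartzMap.integral_mul_lineDerivOp_right_eq_neg_left (μ := volume) f φ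
    (EuclideanSpace.single j (1 : ℝ))
  rw [der_eq, der_eq, this, neg_neg]

theorem integral_pos_mul (j : Fin d) (f φ : 𝓢(E d, ℂ)) :
    ∫ x, pos j f x * φ x = ∫ x, f x * pos j φ x := by
  congr 1; funext x; simp only [pos_apply]; ring

theorem integral_mul_eq_inner (f φ : 𝓢(E d, ℂ)) :
    ∫ x, f x * φ x = inner ℂ ((conjS φ).toLp 2 volume) (f.toLp 2 volume) := by
  rw [SchwartzMap.inner_toL2_toL2_eq (conjS φ) f volume]
  congr 1; funext x; simp [conjS_apply]

/-- A `q n`-Cauchy sequence of Schwartz functions that tends weakly to zero tends to zero. -/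
theorem tendsto_q_of_weak (n : ℕ) : ∀ f : ℕ → 𝓢(E d, ℂ),
    (∀ ε > 0, ∃ N, ∀ i ≥ N, ∀ j ≥ N, q n (f i - f j) < ε) →
    (∀ φ : 𝓢(E d, ℂ), Tendsto (fun i => ∫ x, f i x * φ x) atTop (𝓝 0)) →
    Tendsto (fun i => q n (f i)) atTop (𝓝 0) := by
  induction n with
  | zero =>
    intro f hf hw
    have hcau : CauchySeq (fun i => (f i).toLp 2 volume) := by
      rw [Metric.cauchySeq_iff]
      intro ε hε
      obtain ⟨N, hN⟩ := hf ε hε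
      refine ⟨N, fun i hi j hj => ?_⟩
      rw [dist_eq_norm]
      exact hN i hi j hj
    obtain ⟨g, hg⟩ := cauchySeq_tendsto_of_complete hcau
    have hz : ∀ φ : 𝓢(E d, ℂ), inner ℂ (φ.toLp 2 volume) g = 0 := by
      intro φ
      have h1 : Tendsto (fun i => inner ℂ (φ.toLp 2 volume) ((f i).toLp 2 volume)) atTop
          (𝓝 (inner ℂ (φ.toLp 2 volume) g)) := tendsto_const_nhds.inner hg
      have h2 := hw (conjS φ)
      simp only [integral_mul_eq_inner, conjS_conjS] at h2
      exact tendsto_nhds_unique h1 h2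
    have hg0 : g = 0 := by
      have hd' : DenseRange (SchwartzMap.toLpCLM ℝ ℂ 2 (volume : Measure (E d))) :=
        SchwartzMap.denseRange_toLpCLM (by simp)
      have : inner ℂ g g = 0 := by
        refine hd'.induction_on (p := fun a => inner ℂ a g = 0) g
          (isClosed_eq (by fun_prop) continuous_const) fun φ => hz φ
      exact inner_self_eq_zero.mp this
    rw [hg0] at hg
    simpa [q_zero_apply] using hg.norm
  | succ n ih =>
    intro f hf hw
    -- Each letter is its own transpose up to sign and preserves Schwartz functions, so weak
    -- convergence to zero passes to `op l (f i)`.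
    have key : ∀ l, Tendsto (fun i => q n (op l (f i))) atTop (𝓝 0) := by
      intro l
      refine ih _ (fun ε hε => ?_) fun φ => ?_
      · obtain ⟨N, hN⟩ := hf ε hε
        refine ⟨N, fun i hi j hj => ?_⟩
        rw [← map_sub]
        exact (q_op_le n l _).trans_lt (hN i hi j hj)
      · match l with
        | none => exact hw φ
        | some (.inl j) =>
          have := (hw (der j φ)).neg
          simp only [← integral_der_mul, neg_zero] at this
          exact this
        | some (.inr j) =>
          have := hw (pos j φ)
          simp only [← integral_pos_mul] at this
          exact this
    simp only [q_succ_sum]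
    simpa using tendsto_finsetSum Finset.univ fun l _ => key l

theorem norm_fn_le (a : Alg d m) (x : E d) : ‖fn m a x‖ ≤ evalConst d m * ‖a‖ := by
  refine le_trans ?_ (wt_mul_norm_fn_le m a x)
  have := one_le_wt (d := d) (Nat.cast_nonneg d) x
  nlinarith [norm_nonneg (fn m a x)]

/-- An element of the algebra is determined by its constant and its function. -/
theorem eq_zero_of_fn_eq_zero {a : Alg d m} (h0 : cst m a = 0) (hf : ∀ x, fn m a x = 0) : a = 0 := by
  obtain ⟨u, hu, hlim⟩ := mem_closure_iff_seq_limit.mp (emb_dense (d := d) m a)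
  choose p hp using hu
  have hlim' : Tendsto (fun i => emb m (p i)) atTop (𝓝 a) := by simpa only [hp] using hlim
  have hc : Tendsto (fun i => (p i).1) atTop (𝓝 0) := by
    have := ((cst m).continuous.tendsto a).comp hlim'
    simpa [Function.comp_def, cst_emb, h0] using this
  have hq : Tendsto (fun i => q (reg d m) (p i).2) atTop (𝓝 0) := by
    -- The approximating functions converge to zero uniformly, hence weakly, and they are Cauchy in
    -- `q`. Closability of the letters then makes the limit in the completion zero.
    refine tendsto_q_of_weak _ (fun i => (p i).2) (fun ε hε => ?_) fun φ => ?_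
    · obtain ⟨N, hN⟩ := Metric.cauchySeq_iff.mp hlim'.cauchySeq ε hε
      refine ⟨N, fun i hi j hj => ?_⟩
      have h1 := hN i hi j hj
      rw [dist_eq_norm, ← map_sub] at h1
      exact (q_le_norm_emb m (p i - p j)).trans_lt h1
    · have hb : ∀ i, ‖∫ x, (p i).2 x * φ x‖ ≤ (evalConst d m * ‖emb m (p i) - a‖) * ∫ x, ‖φ x‖ := by
        intro i
        rw [← integral_const_mul]
        refine norm_integral_le_of_norm_le (φ.integrable.norm.const_mul _)
          (Eventually.of_forall fun x => ?_)
        rw [norm_mul]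
        gcongr
        have := norm_fn_le m (emb m (p i) - a) x
        rwa [fn_sub, hf, fn_emb, sub_zero] at this
      refine squeeze_zero_norm hb ?_
      have h2 := (tendsto_iff_norm_sub_tendsto_zero.mp hlim').const_mul (evalConst d m)
        |>.mul_const (∫ x, ‖φ x‖)
      simpa using h2
  have hn : Tendsto (fun i => ‖emb m (p i)‖) atTop (𝓝 0) := by
    simp only [norm_emb]
    simpa using hc.norm.add (hq.const_mul (algConst d m))
  exact norm_eq_zero.mp (tendsto_nhds_unique hlim'.norm hn)

end EnergyCriticalNLS

namespace EnergyCriticalNLS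

variable {d : ℕ} [hd : Fact (6 ≤ d)] (m : ℕ)

/-! ### Iterated derivatives of Schwartz functions -/

open scoped LineDeriv FourierTransform in
theorem der_comm (i j : Fin d) (f : 𝓢(E d, ℂ)) : der i (der j f) = der j (der i f) :=
  fourier_inj fun ξ => by simp only [fourier_der_apply]; ring

/-- The iterated partial derivative on Schwartz functions. -/
noncomputable def derW {j : ℕ} (s : Fin j → Fin d) : 𝓢(E d, ℂ) →L[ℂ] 𝓢(E d, ℂ) :=
  LineDeriv.iteratedLineDerivOpCLM ℂ 𝓢(E d, ℂ) fun l => EuclideanSpace.single (s l) (1 : ℝ)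

theorem derW_zero (s : Fin 0 → Fin d) (f : 𝓢(E d, ℂ)) : derW s f = f := rfl

theorem derW_succ {j : ℕ} (s : Fin (j + 1) → Fin d) (f : 𝓢(E d, ℂ)) :
    derW s f = der (s 0) (derW (Fin.tail s) f) := rfl

theorem derW_apply {j : ℕ} (s : Fin j → Fin d) (f : 𝓢(E d, ℂ)) (x : E d) :
    derW s f x = iterPartial s f x := SchwartzMap.iteratedLineDerivOp_eq_iteratedFDeriv

theorem q_derW_le {j : ℕ} (s : Fin j → Fin d) (n : ℕ) (f : 𝓢(E d, ℂ)) :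
    q n (derW s f) ≤ q (n + j) f := by
  induction j generalizing n with
  | zero => rfl
  | succ j ih =>
    rw [derW_succ]
    refine (q_op_le n _ _).trans ((ih _ (n + 1)).trans (le_of_eq ?_))
    rw [add_right_comm, add_assoc]

theorem derW_der {j : ℕ} (s : Fin j → Fin d) (i : Fin d) (f : 𝓢(E d, ℂ)) :
    derW s (der i f) = der i (derW s f) := by
  induction j with
  | zero => rfl
  | succ j ih => rw [derW_succ, ih, der_comm, derW_succ]

theorem integral_derW_mul {j : ℕ} (s : Fin j → Fin d) (f φ : 𝓢(E d, ℂ)) :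
    ∫ x, derW s f x * φ x = (-1) ^ j * ∫ x, f x * derW s φ x := by
  induction j generalizing φ with
  | zero => simp [derW_zero]
  | succ j ih =>
    simp only [derW_succ]
    rw [integral_der_mul, ih, derW_der, pow_succ]
    ring

theorem iterPartial_one (s : Fin 1 → Fin d) (f : 𝓢(E d, ℂ)) (x : E d) :
    iterPartial s f x = der (s 0) f x := by
  rw [← derW_apply, derW_succ, derW_zero]

/-- The Schwartz function given by a test function. -/
noncomputable def testS {φ : E d → ℂ} (h : IsTest φ) : 𝓢(E d, ℂ) := h.2.toSchwartzMap h.1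

theorem testS_coe {φ : E d → ℂ} (h : IsTest φ) : ⇑(testS h) = φ := rfl

theorem integral_lp_mul (g : Lp ℂ 2 (volume : Measure (E d))) (φ : 𝓢(E d, ℂ)) :
    ∫ x, g x * φ x = inner ℂ ((conjS φ).toLp 2 volume) g := by
  rw [L2.inner_def]
  refine integral_congr_ae ?_
  filter_upwards [(conjS φ).coeFn_toLp 2 volume] with x hx
  rw [hx]
  simp [conjS_apply]

/-! ### Functions represented by the algebra -/

theorem continuous_fn_apply (a : Alg d m) : Continuous (fn m a) := by
  refine continuous_of_uniform_approx_of_continuous fun u hu => ?_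
  obtain ⟨ε, hε, hu⟩ := Metric.mem_uniformity_dist.mp hu
  have hK := evalConst_nonneg (d := d) m
  obtain ⟨-, hp, p, rfl⟩ := Metric.dense_iff.mp (emb_dense (d := d) m) a
    (ε / (evalConst d m + 1)) (by positivity)
  refine ⟨p.2, p.2.continuous, fun x => hu ?_⟩
  rw [Metric.mem_ball, dist_comm, dist_eq_norm, lt_div_iff₀ (by positivity)] at hp
  rw [dist_eq_norm, ← fn_emb m p x, ← fn_sub]
  refine (norm_fn_le m _ x).trans_lt ?_
  nlinarith [norm_nonneg (a - emb m p)]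

theorem integrable_fn_mul (a : Alg d m) (φ : 𝓢(E d, ℂ)) :
    Integrable (fun x => fn m a x * φ x) :=
  φ.integrable.bdd_mul (continuous_fn_apply m a).aestronglyMeasurable
    (Eventually.of_forall fun x => norm_fn_le m a x)

/-- The pairing `a ↦ ∫ fn a φ`. -/
noncomputable def pairA (φ : 𝓢(E d, ℂ)) : Alg d m →L[ℂ] ℂ :=
  LinearMap.mkContinuous
    { toFun := fun a => ∫ x, fn m a x * φ x
      map_add' := fun a b => by
        rw [← integral_add (integrable_fn_mul m a φ) (integrable_fn_mul m b φ)]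
        congr 1; funext x; rw [fn_add]; ring
      map_smul' := fun c a => by
        rw [RingHom.id_apply, smul_eq_mul, ← integral_const_mul]
        congr 1; funext x; rw [fn_smul]; ring }
    (evalConst d m * ∫ x, ‖φ x‖) fun a => by
      change ‖∫ x, fn m a x * φ x‖ ≤ _
      have h : ‖∫ x, fn m a x * φ x‖ ≤ ∫ x, evalConst d m * ‖a‖ * ‖φ x‖ := by
        refine norm_integral_le_of_norm_le (φ.integrable.norm.const_mul _)
          (Eventually.of_forall fun x => ?_)
        rw [norm_mul]
        gcongr
        exact norm_fn_le m a x
      rw [integral_const_mul] at h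
      linarith

theorem pairA_apply (φ : 𝓢(E d, ℂ)) (a : Alg d m) : pairA m φ a = ∫ x, fn m a x * φ x := rfl

theorem pairA_emb (φ : 𝓢(E d, ℂ)) (p : ℂ × 𝓢(E d, ℂ)) :
    pairA m φ (emb m p) = ∫ x, p.2 x * φ x := by
  simp only [pairA_apply, fn_emb]

theorem pairA_iota (φ f : 𝓢(E d, ℂ)) : pairA m φ (iota m f) = ∫ x, f x * φ x := pairA_emb m φ _

theorem pairA_grpA (φ : 𝓢(E d, ℂ)) (t : ℝ) (a : Alg d m) :
    pairA m φ (grpA m t a) = pairA m (grp t φ) a := by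
  refine (emb_dense (d := d) m).induction_on
    (p := fun a => pairA m φ (grpA m t a) = pairA m (grp t φ) a) a
    (isClosed_eq (by fun_prop) (by fun_prop)) fun p => ?_
  rw [grpA_emb, pairA_iota, pairA_emb, integral_grp_mul]

variable {m} in
theorem wdL_bound {j : ℕ} (hj : j ≤ m) (s : Fin j → Fin d) (f : 𝓢(E d, ℂ)) :
    ‖((SchwartzMap.toLpCLM ℂ ℂ 2 (volume : Measure (E d))).toLinearMap.comp
      ((mulWt (m : ℝ)).toLinearMap.comp (derW s).toLinearMap)) f‖ ≤ 2 ^ m * q (reg d m) f := by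
  refine (q_mulWt_nat_le m 0 (derW s f)).trans ?_
  gcongr
  -- The weight `wt m` costs `2 m` letters and the derivatives at most `m`: this is the `3 m` in
  -- `reg`.
  exact (q_derW_le s _ f).trans (q_mono (by unfold reg; omega) f)

/-- The weighted weak derivative of the function of an element of the algebra. -/
noncomputable def wdL {j : ℕ} (s : Fin j → Fin d) : Alg d m →L[ℂ] Lp ℂ 2 (volume : Measure (E d)) :=
  lift m ((SchwartzMap.toLpCLM ℂ ℂ 2 volume).toLinearMap.comp
      ((mulWt (m : ℝ)).toLinearMap.comp (derW s).toLinearMap))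

variable {m} in
theorem wdL_emb {j : ℕ} (hj : j ≤ m) (s : Fin j → Fin d) (p : ℂ × 𝓢(E d, ℂ)) :
    wdL m s (emb m p) = (mulWt (m : ℝ) (derW s p.2)).toLp 2 volume :=
  lift_emb (by positivity) (wdL_bound hj s) p

variable {m} in
theorem norm_wdL_le {j : ℕ} (hj : j ≤ m) (s : Fin j → Fin d) (a : Alg d m) :
    ‖wdL m s a‖ ≤ 2 ^ m * ‖a‖ := norm_lift_le (by positivity) (wdL_bound hj s) a

/-- The weak derivative of the function of an element of the algebra. -/
noncomputable def wd {j : ℕ} (s : Fin j → Fin d) (a : Alg d m) (x : E d) : ℂ :=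
  (wt d (-m) x : ℂ) * wdL m s a x

theorem norm_wd (a : Alg d m) {j : ℕ} (s : Fin j → Fin d) (x : E d) :
    wt d m x * ‖wd m s a x‖ = ‖wdL m s a x‖ := by
  rw [wd, norm_mul, Complex.norm_real, Real.norm_of_nonneg (wt_pos _ x).le, ← mul_assoc,
    ← wt_add, add_neg_cancel, wt_zero, one_mul]

theorem memLp_wd {j : ℕ} (s : Fin j → Fin d) (a : Alg d m) : MemLp (wd m s a) 2 volume := by
  refine (Lp.memLp (wdL m s a)).of_le ?_ (Eventually.of_forall fun x => ?_)
  · exact ((wt_temperate' (d := d) (-m)).1.continuous.aestronglyMeasurable).mul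
      (Lp.aestronglyMeasurable _)
  · rw [← norm_wd m a s x]
    have := one_le_wt (d := d) (Nat.cast_nonneg m) x
    nlinarith [norm_nonneg (wd m s a x)]

theorem integral_wd_mul {j : ℕ} (s : Fin j → Fin d) (a : Alg d m) (φ : 𝓢(E d, ℂ)) :
    ∫ x, wd m s a x * φ x = inner ℂ ((conjS (mulWt (-m : ℝ) φ)).toLp 2 volume) (wdL m s a) := by
  rw [← integral_lp_mul]
  congr 1; funext x
  rw [wd, mulWt_apply]; ring

variable {m} in
theorem integral_wd_mul_eq {j : ℕ} (hj : j ≤ m) (s : Fin j → Fin d) (a : Alg d m)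
    (φ : 𝓢(E d, ℂ)) :
    ∫ x, wd m s a x * φ x = (-1) ^ j * ∫ x, fn m a x * derW s φ x := by
  rw [integral_wd_mul, ← pairA_apply]
  refine (emb_dense (d := d) m).induction_on
    (p := fun a => inner ℂ ((conjS (mulWt (-m : ℝ) φ)).toLp 2 volume) (wdL m s a) =
      (-1) ^ j * pairA m (derW s φ) a) a
    (isClosed_eq (by fun_prop) (by fun_prop)) fun p => ?_
  rw [wdL_emb hj, pairA_emb, ← integral_derW_mul, ← integral_mul_eq_inner]
  congr 1; funext x
  rw [mulWt_apply, mulWt_apply]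
  have : (wt d m x : ℂ) * (wt d (-m) x : ℂ) = 1 := by
    rw [← Complex.ofReal_mul, ← wt_add, add_neg_cancel, wt_zero, Complex.ofReal_one]
  linear_combination (derW s p.2 x * φ x) * this

variable {m} in
theorem isWeakDeriv_fn {j : ℕ} (hj : j ≤ m) (s : Fin j → Fin d) (a : Alg d m) :
    IsWeakDeriv s (fn m a) (wd m s a) := by
  refine ⟨(continuous_fn_apply m a).locallyIntegrable,
    (memLp_wd m s a).locallyIntegrable (by norm_num), fun φ hφ => ?_⟩
  have := integral_wd_mul_eq hj s a (testS hφ)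
  simpa only [derW_apply, testS_coe] using this

theorem sqrt_sum_sq_le {ι : Type*} [Fintype ι] (f : ι → ℝ) (hf : ∀ i, 0 ≤ f i) :
    √(∑ i, f i ^ 2) ≤ ∑ i, f i := by
  rw [Real.sqrt_le_left (Finset.sum_nonneg fun i _ => hf i)]
  exact Finset.sum_sq_le_sq_sum_of_nonneg fun i _ => hf i

variable {m} in
theorem gradNorm_fn_le {j : ℕ} (hj : j ≤ m) {ρ : E d → ℝ} {B : ℝ} (hB : 0 ≤ B)
    (hρ : ∀ x, |ρ x| ≤ B * wt d m x) (a : Alg d m) :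
    gradNorm ρ j (fn m a) ≤
      ENNReal.ofReal (Fintype.card (Fin j → Fin d) * (B * 2 ^ m) * ‖a‖) := by
  -- The infimum is bounded by its value at the explicit weak derivatives `wd`.
  refine (iInf₂_le (fun s => wd m s a) fun s => isWeakDeriv_fn hj s a).trans ?_
  have h1 : eLpNorm (fun x => ρ x * √(∑ s : Fin j → Fin d, ‖wd m s a x‖ ^ 2)) 2 volume ≤
      eLpNorm (∑ s : Fin j → Fin d, fun x => B * ‖wdL m s a x‖) 2 volume := by
    refine eLpNorm_mono_real fun x => ?_
    rw [Finset.sum_apply, norm_mul, Real.norm_eq_abs, Real.norm_of_nonneg (Real.sqrt_nonneg _)]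
    calc |ρ x| * √(∑ s : Fin j → Fin d, ‖wd m s a x‖ ^ 2) ≤
          (B * wt d m x) * ∑ s : Fin j → Fin d, ‖wd m s a x‖ :=
          mul_le_mul (hρ x) (sqrt_sum_sq_le _ fun s => norm_nonneg _) (Real.sqrt_nonneg _)
            (mul_nonneg hB (wt_pos _ x).le)
      _ = _ := by
          rw [Finset.mul_sum]
          refine Finset.sum_congr rfl fun s _ => ?_
          rw [mul_assoc, norm_wd]
  refine h1.trans ((eLpNorm_sum_le (fun s _ =>
    (Lp.aestronglyMeasurable (wdL m s a)).norm.const_mul B) (by norm_num)).trans ?_)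
  have h2 : ∀ s : Fin j → Fin d, eLpNorm (fun x => B * ‖wdL m s a x‖) 2 volume ≤
      ENNReal.ofReal (B * 2 ^ m * ‖a‖) := by
    intro s
    have : eLpNorm (fun x => B * ‖wdL m s a x‖) 2 volume =
        ENNReal.ofReal (‖B‖ * ‖wdL m s a‖) := by
      rw [ENNReal.ofReal_mul (norm_nonneg _), Lp.norm_def, ENNReal.ofReal_toReal (Lp.eLpNorm_ne_top _),
        ← eLpNorm_norm (wdL m s a : E d → ℂ), ofReal_norm_eq_enorm]
      exact eLpNorm_const_smul B (fun x => ‖wdL m s a x‖) 2 volume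
    rw [this, mul_assoc, Real.norm_of_nonneg hB]
    exact ENNReal.ofReal_le_ofReal (by gcongr; exact norm_wdL_le hj s a)
  refine (Finset.sum_le_sum fun s _ => h2 s).trans (le_of_eq ?_)
  rw [Finset.sum_const, Finset.card_univ, mul_assoc (Fintype.card _ : ℝ),
    ENNReal.ofReal_mul (p := (Fintype.card _ : ℝ)) (by positivity), ENNReal.ofReal_natCast, nsmul_eq_mul]

theorem bracket_pow_le (n : ℕ) (x : E d) (k : ℕ) (hk : k ≤ n) :
    |bracket x ^ k| ≤ ((d : ℝ) * ((d : ℝ) - 2)) ^ n * wt d n x := by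
  have hc := cc_pos (d := d)
  have h6 := six_le_cast (d := d)
  have hc1 : 1 ≤ (d : ℝ) * ((d : ℝ) - 2) := by nlinarith
  have hb := one_le_base (d := d) x
  have h1 : 1 ≤ bracket x := by
    unfold bracket; rw [Real.one_le_sqrt]; nlinarith [sq_nonneg ‖x‖]
  have h2 : bracket x ≤ (d : ℝ) * ((d : ℝ) - 2) * (1 + ‖x‖ ^ 2 / ((d : ℝ) * ((d : ℝ) - 2))) := by
    have e : (d : ℝ) * ((d : ℝ) - 2) * (1 + ‖x‖ ^ 2 / ((d : ℝ) * ((d : ℝ) - 2))) =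
        (d : ℝ) * ((d : ℝ) - 2) + ‖x‖ ^ 2 := by rw [mul_add, mul_one, mul_div_cancel₀ _ hc.ne']
    rw [e]
    have h3 : bracket x ^ 2 = 1 + ‖x‖ ^ 2 := Real.sq_sqrt (by positivity)
    nlinarith
  rw [abs_of_nonneg (by positivity)]
  calc bracket x ^ k ≤ bracket x ^ n := pow_le_pow_right₀ h1 hk
    _ ≤ ((d : ℝ) * ((d : ℝ) - 2) * (1 + ‖x‖ ^ 2 / ((d : ℝ) * ((d : ℝ) - 2)))) ^ n := by gcongr
    _ = _ := by rw [mul_pow, wt, Real.rpow_natCast]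

theorem exists_hmmNorm_fn_le : ∃ C, 0 < C ∧ ∀ a : Alg d m,
    hmmNorm m (fn m a) ≤ ENNReal.ofReal (C * ‖a‖) := by
  have hc := cc_pos (d := d)
  set B := ((d : ℝ) * ((d : ℝ) - 2)) ^ m
  refine ⟨∑ j ∈ Finset.range (m + 1), Fintype.card (Fin j → Fin d) * (B * 2 ^ m) + 1,
    by positivity, fun a => ?_⟩
  have h : hmmNorm m (fn m a) ≤ ∑ j ∈ Finset.range (m + 1),
      ENNReal.ofReal (Fintype.card (Fin j → Fin d) * (B * 2 ^ m) * ‖a‖) := by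
    refine Finset.sum_le_sum fun j hj => ?_
    have hj' : j ≤ m := by simpa [Nat.lt_succ_iff] using hj
    exact gradNorm_fn_le hj' (by positivity) (fun x => bracket_pow_le m x _ (Nat.sub_le _ _)) a
  refine h.trans ?_
  rw [← ENNReal.ofReal_sum_of_nonneg (fun j _ => by positivity), ← Finset.sum_mul]
  exact ENNReal.ofReal_le_ofReal (by nlinarith [norm_nonneg a])

variable {m} in
theorem exists_hDotNorm_fn_le (hm : 1 ≤ m) : ∃ C, 0 < C ∧ ∀ a : Alg d m,
    hDotNorm (fn m a) ≤ ENNReal.ofReal (C * ‖a‖) := by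
  refine ⟨Fintype.card (Fin 1 → Fin d) * (1 * 2 ^ m) + 1, by positivity, fun a => ?_⟩
  refine (gradNorm_fn_le (B := 1) hm zero_le_one (fun x => ?_) a).trans ?_
  · rw [abs_one, one_mul]; exact one_le_wt (Nat.cast_nonneg m) x
  · exact ENNReal.ofReal_le_ofReal (by nlinarith [norm_nonneg a])

end EnergyCriticalNLS

namespace EnergyCriticalNLS

open scoped BoundedContinuousFunction

/-! ### Solutions of a Duhamel equation with prescribed decay -/

section Duhamel

variable {X : Type*} [NormedAddCommGroup X] [NormedSpace ℂ X] [CompleteSpace X]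

/-- A strongly continuous one-parameter family of operators with `S s S t = S (s + t)` and growth at
most `C e^{|t|}`. -/
structure IsExpGroup (S : ℝ → X →L[ℂ] X) (C : ℝ) : Prop where
  pos : 0 < C
  bound : ∀ t x, ‖S t x‖ ≤ C * Real.exp |t| * ‖x‖
  comp : ∀ s t x, S s (S t x) = S (s + t) x
  cont : ∀ g : ℝ → X, Continuous g → Continuous fun t => S (-t) (g t)

/-- The profile `-i ∫_t^∞ S(-s) f(s) ds`. -/
noncomputable def profile (S : ℝ → X →L[ℂ] X) (f : ℝ → X) (t : ℝ) : X :=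
  -Complex.I • ∫ s in Set.Ioi t, S (-s) (f s)

variable {S : ℝ → X →L[ℂ] X} {C : ℝ} {f g : ℝ → X} {M γ : ℝ}

theorem integrableOn_exp_Ioi {a : ℝ} (ha : 0 < a) (t : ℝ) :
    IntegrableOn (fun s => Real.exp (-(a * s))) (Set.Ioi t) := by
  simpa [neg_mul] using integrableOn_exp_mul_Ioi (neg_lt_zero.mpr ha) t

theorem profile_integrableOn (hS : IsExpGroup S C) (hf : Continuous f) (hγ : 1 < γ)
    (hM : ∀ s, ‖f s‖ ≤ M * Real.exp (-(γ * s))) (t : ℝ) :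
    IntegrableOn (fun s => S (-s) (f s)) (Set.Ioi t) := by
  have h1 := (integrableOn_exp_Ioi (sub_pos.mpr hγ) t).const_mul (C * Real.exp (2 * |t|) * M)
  refine h1.mono' (hS.cont f hf).aestronglyMeasurable ?_
  refine (ae_restrict_mem measurableSet_Ioi).mono fun s hs => ?_
  have hs' : |s| ≤ s + 2 * |t| := by
    have := neg_abs_le t
    have hs : t < s := hs
    rw [abs_le]; constructor <;> linarith [abs_nonneg t]
  have hC := hS.pos
  calc ‖S (-s) (f s)‖ ≤ C * Real.exp |-s| * ‖f s‖ := hS.bound _ _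
    _ ≤ C * Real.exp (s + 2 * |t|) * (M * Real.exp (-(γ * s))) := by
        rw [abs_neg]; gcongr; exact hM s
    _ = C * Real.exp (2 * |t|) * M * (Real.exp s * Real.exp (-(γ * s))) := by
        rw [Real.exp_add]; ring
    _ = _ := by rw [← Real.exp_add]; congr 2; ring

/-- The profile `y(t) = S(-t) v(t)` of a mild solution `v` is differentiable in norm, although `v`
itself need not be in the domain of the generator. -/
theorem profile_hasDerivAt (hS : IsExpGroup S C) (hf : Continuous f) (hγ : 1 < γ)
    (hM : ∀ s, ‖f s‖ ≤ M * Real.exp (-(γ * s))) (t : ℝ) :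
    HasDerivAt (profile S f) (Complex.I • S (-t) (f t)) t := by
  have hint := profile_integrableOn hS hf hγ hM
  have hc := hS.cont f hf
  have e : profile S f = fun t => -Complex.I • ((∫ s in Set.Ioi (0 : ℝ), S (-s) (f s)) -
      ∫ s in (0 : ℝ)..t, S (-s) (f s)) := by
    funext t
    rw [profile, ← intervalIntegral.integral_interval_add_Ioi (hint 0) (hint t)]
    congr 1; abel
  rw [e]
  have h := (hc.integral_hasStrictDerivAt 0 t).hasDerivAt
  have h2 := (h.const_sub (∫ s in Set.Ioi (0 : ℝ), S (-s) (f s))).const_smul (-Complex.I)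
  have e2 : -Complex.I • -(S (-t) (f t)) = Complex.I • S (-t) (f t) := by simp
  rw [← e2]
  exact h2

/-- This rests on `∫_t^∞ e^{s-t} e^{-γs} ds = e^{-γt}/(γ-1)`. The decay rate is preserved and the
constant tends to zero as `γ` grows, which replaces any smoothing or dispersion in the contraction
argument. -/
theorem norm_profile_le (hS : IsExpGroup S C) (hf : Continuous f) (hγ : 1 < γ)
    (hM : ∀ s, ‖f s‖ ≤ M * Real.exp (-(γ * s))) (t : ℝ) :
    ‖S t (profile S f t)‖ ≤ C * M / (γ - 1) * Real.exp (-(γ * t)) := by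
  have hC := hS.pos
  have hγ' : 0 < γ - 1 := sub_pos.mpr hγ
  have hint := profile_integrableOn hS hf hγ hM t
  rw [profile, map_smul, norm_smul, norm_neg, Complex.norm_I, one_mul,
    ← ContinuousLinearMap.integral_comp_comm _ hint]
  have h1 := (integrableOn_exp_Ioi hγ' t).const_mul (C * M * Real.exp (-t))
  refine (norm_integral_le_of_norm_le h1 ?_).trans ?_
  · refine (ae_restrict_mem measurableSet_Ioi).mono fun s hs => ?_
    have hs : t < s := hs
    rw [hS.comp]
    calc ‖S (t + -s) (f s)‖ ≤ C * Real.exp |t + -s| * ‖f s‖ := hS.bound _ _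
      _ ≤ C * Real.exp (s - t) * (M * Real.exp (-(γ * s))) := by
          rw [abs_of_neg (by linarith), show -(t + -s) = s - t by ring]; gcongr; exact hM s
      _ = C * M * (Real.exp (s - t) * Real.exp (-(γ * s))) := by ring
      _ = C * M * (Real.exp (-t) * Real.exp (-((γ - 1) * s))) := by
          rw [← Real.exp_add, ← Real.exp_add]; congr 2; ring
      _ = _ := by ring
  · have e : ∫ s in Set.Ioi t, Real.exp (-((γ - 1) * s)) = Real.exp (-((γ - 1) * t)) / (γ - 1) := by
      have := integral_exp_mul_Ioi (neg_lt_zero.mpr hγ') t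
      simp only [neg_mul] at this
      rw [this, neg_div_neg_eq]
    rw [integral_const_mul, e]
    refine le_of_eq ?_
    have : Real.exp (-(γ * t)) = Real.exp (-t) * Real.exp (-((γ - 1) * t)) := by
      rw [← Real.exp_add]; congr 1; ring
    rw [this]; ring

theorem profile_sub (hS : IsExpGroup S C) (hf : Continuous f) (hg : Continuous g) (hγ : 1 < γ)
    (hM : ∀ s, ‖f s‖ ≤ M * Real.exp (-(γ * s))) (hM' : ∀ s, ‖g s‖ ≤ M * Real.exp (-(γ * s)))
    (t : ℝ) : profile S (fun s => f s - g s) t = profile S f t - profile S g t := by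
  simp only [profile, map_sub]
  rw [integral_sub (profile_integrableOn hS hf hγ hM t) (profile_integrableOn hS hg hγ hM' t),
    smul_sub]

theorem continuous_group_profile (hS : IsExpGroup S C) (hf : Continuous f) (hγ : 1 < γ)
    (hM : ∀ s, ‖f s‖ ≤ M * Real.exp (-(γ * s))) : Continuous fun t => S t (profile S f t) := by
  have h1 : Continuous (profile S f) :=
    continuous_iff_continuousAt.mpr fun t => (profile_hasDerivAt hS hf hγ hM t).continuousAt
  simpa [Function.comp_def] using (hS.cont _ (h1.comp continuous_neg)).comp continuous_neg

variable {G : ℝ → X → X} {L δ η K T₀ ρ : ℝ}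

/-- A fixed point for `e^{γt} v(t)` in a ball of bounded continuous curves. The condition `2 C L ≤ γ
- 1` gives contraction with ratio `1/2`; the surplus decay `η` of the source at zero, with a late
starting time, makes the ball invariant. -/
theorem exists_duhamel (hS : IsExpGroup S C) (hρ : 0 < ρ) (hρδ : ρ ≤ δ) (hη : 0 < η) (hL : 0 ≤ L)
    (hγ : 1 < γ) (hγL : 2 * (C * L) ≤ γ - 1) (hK : 0 ≤ K)
    (hLip : ∀ t ≥ T₀, ∀ v v', ‖v‖ ≤ δ → ‖v'‖ ≤ δ → ‖G t v - G t v'‖ ≤ L * ‖v - v'‖)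
    (h0 : ∀ t ≥ T₀, ‖G t 0‖ ≤ K * Real.exp (-((γ + η) * t)))
    (hGc : ∀ v : ℝ → X, Continuous v → (∀ t ≥ T₀, 0 ≤ t → ‖v t‖ ≤ δ) →
      ContinuousOn (fun t => G t (v t)) {t | T₀ ≤ t ∧ 0 ≤ t}) :
    ∃ T, T₀ ≤ T ∧ 0 ≤ T ∧ ∃ y : ℝ → X, (∀ t ≥ T, ‖S t (y t)‖ ≤ ρ * Real.exp (-(γ * t))) ∧
      Continuous (fun t => S t (y t)) ∧
      ∀ t, HasDerivAt y
        (Complex.I • S (-t) (G (max T t) (S (max T t) (y (max T t))))) t := by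
  have hC := hS.pos
  have hγ' : 0 < γ - 1 := sub_pos.mpr hγ
  -- Beyond `T` the surplus decay makes the source at zero use up at most half of the ball.
  obtain ⟨T, hT₀, hT0, hT⟩ : ∃ T, T₀ ≤ T ∧ 0 ≤ T ∧
      C * (K * Real.exp (-(η * T))) ≤ (γ - 1) * ρ / 2 := by
    have h1 : Tendsto (fun T => C * (K * Real.exp (-(η * T)))) atTop (𝓝 (C * (K * 0))) :=
      ((Real.tendsto_exp_atBot.comp (tendsto_neg_atTop_atBot.comp
        (tendsto_id.const_mul_atTop hη))).const_mul K).const_mul C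
    rw [mul_zero, mul_zero] at h1
    have h2 := h1.eventually (eventually_le_nhds (show 0 < (γ - 1) * ρ / 2 by positivity))
    obtain ⟨T, h3, h4, h5⟩ := (h2.and ((eventually_ge_atTop T₀).and (eventually_ge_atTop 0))).exists
    exact ⟨T, h4, h5, h3⟩
  set M := L * ρ + K * Real.exp (-(η * T)) with hMdef
  -- Half of `ρ` comes from the Lipschitz part, half from the source at zero.
  have hCM : C * M / (γ - 1) ≤ ρ := by
    rw [div_le_iff₀ hγ', hMdef]; nlinarith
  -- the source term attached to a weighted perturbation
  let vv : (ℝ →ᵇ X) → ℝ → X := fun w t => Real.exp (-(γ * t)) • w t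
  -- Freezing time at `T` for earlier `s` makes every curve live on the whole line, so the space of
  -- bounded continuous functions applies directly.
  let gg : (ℝ →ᵇ X) → ℝ → X := fun w s => G (max T s) (vv w (max T s))
  have hvc : ∀ w, Continuous (vv w) := fun w => by
    have := w.continuous
    fun_prop
  have hvn : ∀ w : ℝ →ᵇ X, ∀ t, ‖vv w t‖ ≤ Real.exp (-(γ * t)) * ‖w‖ := by
    intro w t
    rw [norm_smul, Real.norm_of_nonneg (Real.exp_nonneg _)]
    gcongr
    exact w.norm_coe_le_norm t
  have hvδ : ∀ w : ℝ →ᵇ X, ‖w‖ ≤ ρ → ∀ t, 0 ≤ t → ‖vv w t‖ ≤ δ := by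
    intro w hw t ht
    refine ((hvn w t).trans ?_).trans hρδ
    have : Real.exp (-(γ * t)) ≤ 1 := Real.exp_le_one_iff.mpr (by nlinarith)
    nlinarith [norm_nonneg w]
  have hτ : ∀ s, T ≤ max T s ∧ s ≤ max T s := fun s => ⟨le_max_left _ _, le_max_right _ _⟩
  have hexp : ∀ s, Real.exp (-(γ * max T s)) ≤ Real.exp (-(γ * s)) := fun s =>
    Real.exp_le_exp.mpr (by nlinarith [(hτ s).2])
  have hgc : ∀ w : ℝ →ᵇ X, ‖w‖ ≤ ρ → Continuous (gg w) := by
    intro w hw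
    have h1 := hGc (vv w) (hvc w) fun t _ ht => hvδ w hw t ht
    exact h1.comp_continuous (continuous_const.max continuous_id) fun s =>
      ⟨hT₀.trans (hτ s).1, hT0.trans (hτ s).1⟩
  have hgn : ∀ w : ℝ →ᵇ X, ‖w‖ ≤ ρ → ∀ s, ‖gg w s‖ ≤ M * Real.exp (-(γ * s)) := by
    intro w hw s
    obtain ⟨h1, h2⟩ := hτ s
    have h3 := hLip _ (hT₀.trans h1) (vv w (max T s)) 0 (hvδ w hw _ (hT0.trans h1))
      (by rw [norm_zero]; linarith)
    have h4 := h0 _ (hT₀.trans h1)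
    have h5 := norm_add_le (G (max T s) (vv w (max T s)) - G (max T s) 0) (G (max T s) 0)
    rw [sub_add_cancel] at h5
    rw [sub_zero] at h3
    have h6 := hvn w (max T s)
    have h7 : Real.exp (-((γ + η) * max T s)) ≤
        Real.exp (-(η * T)) * Real.exp (-(γ * max T s)) := by
      rw [← Real.exp_add]; exact Real.exp_le_exp.mpr (by nlinarith)
    have hM0 : 0 ≤ M := by positivity
    calc ‖gg w s‖ ≤ L * ‖vv w (max T s)‖ + K * Real.exp (-((γ + η) * max T s)) := by
          change ‖G (max T s) (vv w (max T s))‖ ≤ _; linarith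
      _ ≤ L * (Real.exp (-(γ * max T s)) * ρ) +
          K * (Real.exp (-(η * T)) * Real.exp (-(γ * max T s))) := by
          gcongr
          exact h6.trans (by gcongr)
      _ = M * Real.exp (-(γ * max T s)) := by rw [hMdef]; ring
      _ ≤ _ := mul_le_mul_of_nonneg_left (hexp s) hM0
  have hgd : ∀ w w' : ℝ →ᵇ X, ‖w‖ ≤ ρ → ‖w'‖ ≤ ρ → ∀ s,
      ‖gg w s - gg w' s‖ ≤ L * ‖w - w'‖ * Real.exp (-(γ * s)) := by
    intro w w' hw hw' s
    obtain ⟨h1, h2⟩ := hτ s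
    refine (hLip _ (hT₀.trans h1) _ _ (hvδ w hw _ (hT0.trans h1))
      (hvδ w' hw' _ (hT0.trans h1))).trans ?_
    have e : vv w (max T s) - vv w' (max T s) = vv (w - w') (max T s) := by
      simp only [vv, BoundedContinuousFunction.coe_sub, Pi.sub_apply, smul_sub]
    rw [e, mul_assoc]
    gcongr
    refine (hvn _ _).trans ?_
    rw [mul_comm]
    exact mul_le_mul_of_nonneg_left (hexp s) (norm_nonneg _)
  have hbound : ∀ w : ℝ →ᵇ X, ‖w‖ ≤ ρ → ∀ t,
      ‖Real.exp (γ * max T t) • S (max T t) (profile S (gg w) (max T t))‖ ≤ ρ := by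
    intro w hw t
    have h := norm_profile_le hS (hgc w hw) hγ (hgn w hw) (max T t)
    rw [norm_smul, Real.norm_of_nonneg (Real.exp_nonneg _)]
    calc _ ≤ Real.exp (γ * max T t) * (C * M / (γ - 1) * Real.exp (-(γ * max T t))) := by gcongr
      _ = C * M / (γ - 1) * (Real.exp (γ * max T t) * Real.exp (-(γ * max T t))) := by ring
      _ = C * M / (γ - 1) := by rw [← Real.exp_add, add_neg_cancel, Real.exp_zero, mul_one]
      _ ≤ ρ := hCM
  have hcont : ∀ w : ℝ →ᵇ X, ‖w‖ ≤ ρ → Continuous fun t =>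
      Real.exp (γ * max T t) • S (max T t) (profile S (gg w) (max T t)) := by
    intro w hw
    have h1 := (continuous_group_profile hS (hgc w hw) hγ (hgn w hw)).comp
      ((continuous_const (y := T)).max continuous_id)
    exact (Real.continuous_exp.comp (continuous_const.mul (continuous_const.max continuous_id))).smul h1
  -- the fixed point
  let B : Set (ℝ →ᵇ X) := Metric.closedBall 0 ρ
  have hB : ∀ w : B, ‖(w : ℝ →ᵇ X)‖ ≤ ρ := fun w => by
    have := w.2
    rwa [Metric.mem_closedBall, dist_zero_right] at this
  let Φ : B → B := fun w => ⟨BoundedContinuousFunction.ofNormedAddCommGroup _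
      (hcont w (hB w)) ρ (hbound w (hB w)), by
    rw [Metric.mem_closedBall, dist_zero_right]
    exact BoundedContinuousFunction.norm_ofNormedAddCommGroup_le _ hρ.le _⟩
  have hΦ : ∀ (w : B) t, (Φ w : ℝ →ᵇ X) t =
      Real.exp (γ * max T t) • S (max T t) (profile S (gg w) (max T t)) := fun w t => rfl
  have hcontr : ContractingWith (1 / 2) Φ := by
    refine ⟨by norm_num, LipschitzWith.of_dist_le_mul fun w w' => ?_⟩
    rw [Subtype.dist_eq, Subtype.dist_eq, dist_eq_norm, dist_eq_norm]
    rw [BoundedContinuousFunction.norm_le (by positivity)]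
    intro t
    rw [BoundedContinuousFunction.coe_sub, Pi.sub_apply, hΦ, hΦ, ← smul_sub, ← map_sub,
      ← profile_sub hS (hgc w (hB w)) (hgc w' (hB w')) hγ (hgn w (hB w)) (hgn w' (hB w'))]
    have h := norm_profile_le hS ((hgc w (hB w)).sub (hgc w' (hB w'))) hγ
      (hgd w w' (hB w) (hB w')) (max T t)
    rw [norm_smul, Real.norm_of_nonneg (Real.exp_nonneg _)]
    calc _ ≤ Real.exp (γ * max T t) * (C * (L * ‖(w : ℝ →ᵇ X) - w'‖) / (γ - 1) *
          Real.exp (-(γ * max T t))) := mul_le_mul_of_nonneg_left h (Real.exp_nonneg _)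
      _ = C * (L * ‖(w : ℝ →ᵇ X) - w'‖) / (γ - 1) *
          (Real.exp (γ * max T t) * Real.exp (-(γ * max T t))) := by ring
      _ = C * (L * ‖(w : ℝ →ᵇ X) - w'‖) / (γ - 1) := by
          rw [← Real.exp_add, add_neg_cancel, Real.exp_zero, mul_one]
      _ ≤ _ := by
          rw [div_le_iff₀ hγ']
          push_cast
          nlinarith [norm_nonneg ((w : ℝ →ᵇ X) - w')]
  haveI : Nonempty B := ⟨⟨0, Metric.mem_closedBall_self hρ.le⟩⟩
  haveI : CompleteSpace B := (Metric.isClosed_closedBall.isComplete).completeSpace_coe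
  obtain ⟨w, hw⟩ : ∃ w : B, Φ w = w := ⟨_, hcontr.fixedPoint_isFixedPt⟩
  -- After `T` the truncation is inactive, and removing the weight turns the fixed point relation
  -- into the Duhamel equation.
  have hwt : ∀ t, T ≤ t → S t (profile S (gg w) t) = vv w t := by
    intro t ht
    have h1 : (w : ℝ →ᵇ X) t = Real.exp (γ * t) • S t (profile S (gg w) t) := by
      conv_lhs => rw [← hw]
      rw [hΦ, max_eq_right ht]
    change _ = Real.exp (-(γ * t)) • (w : ℝ →ᵇ X) t
    rw [h1, smul_smul, ← Real.exp_add, neg_add_cancel, Real.exp_zero, one_smul]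
  refine ⟨T, hT₀, hT0, profile S (gg w), fun t ht => ?_,
    continuous_group_profile hS (hgc w (hB w)) hγ (hgn w (hB w)), fun t => ?_⟩
  · rw [hwt t ht]
    refine (hvn _ t).trans ?_
    rw [mul_comm]
    gcongr
    exact hB w
  · have := profile_hasDerivAt hS (hgc w (hB w)) hγ (hgn w (hB w)) t
    rw [hwt _ (le_max_left T t)]
    exact this

end Duhamel

end EnergyCriticalNLS

namespace EnergyCriticalNLS

variable {d : ℕ} [hd : Fact (6 ≤ d)] (m : ℕ)

/-! ### The ground state -/

open scoped LineDeriv FourierTransform in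
-- The integral is the Fourier transform at zero frequency, where the symbol `2πi ξ_j` vanishes.
theorem integral_der (j : Fin d) (f : 𝓢(E d, ℂ)) : ∫ x, der j f x = 0 := by
  have h := fourier_der_apply j f 0
  have e : 𝓕 (der j f) 0 = ∫ x, der j f x := by
    rw [SchwartzMap.fourier_coe, Real.fourier_eq]
    simp
  rw [← e, h]; simp

theorem integral_laplacian_mul (f φ : 𝓢(E d, ℂ)) :
    ∫ x, (Δ f) x * φ x = ∫ x, f x * (Δ φ) x :=
  (SchwartzMap.integral_mul_laplacian_right_eq_left f φ).symm

theorem der_pos (j : Fin d) (f : 𝓢(E d, ℂ)) : der j (pos j f) = f + pos j (der j f) := by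
  ext x
  have h1 : HasFDerivAt (fun x : E d => ((x j : ℝ) : ℂ))
      (Complex.ofRealCLM.comp (EuclideanSpace.proj j : E d →L[ℝ] ℝ)) x :=
    (Complex.ofRealCLM.comp (EuclideanSpace.proj j : E d →L[ℝ] ℝ)).hasFDerivAt
  have h2 : HasFDerivAt (fun x : E d => ((x j : ℝ) : ℂ) * f x) _ x :=
    h1.mul (f.differentiableAt (x := x)).hasFDerivAt
  have e : (pos j f : E d → ℂ) = fun x => ((x j : ℝ) : ℂ) * f x := funext fun x => pos_apply j f x
  change _ = f x + pos j (der j f) x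
  rw [der_apply, e, h2.fderiv, pos_apply, der_apply]
  simp [add_comm]

/-- The exponents of `∇W`: the derivative `∂_j W = -(1/d) x_j (1 + |x|²/(d(d-2)))^{-d/2}`. -/
noncomputable def gradW (j : Fin d) (x : E d) : ℂ :=
  ((-(1 / (d : ℝ)) * (x j * wt d (gsExp d - 1) x) : ℝ) : ℂ)

theorem two_mul_gsExp_div : 2 * gsExp d / ((d : ℝ) * ((d : ℝ) - 2)) = -(1 / (d : ℝ)) := by
  have := six_le_cast (d := d)
  have h : (d : ℝ) - 2 ≠ 0 := by linarith
  have h' : (d : ℝ) ≠ 0 := by linarith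
  unfold gsExp
  field_simp

/-- Integration of `∂_j (W φ)`: this product is a Schwartz function, so no cutoff at infinity is
needed. -/
theorem integral_W_der (j : Fin d) (φ : 𝓢(E d, ℂ)) :
    ∫ x, (W d x : ℂ) * der j φ x = -∫ x, gradW j x * φ x := by
  have h := integral_der j (mulWt (gsExp d) φ)
  rw [der_mulWt, two_mul_gsExp_div] at h
  simp only [SchwartzMap.add_apply] at h
  rw [integral_add (SchwartzMap.integrable _) (SchwartzMap.integrable _)] at h
  rw [eq_neg_iff_add_eq_zero, ← h]
  congr 1
  · congr 1; funext x; rw [mulWt_apply, W_eq_wt]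
  · congr 1; funext x; rw [SchwartzMap.smul_apply, mulWt_apply, pos_apply, gradW, smul_eq_mul]; push_cast; ring

theorem nonlin_W (x : E d) : nonlin d (W d x : ℂ) = (wt d (gsExp d - 2) x : ℂ) := by
  have h := W_pos x
  rw [nonlin_eq, Complex.norm_real, Real.norm_of_nonneg h.le, W_rpow_alpha, W_eq_wt,
    ← Complex.ofReal_mul, ← wt_add]
  congr 2; ring

theorem sum_coord_sq (x : E d) : ∑ j, x j ^ 2 = ‖x‖ ^ 2 := by
  rw [EuclideanSpace.norm_sq_eq]; simp

theorem norm_sq_mul_wt (r : ℝ) (x : E d) :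
    ‖x‖ ^ 2 * wt d r x = (d : ℝ) * ((d : ℝ) - 2) * (wt d (r + 1) x - wt d r x) := by
  have hc := cc_pos (d := d)
  have h1 : wt d (r + 1) x = wt d r x * (1 + ‖x‖ ^ 2 / ((d : ℝ) * ((d : ℝ) - 2))) := by
    rw [wt_add]; congr 1; simp [wt]
  rw [h1]
  have : ‖x‖ ^ 2 = (d : ℝ) * ((d : ℝ) - 2) * (‖x‖ ^ 2 / ((d : ℝ) * ((d : ℝ) - 2))) := by
    rw [mul_div_cancel₀ _ hc.ne']
  nth_rewrite 1 [this]; ring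

/-- `∑_j ∂_j (x_j (1 + |x|²/(d(d-2)))^{-d/2}) = d (1 + |x|²/(d(d-2)))^{-(d+2)/2}`. -/
theorem divergence_identity (x : E d) :
    (d : ℝ) * wt d (gsExp d - 1) x + 2 * (gsExp d - 1) / ((d : ℝ) * ((d : ℝ) - 2)) *
      (‖x‖ ^ 2 * wt d (gsExp d - 2) x) = d * wt d (gsExp d - 2) x := by
  have hc := cc_pos (d := d)
  have h6 := six_le_cast (d := d)
  have h : (d : ℝ) - 2 ≠ 0 := by linarith
  have h' : (d : ℝ) ≠ 0 := by linarith
  rw [norm_sq_mul_wt, show gsExp d - 2 + 1 = gsExp d - 1 by ring]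
  have : 2 * (gsExp d - 1) / ((d : ℝ) * ((d : ℝ) - 2)) * ((d : ℝ) * ((d : ℝ) - 2) *
      (wt d (gsExp d - 1) x - wt d (gsExp d - 2) x)) =
      2 * (gsExp d - 1) * (wt d (gsExp d - 1) x - wt d (gsExp d - 2) x) := by
    field_simp
  rw [this]
  unfold gsExp
  ring

theorem integral_gradW_der (j : Fin d) (φ : 𝓢(E d, ℂ)) :
    ∫ x, gradW j x * der j φ x = ∫ x, ((1 / (d : ℝ) * (wt d (gsExp d - 1) x +
      2 * (gsExp d - 1) / ((d : ℝ) * ((d : ℝ) - 2)) * (x j ^ 2 * wt d (gsExp d - 2) x)) : ℝ) : ℂ)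
      * φ x := by
  set B := 2 * (gsExp d - 1) / ((d : ℝ) * ((d : ℝ) - 2)) with hB
  have h := integral_der j (mulWt (gsExp d - 1) (pos j φ))
  rw [der_mulWt, der_pos, map_add, show gsExp d - 1 - 1 = gsExp d - 2 by ring, ← hB] at h
  simp only [SchwartzMap.add_apply] at h
  rw [integral_add ((SchwartzMap.integrable _).add (SchwartzMap.integrable _))
    (SchwartzMap.integrable _), integral_add (SchwartzMap.integrable _)
    (SchwartzMap.integrable _)] at h
  have e1 : ∫ x, gradW j x * der j φ x =
      -(1 / (d : ℂ)) * ∫ x, mulWt (gsExp d - 1) (pos j (der j φ)) x := by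
    rw [← integral_const_mul]
    congr 1; funext x; rw [mulWt_apply, pos_apply, gradW]; push_cast; ring
  have e2 : ∫ x, ((1 / (d : ℝ) * (wt d (gsExp d - 1) x +
      B * (x j ^ 2 * wt d (gsExp d - 2) x)) : ℝ) : ℂ) * φ x =
      (1 / (d : ℂ)) * ((∫ x, mulWt (gsExp d - 1) φ x) +
        ∫ x, ((B : ℂ) • mulWt (gsExp d - 2) (pos j (pos j φ))) x) := by
    rw [← integral_add (SchwartzMap.integrable _) (SchwartzMap.integrable _),
      ← integral_const_mul]
    congr 1; funext x
    simp only [SchwartzMap.smul_apply, mulWt_apply, pos_apply, smul_eq_mul]; push_cast; ring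
  rw [e1, e2]
  linear_combination (-(1 / (d : ℂ))) * h

theorem wt_mul_schwartz_integrable (r : ℝ) (φ : 𝓢(E d, ℂ)) :
    Integrable fun x => (wt d r x : ℂ) * φ x := by
  refine (mulWt r φ).integrable.congr (Eventually.of_forall fun x => ?_)
  rw [mulWt_apply]

/-- The equation `ΔW + W^{p_c} = 0` in the sense of distributions. -/
theorem integral_W_laplacian (φ : 𝓢(E d, ℂ)) :
    ∫ x, (W d x : ℂ) * (Δ φ) x = -∫ x, nonlin d (W d x : ℂ) * φ x := by
  have h6 := six_le_cast (d := d)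
  have h' : (d : ℂ) ≠ 0 := by
    have : (d : ℝ) ≠ 0 := by linarith
    exact_mod_cast this
  have e1 : ∫ x, (W d x : ℂ) * (Δ φ) x = ∑ j, ∫ x, (W d x : ℂ) * der j (der j φ) x := by
    simp only [W_eq_wt]
    rw [← integral_finsetSum Finset.univ fun j _ =>
      wt_mul_schwartz_integrable (gsExp d) (der j (der j φ))]
    congr 1; funext x
    rw [laplacian_eq_der, ← Finset.mul_sum]
    simp
  rw [e1]
  simp only [integral_W_der, integral_gradW_der]
  set B := 2 * (gsExp d - 1) / ((d : ℝ) * ((d : ℝ) - 2)) with hB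
  rw [Finset.sum_neg_distrib, ← integral_finsetSum _ fun j _ => ?_]
  · congr 2; funext x
    rw [nonlin_W, ← Finset.sum_mul]
    congr 1
    rw [← Complex.ofReal_sum]
    congr 1
    rw [← Finset.mul_sum, Finset.sum_add_distrib, ← Finset.mul_sum, ← Finset.sum_mul,
      sum_coord_sq, Finset.sum_const, Finset.card_univ, Fintype.card_fin, nsmul_eq_mul,
      divergence_identity]
    have : (d : ℝ) ≠ 0 := by linarith
    field_simp
  · have := ((mulWt (gsExp d - 1) φ).integrable (μ := volume)).add
      (((mulWt (gsExp d - 2) (pos j (pos j φ))).integrable (μ := volume)).smul (B : ℂ))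
    refine (this.const_mul (1 / (d : ℂ))).congr (Eventually.of_forall fun x => ?_)
    simp only [Pi.add_apply, Pi.smul_apply, mulWt_apply, pos_apply, smul_eq_mul]
    push_cast; ring

theorem wt_contDiff (r : ℝ) : ContDiff ℝ ∞ (wt d r) := (wt_temperate r).1

/-- Besides the distributional equation for `W`, the pointwise one is needed, because `nearError` is
built from the classical Laplacian. -/
theorem laplacian_W (x : E d) : (Δ (W d)) x = -wt d (gsExp d - 2) x := by
  have h6 := six_le_cast (d := d)
  rw [InnerProductSpace.laplacian_eq_iteratedFDeriv_orthonormalBasis _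
    (EuclideanSpace.basisFun (Fin d) ℝ)]
  simp only [iteratedFDeriv_two_apply]
  have e1 : fderiv ℝ (W d) = fun x => (-(1 / (d : ℝ)) * wt d (gsExp d - 1) x) • innerSL ℝ x := by
    funext x
    have := (wt_hasFDerivAt (d := d) (gsExp d) x).fderiv
    rwa [two_mul_gsExp_div] at this
  have h1 : HasFDerivAt (fun x : E d => (-(1 / (d : ℝ)) * wt d (gsExp d - 1) x) • innerSL ℝ x) _ x :=
    ((wt_hasFDerivAt (d := d) (gsExp d - 1) x).const_mul (-(1 / (d : ℝ)))).smul
      (innerSL ℝ (E := E d)).hasFDerivAt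
  rw [e1, h1.fderiv]
  have e2 : ∀ i : Fin d, inner ℝ x (EuclideanSpace.single i (1 : ℝ)) = x i := by
    intro i; simp [EuclideanSpace.inner_single_right]
  simp only [EuclideanSpace.basisFun_apply, Matrix.cons_val_zero, Matrix.cons_val_one,
    _root_.add_apply, _root_.smul_apply, ContinuousLinearMap.smulRight_apply, innerSL_apply_apply,
    e2, EuclideanSpace.inner_single_left, smul_eq_mul]
  have e3 := divergence_identity x
  rw [← sum_coord_sq, Finset.sum_mul, Finset.mul_sum] at e3
  have h' : (d : ℝ) ≠ 0 := by linarith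
  calc _ = ∑ i : Fin d, (-(1 / (d : ℝ))) * (wt d (gsExp d - 1) x +
        2 * (gsExp d - 1) / ((d : ℝ) * ((d : ℝ) - 2)) * (x i ^ 2 * wt d (gsExp d - 2) x)) := by
        refine Finset.sum_congr rfl fun i _ => ?_
        have e5 : innerSL ℝ (EuclideanSpace.single i (1 : ℝ) : E d)
            (EuclideanSpace.single i (1 : ℝ)) = 1 := by rw [innerSL_apply_apply]; simp
        rw [show gsExp d - 1 - 1 = gsExp d - 2 by ring]
        simp [e5]
        ring
    _ = -(1 / (d : ℝ)) * (d * wt d (gsExp d - 2) x) := by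
        rw [← Finset.mul_sum, Finset.sum_add_distrib, ← e3]
        simp
    _ = _ := by field_simp

theorem laplacian_ofReal_W (x : E d) :
    (Δ (fun x => (W d x : ℂ))) x = -nonlin d (W d x : ℂ) := by
  have h : ContDiffAt ℝ 2 (W d) x := 
    (contDiff_infty.mp (wt_contDiff (d := d) (gsExp d)) 2).contDiffAt
  have := h.laplacian_CLM_comp_left (l := Complex.ofRealCLM)
  refine this.trans ?_
  simp [laplacian_W, nonlin_W]

/-! ### Integrability of the weights -/

theorem wt_le_bracket {r : ℝ} (hr : r ≤ 0) (x : E d) :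
    wt d r x ≤ ((d : ℝ) * ((d : ℝ) - 2)) ^ (-r) * (1 + ‖x‖ ^ 2) ^ r := by
  have hc := cc_pos (d := d)
  have h6 := six_le_cast (d := d)
  have hc1 : 1 ≤ (d : ℝ) * ((d : ℝ) - 2) := by nlinarith
  have e : (1 + ‖x‖ ^ 2) / ((d : ℝ) * ((d : ℝ) - 2)) ≤
      1 + ‖x‖ ^ 2 / ((d : ℝ) * ((d : ℝ) - 2)) := by
    rw [add_div]
    gcongr
    rw [div_le_one hc]; exact hc1
  calc wt d r x ≤ ((1 + ‖x‖ ^ 2) / ((d : ℝ) * ((d : ℝ) - 2))) ^ r :=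
        Real.rpow_le_rpow_of_nonpos (by positivity) e hr
    _ = _ := by
        rw [Real.div_rpow (by positivity) hc.le, Real.rpow_neg hc.le]; field_simp

theorem wt_integrable {r : ℝ} (hr : (d : ℝ) < -(2 * r)) : Integrable (wt d r) := by
  have h6 := six_le_cast (d := d)
  have h := integrable_rpow_neg_one_add_norm_sq (E := E d) (μ := volume) (r := -(2 * r))
    (by rw [finrank_euclideanSpace_fin]; exact hr)
  refine (h.const_mul (((d : ℝ) * ((d : ℝ) - 2)) ^ (-r))).mono'
    (wt_contDiff r).continuous.aestronglyMeasurable (Eventually.of_forall fun x => ?_)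
  rw [Real.norm_of_nonneg (wt_pos r x).le, show -(-(2 * r)) / 2 = r by ring]
  exact wt_le_bracket (by linarith) x

theorem wt_memLp {r p : ℝ} (hp : 0 < p) (hr : (d : ℝ) < -(2 * r * p)) :
    MemLp (wt d r) (ENNReal.ofReal p) volume := by
  rw [← integrable_norm_rpow_iff (wt_contDiff r).continuous.aestronglyMeasurable
    (by simpa using hp) ENNReal.ofReal_ne_top, ENNReal.toReal_ofReal hp.le]
  refine (wt_integrable (r := r * p) (by linarith)).congr (Eventually.of_forall fun x => ?_)
  simp only
  rw [Real.norm_of_nonneg (wt_pos r x).le, wt_rpow]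

theorem memLp_of_norm_le_wt {r p C : ℝ} (hp : 0 < p) (hr : (d : ℝ) < -(2 * r * p)) {f : E d → ℂ}
    (hf : AEStronglyMeasurable f volume) (h : ∀ x, ‖f x‖ ≤ C * wt d r x) :
    MemLp f (ENNReal.ofReal p) volume :=
  ((wt_memLp hp hr).const_mul C).of_le hf (Eventually.of_forall fun x =>
    (h x).trans (le_abs_self _))

theorem norm_fn_le_wt (a : Alg d m) (x : E d) : ‖fn m a x‖ ≤ evalConst d m * ‖a‖ * wt d (-d) x := by
  have h := wt_mul_norm_fn_le m a x
  have e : wt d d x * wt d (-d) x = 1 := by rw [← wt_add, add_neg_cancel, wt_zero]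
  have h2 := wt_pos (d := d) (-d) x
  calc ‖fn m a x‖ = (wt d d x * ‖fn m a x‖) * wt d (-d) x := by
        rw [mul_right_comm, e, one_mul]
    _ ≤ _ := by gcongr

theorem memLp_fn (a : Alg d m) {p : ℝ} (hp : 1 ≤ p) : MemLp (fn m a) (ENNReal.ofReal p) volume := by
  have h6 := six_le_cast (d := d)
  exact memLp_of_norm_le_wt (by linarith) (by nlinarith) (continuous_fn_apply m a).aestronglyMeasurable
    (norm_fn_le_wt m a)

/-- The Sobolev exponent `2d/(d-2)`. -/
noncomputable def sob (d : ℕ) : ℝ := 2 * d / ((d : ℝ) - 2)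

theorem two_lt_sob : 2 < sob d := by
  have h6 := six_le_cast (d := d)
  rw [sob, lt_div_iff₀ (by linarith)]; linarith

theorem continuous_W : Continuous fun x => (W d x : ℂ) :=
  Complex.continuous_ofReal.comp (wt_contDiff (gsExp d)).continuous

theorem memLp_W : MemLp (fun x => (W d x : ℂ)) (ENNReal.ofReal (sob d)) volume := by
  have h6 := six_le_cast (d := d)
  refine memLp_of_norm_le_wt (r := gsExp d) (C := 1) (by linarith [two_lt_sob (d := d)]) ?_
    continuous_W.aestronglyMeasurable fun x => ?_
  · have : -(2 * gsExp d * sob d) = 2 * d := by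
      have h : (d : ℝ) - 2 ≠ 0 := by linarith
      unfold gsExp sob; field_simp
    rw [this]; linarith
  · rw [Complex.norm_real, Real.norm_of_nonneg (W_pos x).le, one_mul, W_eq_wt]

theorem continuous_gradW (j : Fin d) : Continuous (gradW (d := d) j) := by
  have := (wt_contDiff (d := d) (gsExp d - 1)).continuous
  unfold gradW
  fun_prop

theorem norm_gradW_le (j : Fin d) (x : E d) :
    ‖gradW j x‖ ≤ ((d : ℝ) * ((d : ℝ) - 2)) * wt d (gsExp d - 1 / 2) x := by
  have h6 := six_le_cast (d := d)
  have hc := cc_pos (d := d)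
  have hw := wt_pos (d := d) (gsExp d - 1) x
  have hj : |x j| ≤ ‖x‖ := by simpa using PiLp.norm_apply_le x j
  have h2 : ‖x‖ ≤ ((d : ℝ) * ((d : ℝ) - 2)) * wt d (1 / 2) x := by
    rw [wt, ← Real.sqrt_eq_rpow]
    refine abs_le_of_sq_le_sq' ?_ (by positivity) |>.2
    rw [mul_pow, Real.sq_sqrt (by positivity)]
    have : ((d : ℝ) * ((d : ℝ) - 2)) ^ 2 * (1 + ‖x‖ ^ 2 / ((d : ℝ) * ((d : ℝ) - 2))) =
        ((d : ℝ) * ((d : ℝ) - 2)) ^ 2 + ((d : ℝ) * ((d : ℝ) - 2)) * ‖x‖ ^ 2 := by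
      generalize (d : ℝ) * ((d : ℝ) - 2) = c at hc
      field_simp
    rw [this]
    have hc1 : 1 ≤ (d : ℝ) * ((d : ℝ) - 2) := by nlinarith
    nlinarith [sq_nonneg ‖x‖]
  have e : wt d (gsExp d - 1 / 2) x = wt d (1 / 2) x * wt d (gsExp d - 1) x := by
    rw [← wt_add]; congr 1; ring
  rw [gradW, Complex.norm_real, norm_mul, norm_mul, Real.norm_of_nonneg hw.le, e, norm_neg,
    Real.norm_of_nonneg (by positivity), Real.norm_eq_abs, ← mul_assoc, ← mul_assoc]
  refine mul_le_mul_of_nonneg_right ?_ hw.le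
  have : 1 / (d : ℝ) ≤ 1 := by rw [div_le_one (by linarith)]; linarith
  calc 1 / (d : ℝ) * |x j| ≤ 1 * |x j| := by gcongr
    _ ≤ _ := by linarith

theorem memLp_gradW (j : Fin d) : MemLp (gradW (d := d) j) 2 volume := by
  have h6 := six_le_cast (d := d)
  have := memLp_of_norm_le_wt (d := d) (p := 2) two_pos (by unfold gsExp; linarith)
    (continuous_gradW j).aestronglyMeasurable (norm_gradW_le j)
  simpa using this

theorem isWeakDeriv_W (s : Fin 1 → Fin d) :
    IsWeakDeriv s (fun x => (W d x : ℂ)) (gradW (s 0)) := by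
  refine ⟨continuous_W.locallyIntegrable, (continuous_gradW _).locallyIntegrable, fun φ hφ => ?_⟩
  have := integral_W_der (s 0) (testS hφ)
  simp only [← iterPartial_one, testS_coe] at this
  rw [this]; simp

end EnergyCriticalNLS

namespace EnergyCriticalNLS

variable {d : ℕ} [hd : Fact (6 ≤ d)] (m : ℕ)

/-! ### Differentiating pairings along the group -/

theorem toLp_bound (f : 𝓢(E d, ℂ)) :
    ‖(SchwartzMap.toLpCLM ℂ ℂ 2 (volume : Measure (E d))).toLinearMap f‖ ≤ 1 * q (reg d m) f := by
  rw [one_mul]; exact q_mono (Nat.zero_le _) f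

/-- The function of an element of the algebra as an element of `L²`. -/
noncomputable def fnL : Alg d m →L[ℂ] Lp ℂ 2 (volume : Measure (E d)) :=
  lift m (SchwartzMap.toLpCLM ℂ ℂ 2 volume).toLinearMap

theorem pairA_eq_inner (φ : 𝓢(E d, ℂ)) (a : Alg d m) :
    pairA m φ a = inner ℂ ((conjS φ).toLp 2 volume) (fnL m a) := by
  refine (emb_dense (d := d) m).induction_on
    (p := fun a => pairA m φ a = inner ℂ ((conjS φ).toLp 2 volume) (fnL m a)) a
    (isClosed_eq (by fun_prop) (by fun_prop)) fun p => ?_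
  rw [fnL, lift_emb zero_le_one (toLp_bound m), pairA_emb, integral_mul_eq_inner]
  rfl

/-- The quadratic Taylor remainder of the group in `L²` gives differentiability along a Schwartz
function. Under conjugation the derivative carries `I • Δ φ` inside `conjS`, the form needed for the
conjugate-linear slot of the inner product. -/
theorem hasDerivAt_conj_grp (φ : 𝓢(E d, ℂ)) (t : ℝ) :
    HasDerivAt (fun t => (conjS (grp t φ)).toLp 2 (volume : Measure (E d)))
      ((conjS (grp t (Complex.I • Δ φ))).toLp 2 volume) t := by
  rw [hasDerivAt_iff_isLittleO_nhds_zero]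
  have key : ∀ h : ℝ, ‖(conjS (grp (t + h) φ)).toLp 2 (volume : Measure (E d)) -
      (conjS (grp t φ)).toLp 2 volume - h • (conjS (grp t (Complex.I • Δ φ))).toLp 2 volume‖ ≤
      2 * q 0 (Δ (Δ φ)) * ‖h ^ 2‖ := by
    intro h
    have e : conjS (grp (t + h) φ) - conjS (grp t φ) - h • conjS (grp t (Complex.I • Δ φ)) =
        conjS (grp t (grp h φ - φ - (Complex.I * h) • Δ φ)) := by
      rw [← map_sub, ← map_smul, ← map_sub]
      congr 1
      rw [map_sub, map_sub, grp_grp, map_smul, map_smul, mul_comm, mul_smul]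
      rfl
    have e2 : (conjS (grp (t + h) φ)).toLp 2 (volume : Measure (E d)) -
      (conjS (grp t φ)).toLp 2 volume - h • (conjS (grp t (Complex.I • Δ φ))).toLp 2 volume =
      SchwartzMap.toLpCLM ℝ ℂ 2 (volume : Measure (E d))
        (conjS (grp (t + h) φ) - conjS (grp t φ) - h • conjS (grp t (Complex.I • Δ φ))) := by
      rw [map_sub, map_sub, map_smul]; rfl
    rw [e2, e]
    calc _ = q 0 (conjS (grp t (grp h φ - φ - (Complex.I * h) • Δ φ))) := rfl
      _ ≤ q 0 (grp t (grp h φ - φ - (Complex.I * h) • Δ φ)) := q_conjS_le _ _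
      _ ≤ q 0 (grp h φ - φ - (Complex.I * h) • Δ φ) := q_zero_grp_le _ _
      _ ≤ 2 * h ^ 2 * q 0 (Δ (Δ φ)) := q_zero_grp_sub_sub_le h φ
      _ = _ := by rw [Real.norm_of_nonneg (sq_nonneg h)]; ring
  refine (Asymptotics.IsBigO.of_bound _ (Eventually.of_forall key)).trans_isLittleO ?_
  exact Asymptotics.isLittleO_pow_id one_lt_two

/-- The group is moved onto the Schwartz function, along which it is differentiable; the product
rule then uses only a derivative of the profile `y`. This is how the mild equation becomes the
distributional one. -/
theorem hasDerivAt_pairA_grpA (φ : 𝓢(E d, ℂ)) {y : ℝ → Alg d m} {y' : Alg d m} {t : ℝ}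
    (hy : HasDerivAt y y' t) :
    HasDerivAt (fun t => pairA m φ (grpA m t (y t)))
      (pairA m φ (grpA m t y') + Complex.I * pairA m (Δ φ) (grpA m t (y t))) t := by
  have h1 := hasDerivAt_conj_grp φ t
  have h2 : HasDerivAt (fun t => fnL m (y t)) (fnL m y') t :=
    ((fnL m).restrictScalars ℝ).hasFDerivAt.comp_hasDerivAt t hy
  have h3 := HasDerivAt.inner ℂ h1 h2
  simp only [← pairA_eq_inner, ← pairA_grpA] at h3
  convert h3 using 1
  congr 1
  have : ∀ a : Alg d m, pairA m (Complex.I • Δ φ) a = Complex.I * pairA m (Δ φ) a := by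
    intro a
    rw [pairA_apply, pairA_apply, ← integral_const_mul]
    congr 1; funext x; rw [SchwartzMap.smul_apply, smul_eq_mul]; ring
  rw [this]

/-! ### The near solutions in the algebra -/

variable (e₀ : ℝ) (Φ : ℕ → 𝓢(E d, ℂ)) (k : ℕ)

/-- The perturbation `∑ s^j Φ_j` in the algebra. -/
noncomputable def nearA (s : ℝ) : Alg d m := ∑ j ∈ Finset.Icc 1 k, s ^ j • iota m (Φ j)

/-- The error of the near solution in the algebra. -/
noncomputable def errA (s : ℝ) : Alg d m :=
  ∑ j ∈ Finset.Icc 1 k, s ^ j • iota m (Δ (Φ j) - (Complex.I * (j * e₀ : ℝ)) • Φ j) +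
    nlA m (nearA m Φ k s)

theorem cst_nearA (s : ℝ) : cst m (nearA m Φ k s) = 0 := by
  simp only [nearA, map_sum]
  refine Finset.sum_eq_zero fun j _ => ?_
  rw [← Complex.coe_smul, map_smul, cst_iota, smul_zero]

theorem cst_errA (s : ℝ) : cst m (errA m e₀ Φ k s) = 0 := by
  simp only [errA, map_add, map_sum, cst_nlA, add_zero]
  refine Finset.sum_eq_zero fun j _ => ?_
  rw [← Complex.coe_smul, map_smul, cst_iota, smul_zero]

theorem fn_real_smul (c : ℝ) (a : Alg d m) (x : E d) : fn m (c • a) x = (c : ℂ) * fn m a x := by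
  rw [← Complex.coe_smul, fn_smul]

theorem fn_sum {ι : Type*} (s : Finset ι) (a : ι → Alg d m) (x : E d) :
    fn m (∑ i ∈ s, a i) x = ∑ i ∈ s, fn m (a i) x := map_sum (lift m (evalS x)) a s

theorem fn_nearA (s : ℝ) (x : E d) :
    fn m (nearA m Φ k s) x = ∑ j ∈ Finset.Icc 1 k, ((s ^ j : ℝ) : ℂ) * Φ j x := by
  rw [nearA, fn_sum]
  refine Finset.sum_congr rfl fun j _ => ?_
  rw [fn_real_smul, fn_iota]

theorem exp_pow_nat (t : ℝ) (j : ℕ) : Real.exp (-(e₀ * t)) ^ j = Real.exp (-(j * e₀ * t)) := by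
  rw [← Real.exp_nat_mul]; congr 1; ring

theorem Wk_eq (t : ℝ) (x : E d) :
    Wk e₀ Φ k t x = (W d x : ℂ) + fn m (nearA m Φ k (Real.exp (-(e₀ * t)))) x := by
  rw [fn_nearA, Wk]
  simp only [exp_pow_nat]

theorem laplacian_Wk (t : ℝ) (x : E d) :
    (Δ (Wk e₀ Φ k t)) x = -nonlin d (W d x : ℂ) +
      ∑ j ∈ Finset.Icc 1 k, ((Real.exp (-(j * e₀ * t)) : ℝ) : ℂ) * (Δ (Φ j)) x := by
  set g : 𝓢(E d, ℂ) := ∑ j ∈ Finset.Icc 1 k, ((Real.exp (-(j * e₀ * t)) : ℝ) : ℂ) • Φ j with hg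
  have e : Wk e₀ Φ k t = (fun x => (W d x : ℂ)) + ⇑g := by
    funext x
    simp [Wk, hg]
  have h1 : ContDiffAt ℝ 2 (fun x => (W d x : ℂ)) x :=
    Complex.ofRealCLM.contDiff.contDiffAt.comp x
      (contDiff_infty.mp (wt_contDiff (d := d) (gsExp d)) 2).contDiffAt
  have h2 : ContDiffAt ℝ 2 g x := (g.smooth 2).contDiffAt
  rw [e, h1.laplacian_add h2, laplacian_ofReal_W, ← SchwartzMap.laplacian_apply]
  congr 1
  have e3 : Δ g = ∑ j ∈ Finset.Icc 1 k, ((Real.exp (-(j * e₀ * t)) : ℝ) : ℂ) • Δ (Φ j) := by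
    rw [hg, ← SchwartzMap.laplacianCLM_eq (𝕜 := ℂ), map_sum]
    simp only [map_smul, SchwartzMap.laplacianCLM_eq]
  rw [e3]; simp

theorem deriv_Wk (t : ℝ) (x : E d) :
    deriv (fun s => Wk e₀ Φ k s x) t =
      ∑ j ∈ Finset.Icc 1 k, -((j * e₀ : ℝ) : ℂ) * ((Real.exp (-(j * e₀ * t)) : ℝ) : ℂ) * Φ j x := by
  have h : HasDerivAt (fun s => Wk e₀ Φ k s x) (∑ j ∈ Finset.Icc 1 k,
      -((j * e₀ : ℝ) : ℂ) * ((Real.exp (-(j * e₀ * t)) : ℝ) : ℂ) * Φ j x) t := by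
    unfold Wk
    refine HasDerivAt.const_add _ (HasDerivAt.fun_sum fun j _ => HasDerivAt.mul_const ?_ _)
    have h1 : HasDerivAt (fun s : ℝ => Real.exp (-(j * e₀ * s)))
        (Real.exp (-(j * e₀ * t)) * (-(j * e₀ * 1))) t :=
      ((hasDerivAt_id t).const_mul (j * e₀)).neg.exp
    have h2 := h1.ofReal_comp
    refine h2.congr_deriv ?_
    push_cast; ring
  exact h.deriv

/-- The Laplacian of `W` supplies `-F(W)`, exactly the term subtracted in `nlA`. Smallness of the
near solution places the binomial series in their disc of convergence. -/
theorem fn_errA {t : ℝ} (ht : ‖nearA m Φ k (Real.exp (-(e₀ * t)))‖ < 1) (x : E d) :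
    fn m (errA m e₀ Φ k (Real.exp (-(e₀ * t)))) x = nearError e₀ Φ k t x := by
  rw [errA, fn_add, fn_nlA m ht (cst_nearA m Φ k _), nearError, deriv_Wk, laplacian_Wk, fn_sum,
    ← Wk_eq]
  simp only [fn_real_smul, fn_iota, exp_pow_nat, SchwartzMap.sub_apply, SchwartzMap.smul_apply,
    smul_eq_mul, mul_sub, Finset.sum_sub_distrib, Finset.mul_sum]
  have : ∑ j ∈ Finset.Icc 1 k, Complex.I * (-((j * e₀ : ℝ) : ℂ) *
      ((Real.exp (-(j * e₀ * t)) : ℝ) : ℂ) * Φ j x) = -∑ j ∈ Finset.Icc 1 k,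
      ((Real.exp (-(j * e₀ * t)) : ℝ) : ℂ) * (Complex.I * ((j * e₀ : ℝ) : ℂ) * Φ j x) := by
    rw [← Finset.sum_neg_distrib]
    exact Finset.sum_congr rfl fun j _ => by ring
  rw [this]; ring

theorem nearA_zero : nearA m Φ k 0 = 0 := by
  unfold nearA
  refine Finset.sum_eq_zero fun j hj => ?_
  have : j ≠ 0 := by have := (Finset.mem_Icc.mp hj).1; omega
  rw [zero_pow this, zero_smul]

theorem nearA_analytic : AnalyticAt ℝ (nearA m Φ k) 0 := by
  unfold nearA
  refine Finset.analyticAt_fun_sum _ fun j _ => ?_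
  exact (analyticAt_id.pow j).smul analyticAt_const

/-- With `s = e^{-e₀t}` as variable, the error is a polynomial plus the analytic nonlinearity of a
polynomial vanishing at `s = 0`. -/
theorem errA_analytic : AnalyticAt ℝ (errA m e₀ Φ k) 0 := by
  unfold errA
  refine AnalyticAt.add (Finset.analyticAt_fun_sum _ fun j _ => ?_) ?_
  · exact (analyticAt_id.pow j).smul analyticAt_const
  · refine AnalyticAt.comp' ?_ (nearA_analytic m Φ k)
    rw [nearA_zero]; exact nlA_analyticAt m

theorem continuous_nearA : Continuous (nearA m Φ k) := by
  unfold nearA; fun_prop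

theorem tendsto_exp_neg (he : 0 < e₀) :
    Tendsto (fun t => Real.exp (-(e₀ * t))) atTop (𝓝[>] 0) := by
  rw [tendsto_nhdsWithin_iff]
  refine ⟨Real.tendsto_exp_atBot.comp (tendsto_neg_atTop_atBot.comp
    (tendsto_id.const_mul_atTop he)), Eventually.of_forall fun t => Real.exp_pos _⟩

variable {m e₀ Φ} in
/-- The error of the near solution of order `k` is `O(e^{-(k+1)e₀t})` in the norm of the algebra. -/
theorem exists_errA_bound (he : 0 < e₀) {k : ℕ}
    (hΦ : ∃ C : ℝ, ∀ᶠ t : ℝ in atTop, ∀ x, ‖nearError e₀ Φ k t x‖ ≤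
      C * Real.exp (-((k + 1) * e₀ * t))) :
    ∃ K, 0 ≤ K ∧ ∀ᶠ t : ℝ in atTop,
      ‖errA m e₀ Φ k (Real.exp (-(e₀ * t)))‖ ≤ K * Real.exp (-((k + 1) * e₀ * t)) := by
  have hpow : ∀ t : ℝ, Real.exp (-((k + 1) * e₀ * t)) = Real.exp (-(e₀ * t)) ^ (k + 1) := by
    intro t; rw [exp_pow_nat]; push_cast; rfl
  have hlim := tendsto_exp_neg e₀ he
  have hlim0 : Tendsto (fun t => Real.exp (-(e₀ * t))) atTop (𝓝 0) := hlim.mono_right inf_le_left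
  by_cases hz : ∀ᶠ s in 𝓝 (0 : ℝ), errA m e₀ Φ k s = 0
  · refine ⟨0, le_rfl, ?_⟩
    filter_upwards [hlim0.eventually hz] with t ht
    rw [ht]; simp
  -- Unless the error vanishes near `s = 0`, analyticity factors out its exact order of vanishing:
  -- it equals `s^n g(s)` with `g(0) ≠ 0`.
  obtain ⟨n, g, hg, hg0, hgn⟩ :=
    (errA_analytic m e₀ Φ k).exists_eventuallyEq_pow_smul_nonzero_iff.mpr hz
  simp only [sub_zero] at hgn
  by_cases hn : k + 1 ≤ n
  · have hb : ∀ᶠ s in 𝓝 (0 : ℝ), ‖g s‖ ≤ ‖g 0‖ + 1 :=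
      hg.continuousAt.norm.eventually (eventually_le_nhds (by linarith))
    have h1 : ∀ᶠ t : ℝ in atTop, Real.exp (-(e₀ * t)) ≤ 1 :=
      hlim0.eventually (eventually_le_nhds one_pos)
    refine ⟨‖g 0‖ + 1, by positivity, ?_⟩
    filter_upwards [hlim0.eventually hgn, hlim0.eventually hb, h1] with t h2 h3 h4
    rw [h2, hpow, norm_smul, norm_pow, Real.norm_of_nonneg (Real.exp_nonneg _), mul_comm]
    exact mul_le_mul h3 (pow_le_pow_of_le_one (Real.exp_nonneg _) h4 hn) (by positivity)
      (by positivity)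
  · exfalso
    push Not at hn
    have hsm : ∀ᶠ s in 𝓝 (0 : ℝ), ‖nearA m Φ k s‖ < 1 := by
      have := (continuous_nearA m Φ k).norm.continuousAt (x := 0)
      refine this.eventually (eventually_lt_nhds ?_)
      change ‖nearA m Φ k 0‖ < 1
      rw [nearA_zero, norm_zero]; exact one_pos
    obtain ⟨C, hC⟩ := hΦ
    have hg' : Tendsto (fun t => g (Real.exp (-(e₀ * t)))) atTop (𝓝 (g 0)) :=
      hg.continuousAt.tendsto.comp hlim0
    -- If `n ≤ k`, the pointwise bound divided by `s^n` shows that the function of `g(0)` vanishes.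
    -- Its constant vanishes too, so `g(0) = 0`, a contradiction.
    apply hg0
    refine eq_zero_of_fn_eq_zero m ?_ fun x => ?_
    · have h1 : Tendsto (fun t => cst m (g (Real.exp (-(e₀ * t))))) atTop (𝓝 (cst m (g 0))) :=
        ((cst m).continuous.tendsto _).comp hg'
      refine tendsto_nhds_unique h1 (tendsto_const_nhds.congr' ?_)
      filter_upwards [hlim0.eventually hgn] with t ht
      have h2 := cst_errA m e₀ Φ k (Real.exp (-(e₀ * t)))
      rw [ht, ← Complex.coe_smul, map_smul, smul_eq_mul, mul_eq_zero] at h2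
      rcases h2 with h2 | h2
      · exact absurd h2 (by exact_mod_cast (pow_pos (Real.exp_pos _) n).ne')
      · exact h2.symm
    · have h1 : Tendsto (fun t => fn m (g (Real.exp (-(e₀ * t)))) x) atTop (𝓝 (fn m (g 0) x)) :=
        ((continuous_fn m x).tendsto _).comp hg'
      refine tendsto_nhds_unique h1 (squeeze_zero_norm'
        (a := fun t => C * Real.exp (-(e₀ * t)) ^ (k + 1 - n)) ?_ ?_)
      · filter_upwards [hlim0.eventually hgn, hlim0.eventually hsm, hC] with t h2 h3 h4
        have h5 := h4 x
        rw [← fn_errA m e₀ Φ k h3, h2, fn_real_smul, norm_mul, Complex.norm_real, norm_pow,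
          Real.norm_of_nonneg (Real.exp_nonneg _), hpow] at h5
        have h6 : Real.exp (-(e₀ * t)) ^ (k + 1) =
            Real.exp (-(e₀ * t)) ^ n * Real.exp (-(e₀ * t)) ^ (k + 1 - n) := by
          rw [← pow_add]; congr 1; omega
        rw [h6] at h5
        have h7 := pow_pos (Real.exp_pos (-(e₀ * t))) n
        refine le_of_mul_le_mul_left ?_ h7
        linarith
      · have : Tendsto (fun t => C * Real.exp (-(e₀ * t)) ^ (k + 1 - n)) atTop
            (𝓝 (C * 0 ^ (k + 1 - n))) := (hlim0.pow _).const_mul C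
        rwa [zero_pow (by omega), mul_zero] at this

/-! ### Construction of the solution in the algebra -/

theorem grpA_isExpGroup : ∃ C, IsExpGroup (grpA (d := d) m) C := by
  obtain ⟨C, hC, hb⟩ := exists_norm_grpA_le (d := d) m
  refine ⟨C, hC, hb, grpA_grpA m, fun g hg => ?_⟩
  rw [← continuousOn_univ]
  exact continuousOn_grpA m hg.continuousOn

theorem hasDerivAt_nearA (t : ℝ) :
    HasDerivAt (fun t => nearA m Φ k (Real.exp (-(e₀ * t))))
      (∑ j ∈ Finset.Icc 1 k, (-(j * e₀) * Real.exp (-(e₀ * t)) ^ j) • iota m (Φ j)) t := by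
  unfold nearA
  refine HasDerivAt.fun_sum fun j _ => HasDerivAt.smul_const ?_ _
  simp only [exp_pow_nat]
  have h1 : HasDerivAt (fun s : ℝ => Real.exp (-(j * e₀ * s)))
      (Real.exp (-(j * e₀ * t)) * (-(j * e₀ * 1))) t :=
    ((hasDerivAt_id t).const_mul (j * e₀)).neg.exp
  exact h1.congr_deriv (by ring)

/-- The equation satisfied by a relative perturbation of the ground state. -/
structure IsAlgSolution (T : ℝ) (z : ℝ → Alg d m) : Prop where
  cont : Continuous z
  cst_eq : ∀ t, cst m (z t) = 0
  small : ∀ t ≥ T, ‖z t‖ < 1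
  cont_nl : ContinuousOn (fun t => nlA m (z t)) (Set.Ici T)
  deriv : ∀ φ : 𝓢(E d, ℂ), ∀ t ≥ T, HasDerivAt (fun t => pairA m φ (z t))
    (Complex.I * (pairA m (Δ φ) (z t) + pairA m φ (nlA m (z t)))) t

-- The contraction argument around the near solution of order `k`. The radius `ρ` is left free so
-- that the constants of later norm comparisons can be absorbed.
variable {m e₀ Φ} in
theorem exists_algSolution (he : 0 < e₀)
    (hΦ : ∀ k : ℕ, 1 ≤ k → ∃ C : ℝ, ∀ᶠ t : ℝ in atTop, ∀ x, ‖nearError e₀ Φ k t x‖ ≤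
      C * Real.exp (-((k + 1) * e₀ * t))) (ρ : ℝ) (hρ : 0 < ρ) :
    ∃ k₀ : ℕ, 0 < k₀ ∧ ∀ k ≥ k₀, ∃ T, 0 ≤ T ∧ ∃ v : ℝ → Alg d m,
      (∀ t ≥ T, ‖v t‖ ≤ ρ * Real.exp (-((k + 1 / 2) * e₀ * t))) ∧
      IsAlgSolution m T fun t => nearA m Φ k (Real.exp (-(e₀ * t))) + v t := by
  obtain ⟨C, hS⟩ := grpA_isExpGroup (d := d) m
  obtain ⟨L, δ, hL, hδ, hδ1, hLip⟩ := exists_nlA_lipschitz (d := d) m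
  have hC := hS.pos
  -- The order must be large enough that `γ - 1` exceeds `2 C L`. The Lipschitz constant `L` does
  -- not depend on `k`, so this is possible.
  obtain ⟨k₀, hk₀⟩ := exists_nat_gt ((2 * (C * L) + 1) / e₀)
  refine ⟨k₀ + 1, Nat.succ_pos _, fun k hk => ?_⟩
  have hkγ : 2 * (C * L) + 1 < (k + 1 / 2) * e₀ := by
    rw [div_lt_iff₀ he] at hk₀
    have : (k₀ : ℝ) + 1 ≤ k := by exact_mod_cast hk
    nlinarith
  set γ := (k + 1 / 2) * e₀ with hγ
  obtain ⟨K, hK, hE⟩ := exists_errA_bound (m := m) he (hΦ k (by omega))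
  set h : ℝ → Alg d m := fun t => nearA m Φ k (Real.exp (-(e₀ * t))) with hh
  have hhc : Continuous h := (continuous_nearA m Φ k).comp (by fun_prop)
  have hlim0 : Tendsto (fun t => Real.exp (-(e₀ * t))) atTop (𝓝 0) :=
    (tendsto_exp_neg e₀ he).mono_right inf_le_left
  have hsm : ∀ᶠ t in atTop, ‖h t‖ < δ / 2 := by
    have h1 : ∀ᶠ s in 𝓝 (0 : ℝ), ‖nearA m Φ k s‖ < δ / 2 := by
      have := (continuous_nearA m Φ k).norm.continuousAt (x := 0)
      refine this.eventually (eventually_lt_nhds ?_)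
      change ‖nearA m Φ k 0‖ < δ / 2
      rw [nearA_zero, norm_zero]; positivity
    exact hlim0.eventually h1
  obtain ⟨T₀, hT₀⟩ := eventually_atTop.mp (hE.and hsm)
  -- The near solution solves the equation up to `errA`, so its correction `v` has this source; at
  -- `v = 0` only the error remains.
  set G : ℝ → Alg d m → Alg d m := fun t v =>
    nlA m (h t + v) - nlA m (h t) + errA m e₀ Φ k (Real.exp (-(e₀ * t))) with hG
  have hadd : ∀ t ≥ T₀, ∀ v : Alg d m, ‖v‖ ≤ min ρ (δ / 2) → ‖h t + v‖ ≤ δ := by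
    intro t ht v hv
    have h1 := norm_add_le (h t) v
    have h2 := (hT₀ t ht).2
    have h3 := hv.trans (min_le_right _ _)
    linarith
  have hnl : ∀ (z : ℝ → Alg d m) (s : Set ℝ), ContinuousOn z s → (∀ t ∈ s, ‖z t‖ ≤ δ) →
      ContinuousOn (fun t => nlA m (z t)) s := by
    intro z s hz hzs
    have hl : LipschitzOnWith (Real.toNNReal L) (nlA (d := d) m) {a | ‖a‖ ≤ δ} := by
      refine LipschitzOnWith.of_dist_le_mul fun a ha b hb => ?_
      rw [dist_eq_norm, dist_eq_norm, Real.coe_toNNReal _ hL]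
      exact hLip a b ha hb
    exact hl.continuousOn.comp hz hzs
  -- The surplus is `η = e₀/2`, since `(k + 1) e₀ = γ + e₀/2`. The ball has radius at most `δ/2`,
  -- the other half of `δ` being reserved for the near solution.
  obtain ⟨T, hT₀T, hT0, y, hy1, hy2, hy3⟩ := exists_duhamel (G := G) (L := L)
    (δ := min ρ (δ / 2)) (η := e₀ / 2) (K := K) (T₀ := T₀) (ρ := min ρ (δ / 2)) (γ := γ) hS
    (by positivity) le_rfl (by positivity) hL (by nlinarith [mul_nonneg hC.le hL])
    (by linarith) hK
    (fun t ht v v' hv hv' => by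
      have h1 := hLip _ _ (hadd t ht v hv) (hadd t ht v' hv')
      simp only [hG]
      rw [add_sub_add_right_eq_sub, sub_sub_sub_cancel_right]
      rwa [add_sub_add_left_eq_sub] at h1)
    (fun t ht => by
      simp only [hG, add_zero, sub_self, zero_add]
      refine ((hT₀ t ht).1).trans (le_of_eq ?_)
      congr 3; rw [hγ]; ring)
    (fun v hv hvs => by
      have hs1 : ∀ t ∈ {t : ℝ | T₀ ≤ t ∧ 0 ≤ t}, ‖h t‖ ≤ δ := fun t ht => by
        have := (hT₀ t ht.1).2; linarith
      have c1 := hnl (fun t => h t + v t) {t | T₀ ≤ t ∧ 0 ≤ t} (hhc.add hv).continuousOn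
        fun t ht => hadd t ht.1 _ (hvs t ht.1 ht.2)
      have c2 := hnl h {t | T₀ ≤ t ∧ 0 ≤ t} hhc.continuousOn hs1
      have c3 : ContinuousOn (fun t => ∑ j ∈ Finset.Icc 1 k, Real.exp (-(e₀ * t)) ^ j •
          iota m (Δ (Φ j) - (Complex.I * (j * e₀ : ℝ)) • Φ j)) {t | T₀ ≤ t ∧ 0 ≤ t} := by
        fun_prop
      exact (c1.sub c2).add (c3.add c2))
  set v : ℝ → Alg d m := fun t => grpA m t (y t) with hv
  have hvb : ∀ t ≥ T, ‖v t‖ ≤ min ρ (δ / 2) := by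
    intro t ht
    refine (hy1 t ht).trans ?_
    have h1 : Real.exp (-(γ * t)) ≤ 1 := by
      apply Real.exp_le_one_iff.mpr
      have : 0 ≤ γ * t := mul_nonneg (by nlinarith [mul_nonneg hC.le hL]) (hT0.trans ht)
      linarith
    have h2 : 0 < min ρ (δ / 2) := by positivity
    nlinarith
  refine ⟨T, hT0, v, fun t ht => ?_, hhc.add hy2, fun t => ?_, fun t ht => ?_, ?_, fun φ t ht => ?_⟩
  · refine (hy1 t ht).trans ?_
    gcongr
    exact min_le_left _ _
  · rw [map_add, cst_nearA, cst_grpA, add_zero]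
  · exact (hadd t (hT₀T.trans ht) _ (hvb t ht)).trans_lt hδ1
  · exact hnl _ _ (hhc.add hy2).continuousOn fun t ht => hadd t (hT₀T.trans ht) _ (hvb t ht)
  · have d1 : HasDerivAt (fun t => pairA m φ (h t)) _ t :=
      ((pairA m φ).restrictScalars ℝ).hasFDerivAt.comp_hasDerivAt t (hasDerivAt_nearA m e₀ Φ k t)
    have d2 := hasDerivAt_pairA_grpA m φ (hy3 t)
    rw [max_eq_right ht] at d2
    have d3 := d1.add d2
    have e1 : (fun t => pairA m φ (h t + v t)) =
        (fun t => pairA m φ (h t)) + fun t => pairA m φ (grpA m t (y t)) := by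
      funext t; simp only [Pi.add_apply, map_add]; rfl
    change HasDerivAt (fun t => pairA m φ (h t + v t)) _ t
    rw [e1]
    refine d3.congr_deriv (Eq.symm ?_)
    have e2 : ∀ a, pairA m φ (grpA m t (grpA m (-t) a)) = pairA m φ a := by
      intro a
      rw [pairA_grpA, pairA_grpA, grp_grp, neg_add_cancel, grp_zero]
    have e3 : ∀ j, pairA m φ (iota m (Δ (Φ j))) = pairA m (Δ φ) (iota m (Φ j)) := by
      intro j
      rw [pairA_iota, pairA_iota, integral_laplacian_mul]
    have e4 : ∀ (c : ℝ) (ψ : 𝓢(E d, ℂ)) (a : Alg d m), pairA m ψ (c • a) = (c : ℂ) * pairA m ψ a := by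
      intro c ψ a
      rw [← Complex.coe_smul, map_smul, smul_eq_mul]
    rw [map_smul, map_smul, e2]
    change _ = pairA m φ _ + _
    rw [show grpA m t (y t) = v t from rfl]
    simp only [hG, hh, errA, map_add, map_sub, map_sum, map_smul, smul_eq_mul, e4, e3, nearA,
      mul_sub, Finset.sum_sub_distrib]
    set s := Real.exp (-(e₀ * t))
    -- The time derivatives of the `e^{-j e₀ t}` cancel the terms `-i j e₀ Φ_j` in `errA`.
    have e5 : ∑ j ∈ Finset.Icc 1 k, ((-(j * e₀) * s ^ j : ℝ) : ℂ) * pairA m φ (iota m (Φ j)) =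
        Complex.I * ∑ j ∈ Finset.Icc 1 k,
          ((s ^ j : ℝ) : ℂ) * (Complex.I * ((j * e₀ : ℝ) : ℂ) * pairA m φ (iota m (Φ j))) := by
      rw [Finset.mul_sum]
      refine Finset.sum_congr rfl fun j _ => ?_
      push_cast
      linear_combination (-(s : ℂ) ^ j * (j * e₀) * pairA m φ (iota m (Φ j))) * Complex.I_mul_I
    rw [e5]
    ring

end EnergyCriticalNLS

namespace EnergyCriticalNLS

variable {d : ℕ} [hd : Fact (6 ≤ d)] {m : ℕ}

/-! ### From the algebra to solutions of the equation -/

/-- The function `W + f` of an element of the algebra. -/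
noncomputable def solFn (a : Alg d m) (x : E d) : ℂ := (W d x : ℂ) + fn m a x

theorem continuous_solFn (a : Alg d m) : Continuous (solFn a) :=
  continuous_W.add (continuous_fn_apply m a)

/-- The perturbation decays at least as fast as `W`. The bound serves both the space-time
integrability of the solution and its boundedness in the uniqueness argument. -/
theorem norm_solFn_le {a : Alg d m} (ha : ‖a‖ < 1) (x : E d) :
    ‖solFn a x‖ ≤ (1 + evalConst d m) * wt d (gsExp d) x := by
  have h6 := six_le_cast (d := d)
  have h1 := norm_fn_le_wt m a x
  have h2 : wt d (-d) x ≤ wt d (gsExp d) x := wt_mono (by unfold gsExp; linarith) x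
  have h3 := evalConst_nonneg (d := d) m
  have h4 : ‖(W d x : ℂ)‖ = wt d (gsExp d) x := by
    rw [Complex.norm_real, Real.norm_of_nonneg (W_pos x).le, W_eq_wt]
  have h5 := wt_pos (d := d) (gsExp d) x
  calc ‖solFn a x‖ ≤ wt d (gsExp d) x + evalConst d m * ‖a‖ * wt d (-d) x := by
        rw [← h4]; exact (norm_add_le _ _).trans (by linarith)
    _ ≤ wt d (gsExp d) x + evalConst d m * 1 * wt d (gsExp d) x := by
        have := wt_pos (d := d) (-d) x
        gcongr
    _ = _ := by ring

theorem norm_solFn_le' {a : Alg d m} (ha : ‖a‖ < 1) (x : E d) :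
    ‖solFn a x‖ ≤ 1 + evalConst d m := by
  have h6 := six_le_cast (d := d)
  have h3 := evalConst_nonneg (d := d) m
  have : wt d (gsExp d) x ≤ wt d 0 x := wt_mono (by unfold gsExp; linarith) x
  rw [wt_zero] at this
  refine (norm_solFn_le ha x).trans ?_
  nlinarith

theorem isWeakDeriv_solFn (hm : 1 ≤ m) (s : Fin 1 → Fin d) (a : Alg d m) :
    IsWeakDeriv s (solFn a) (fun x => gradW (s 0) x + wd m s a x) := by
  obtain ⟨h1, h2, h3⟩ := isWeakDeriv_W s
  obtain ⟨g1, g2, g3⟩ := isWeakDeriv_fn hm s a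
  refine ⟨h1.add g1, h2.add g2, fun φ hφ => ?_⟩
  have hc : Continuous φ := hφ.1.continuous
  have hc' : Continuous (iterPartial s φ) := by
    rw [← testS_coe hφ]
    have : iterPartial s (testS hφ) = derW s (testS hφ) := funext fun x => (derW_apply _ _ _).symm
    rw [this]; exact (derW s (testS hφ)).continuous
  have hcs : HasCompactSupport (iterPartial s φ) := by
    have := hφ.2.iteratedFDeriv (𝕜 := ℝ) 1
    refine this.mono' ?_
    intro x hx
    refine subset_closure ?_
    intro h0
    apply hx
    rw [iterPartial, h0]; simp
  have i1 := h2.integrable_smul_right_of_hasCompactSupport hc hφ.2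
  have i2 := g2.integrable_smul_right_of_hasCompactSupport hc hφ.2
  have i3 := h1.integrable_smul_right_of_hasCompactSupport hc' hcs
  have i4 := g1.integrable_smul_right_of_hasCompactSupport hc' hcs
  simp only [smul_eq_mul] at i1 i2 i3 i4
  simp only [solFn, add_mul]
  rw [integral_add i1 i2, integral_add i3 i4, h3 φ hφ, g3 φ hφ, mul_add]

theorem memHDot_solFn (hm : 1 ≤ m) (a : Alg d m) : MemHDot (solFn a) := by
  refine ⟨(memLp_W (d := d)).add (memLp_fn m a (by linarith [two_lt_sob (d := d)])), ?_⟩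
  refine lt_of_le_of_lt (iInf₂_le (fun s x => gradW (s 0) x + wd m s a x)
    fun s => isWeakDeriv_solFn hm s a) ?_
  have hG : ∀ s : Fin 1 → Fin d, MemLp (fun x => ‖gradW (s 0) x + wd m s a x‖) 2 volume :=
    fun s => ((memLp_gradW (s 0)).add (memLp_wd m s a)).norm
  have hsum := memLp_finsetSum Finset.univ fun s _ => hG s
  refine lt_of_le_of_lt (eLpNorm_mono_real fun x => ?_) hsum.2
  rw [one_mul, Real.norm_of_nonneg (Real.sqrt_nonneg _)]
  exact sqrt_sum_sq_le _ fun s => norm_nonneg _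

theorem integral_solFn_mul (a : Alg d m) (φ : 𝓢(E d, ℂ)) :
    ∫ x, solFn a x * φ x = (∫ x, (W d x : ℂ) * φ x) + pairA m φ a := by
  rw [pairA_apply, ← integral_add (by simpa only [W_eq_wt] using wt_mul_schwartz_integrable _ φ)
    (integrable_fn_mul m a φ)]
  congr 1; funext x; rw [solFn]; ring

theorem integral_nonlin_solFn_mul {a : Alg d m} (ha : ‖a‖ < 1) (h0 : cst m a = 0)
    (φ : 𝓢(E d, ℂ)) : ∫ x, nonlin d (solFn a x) * φ x =
      (∫ x, nonlin d (W d x : ℂ) * φ x) + pairA m φ (nlA m a) := by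
  rw [pairA_apply, ← integral_add (by simpa only [nonlin_W] using wt_mul_schwartz_integrable _ φ)
    (integrable_fn_mul m _ φ)]
  congr 1; funext x; rw [solFn, fn_nlA m ha h0]; ring

theorem isSolutionOn_solFn (hm : 1 ≤ m) {T : ℝ} {z : ℝ → Alg d m} (hz : IsAlgSolution m T z) :
    IsSolutionOn (Set.Ici T) fun t => solFn (z t) := by
  have h6 := six_le_cast (d := d)
  refine ⟨fun t _ => memHDot_solFn hm _, fun t₀ _ => ?_, fun K hK hKc => ?_, fun φ hφ t₁ ht₁ t₂ ht₂ => ?_⟩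
  · obtain ⟨C, hC, h⟩ := exists_hDotNorm_fn_le (d := d) hm
    have e : ∀ t, solFn (z t) - solFn (z t₀) = fn m (z t - z t₀) := by
      intro t; funext x; simp only [Pi.sub_apply, solFn, fn_sub]; ring
    simp only [e]
    have h1 : Tendsto (fun t => ENNReal.ofReal (C * ‖z t - z t₀‖)) (𝓝[Set.Ici T] t₀) (𝓝 0) := by
      have h2 : Continuous fun t => ENNReal.ofReal (C * ‖z t - z t₀‖) :=
        ENNReal.continuous_ofReal.comp (continuous_const.mul (hz.cont.sub continuous_const).norm)
      have h3 := (h2.tendsto t₀).mono_left (nhdsWithin_le_nhds (s := Set.Ici T))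
      simpa using h3
    exact tendsto_of_tendsto_of_tendsto_of_le_of_le tendsto_const_nhds h1 (fun t => zero_le)
      fun t => h _
  · set p := 2 * ((d : ℝ) + 2) / ((d : ℝ) - 2) with hp
    have hp0 : 0 < p := div_pos (by linarith) (by linarith)
    have hA := evalConst_nonneg (d := d) m
    -- The exponents multiply to `gsExp d * p = -(d + 2)`, so this majorant decays like
    -- `|x|^{-2(d+2)}`.
    have hwt : ∫⁻ x : E d, ‖(1 + evalConst d m) ^ p * wt d (gsExp d * p) x‖ₑ < ⊤ := by
      have : (d : ℝ) < -(2 * (gsExp d * p)) := by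
        have h : (d : ℝ) - 2 ≠ 0 := by linarith
        have : gsExp d * p = -(d + 2) := by rw [hp]; unfold gsExp; field_simp
        rw [this]; linarith
      exact ((wt_integrable this).const_mul _).2
    have hb : ∀ t ∈ K, ∫⁻ x, ‖solFn (z t) x‖ₑ ^ p ≤
        ∫⁻ x : E d, ‖(1 + evalConst d m) ^ p * wt d (gsExp d * p) x‖ₑ := by
      intro t ht
      refine lintegral_mono fun x => ?_
      have h1 := norm_solFn_le (hz.small t (hK ht)) x
      rw [← ofReal_norm_eq_enorm, ← ofReal_norm_eq_enorm, ENNReal.ofReal_rpow_of_nonneg (norm_nonneg _) hp0.le,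
        ← wt_rpow, ← Real.mul_rpow (by positivity) (wt_pos _ x).le]
      exact ENNReal.ofReal_le_ofReal ((Real.rpow_le_rpow (norm_nonneg _) h1 hp0.le).trans (le_abs_self _))
    calc _ ≤ ∫⁻ t in K, ∫⁻ x : E d, ‖(1 + evalConst d m) ^ p * wt d (gsExp d * p) x‖ₑ :=
          setLIntegral_mono' hKc.measurableSet hb
      _ < ⊤ := by
          rw [setLIntegral_const]
          exact ENNReal.mul_lt_top hwt hKc.measure_lt_top
  · set ψ := testS hφ
    have hsub : Set.uIcc t₁ t₂ ⊆ Set.Ici T := by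
      intro t ht
      have h1 := (Set.mem_uIcc.mp ht)
      rcases h1 with h | h
      · exact le_trans ht₁ h.1
      · exact le_trans ht₂ h.1
    have e1 : ∀ t, ∫ x, solFn (z t) x * φ x = (∫ x, (W d x : ℂ) * ψ x) + pairA m ψ (z t) :=
      fun t => integral_solFn_mul (z t) ψ
    have e2 : ∀ t ∈ Set.uIcc t₁ t₂, (∫ x, solFn (z t) x * (Δ φ) x) +
        ∫ x, nonlin d (solFn (z t) x) * φ x = pairA m (Δ ψ) (z t) + pairA m ψ (nlA m (z t)) := by
      intro t ht
      have a1 := integral_solFn_mul (z t) (Δ ψ)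
      have a2 := integral_nonlin_solFn_mul (hz.small t (hsub ht)) (hz.cst_eq t) ψ
      -- The `W` term becomes minus the pairing of `F(W)`, which cancels the one in `a2`.
      rw [integral_W_laplacian] at a1
      simp only [SchwartzMap.laplacian_apply] at a1
      have c : ⇑ψ = φ := testS_coe hφ
      rw [c] at a1 a2
      rw [a1, a2]; ring
    rw [e1, e1, intervalIntegral.integral_congr e2]
    have hder : ∀ t ∈ Set.uIcc t₁ t₂, HasDerivAt (fun t => Complex.I * pairA m ψ (z t))
        (-(pairA m (Δ ψ) (z t) + pairA m ψ (nlA m (z t)))) t := by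
      intro t ht
      refine ((hz.deriv ψ t (hsub ht)).const_mul Complex.I).congr_deriv ?_
      rw [← mul_assoc, Complex.I_mul_I]; ring
    have hcont : ContinuousOn (fun t => -(pairA m (Δ ψ) (z t) + pairA m ψ (nlA m (z t))))
        (Set.uIcc t₁ t₂) := by
      have b1 := hz.cont_nl.mono hsub
      exact (((pairA m (Δ ψ)).continuous.comp hz.cont).continuousOn.add
        ((pairA m ψ).continuous.comp_continuousOn b1)).neg
    have h := intervalIntegral.integral_eq_sub_of_hasDerivAt hder hcont.intervalIntegrable
    rw [intervalIntegral.integral_neg] at h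
    linear_combination -h

end EnergyCriticalNLS

namespace EnergyCriticalNLS

variable {d : ℕ} [hd : Fact (6 ≤ d)]

/-! ### Lebesgue spaces and multiplication operators -/

/-- The Sobolev exponent `2d/(d-2)`. -/
noncomputable def exR (d : ℕ) : ℝ≥0∞ := ENNReal.ofReal (2 * d / ((d : ℝ) - 2))

/-- The exponent `2d/(d+2)`, dual to `2d/(d-2)`. -/
noncomputable def exR' (d : ℕ) : ℝ≥0∞ := ENNReal.ofReal (2 * d / ((d : ℝ) + 2))

/-- The exponent `d`. -/
noncomputable def exD (d : ℕ) : ℝ≥0∞ := ENNReal.ofReal d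

/-- The exponent `d/2`. -/
noncomputable def exH (d : ℕ) : ℝ≥0∞ := ENNReal.ofReal ((d : ℝ) / 2)

instance : Fact (1 ≤ exR d) := ⟨by
  have h6 := six_le_cast (d := d)
  rw [exR, ENNReal.one_le_ofReal, le_div_iff₀ (by linarith)]; linarith⟩

instance : Fact (1 ≤ exR' d) := ⟨by
  have h6 := six_le_cast (d := d)
  rw [exR', ENNReal.one_le_ofReal, le_div_iff₀ (by linarith)]; linarith⟩

instance : Fact (1 ≤ exD d) := ⟨by
  have h6 := six_le_cast (d := d)
  rw [exD, ENNReal.one_le_ofReal]; linarith⟩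

theorem holderTriple_of_real {p q r : ℝ} (hp : 0 < p) (hq : 0 < q) (hr : 0 < r)
    (h : p⁻¹ + q⁻¹ = r⁻¹) :
    ENNReal.HolderTriple (ENNReal.ofReal p) (ENNReal.ofReal q) (ENNReal.ofReal r) := ⟨by
  rw [← ENNReal.ofReal_inv_of_pos hp, ← ENNReal.ofReal_inv_of_pos hq, ← ENNReal.ofReal_inv_of_pos hr,
    ← ENNReal.ofReal_add (by positivity) (by positivity), h]⟩

instance : ENNReal.HolderTriple (exD d) (exR d) 2 := by
  have h6 := six_le_cast (d := d)
  have h : (d : ℝ) - 2 ≠ 0 := by linarith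
  have h' : (d : ℝ) ≠ 0 := by linarith
  have := holderTriple_of_real (p := d) (q := 2 * d / ((d : ℝ) - 2)) (r := 2) (by linarith)
    (div_pos (by linarith) (by linarith)) two_pos (by field_simp; ring)
  simpa [exD, exR] using this

instance : ENNReal.HolderTriple (exH d) (exR d) (exR' d) := by
  have h6 := six_le_cast (d := d)
  have h : (d : ℝ) - 2 ≠ 0 := by linarith
  have h' : (d : ℝ) ≠ 0 := by linarith
  have h'' : (d : ℝ) + 2 ≠ 0 := by linarith
  exact holderTriple_of_real (by linarith) (div_pos (by linarith) (by linarith))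
    (div_pos (by linarith) (by linarith)) (by field_simp; ring)

instance : ENNReal.HolderConjugate (exR' d) (exR d) := by
  have h6 := six_le_cast (d := d)
  have h : (d : ℝ) - 2 ≠ 0 := by linarith
  have h' : (d : ℝ) ≠ 0 := by linarith
  have h'' : (d : ℝ) + 2 ≠ 0 := by linarith
  have := holderTriple_of_real (p := 2 * d / ((d : ℝ) + 2)) (q := 2 * d / ((d : ℝ) - 2)) (r := 1)
    (div_pos (by linarith) (by linarith)) (div_pos (by linarith) (by linarith)) one_pos
    (by field_simp; ring)
  simpa [exR', exR] using this

/-- The space `L²(ℝ^d)`. -/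
abbrev LTwo (d : ℕ) : Type := Lp ℂ 2 (volume : Measure (E d))

/-- The space `L^{2d/(d-2)}(ℝ^d)`. -/
abbrev LR (d : ℕ) : Type := Lp ℂ (exR d) (volume : Measure (E d))

/-- The space `L^{2d/(d+2)}(ℝ^d)`. -/
abbrev LR' (d : ℕ) : Type := Lp ℂ (exR' d) (volume : Measure (E d))

/-- Multiplication by a Schwartz function on `L^p`. -/
noncomputable def mulLp {p : ℝ≥0∞} [Fact (1 ≤ p)] (χ : 𝓢(E d, ℂ)) :
    Lp ℂ p (volume : Measure (E d)) →L[ℂ] Lp ℂ p (volume : Measure (E d)) :=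
  (ContinuousLinearMap.mul ℂ ℂ).holderL volume ∞ p p (χ.toLp ∞ volume)

theorem coeFn_mulLp {p : ℝ≥0∞} [Fact (1 ≤ p)] (χ : 𝓢(E d, ℂ))
    (f : Lp ℂ p (volume : Measure (E d))) : mulLp χ f =ᵐ[volume] fun x => χ x * f x := by
  filter_upwards [(ContinuousLinearMap.mul ℂ ℂ).coeFn_holder (r := p) (χ.toLp ∞ volume) f,
    χ.coeFn_toLp ∞ volume] with x h1 h2
  change ((ContinuousLinearMap.mul ℂ ℂ).holder p (χ.toLp ∞ volume) f : E d → ℂ) x = _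
  rw [h1, h2]; rfl

theorem norm_mulLp_le {p : ℝ≥0∞} [Fact (1 ≤ p)] {χ : 𝓢(E d, ℂ)} {C : ℝ} (hC : ∀ x, ‖χ x‖ ≤ C)
    (f : Lp ℂ p (volume : Measure (E d))) : ‖mulLp χ f‖ ≤ C * ‖f‖ := by
  refine Lp.norm_le_mul_norm_of_ae_le_mul ?_
  filter_upwards [coeFn_mulLp χ f] with x hx
  rw [hx, norm_mul]
  gcongr
  exact hC x

/-- Multiplication by a Schwartz function from `L^{2d/(d-2)}` to `L²`. -/
noncomputable def mulR (χ : 𝓢(E d, ℂ)) : LR d →L[ℂ] LTwo d :=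
  (ContinuousLinearMap.mul ℂ ℂ).holderL volume (exD d) (exR d) 2 (χ.toLp (exD d) volume)

theorem coeFn_mulR (χ : 𝓢(E d, ℂ)) (f : LR d) : mulR χ f =ᵐ[volume] fun x => χ x * f x := by
  filter_upwards [(ContinuousLinearMap.mul ℂ ℂ).coeFn_holder (r := 2) (χ.toLp (exD d) volume) f,
    χ.coeFn_toLp (exD d) volume] with x h1 h2
  change ((ContinuousLinearMap.mul ℂ ℂ).holder 2 (χ.toLp (exD d) volume) f : E d → ℂ) x = _
  rw [h1, h2]; rfl

theorem norm_mulR_le (χ : 𝓢(E d, ℂ)) (f : LR d) :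
    ‖mulR χ f‖ ≤ ‖χ.toLp (exD d) (volume : Measure (E d))‖ * ‖f‖ := by
  have := (ContinuousLinearMap.mul ℂ ℂ).norm_holder_apply_apply_le (r := 2)
    (χ.toLp (exD d) (volume : Measure (E d))) f
  rw [ContinuousLinearMap.opNorm_mul, one_mul] at this
  exact this

theorem mulLp_toLp {p : ℝ≥0∞} [Fact (1 ≤ p)] (χ f : 𝓢(E d, ℂ)) :
    mulLp χ (f.toLp p (volume : Measure (E d))) = (smul' χ f).toLp p volume := by
  apply Lp.ext
  filter_upwards [coeFn_mulLp χ (f.toLp p (volume : Measure (E d))), f.coeFn_toLp p volume,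
    (smul' χ f).coeFn_toLp p volume] with x h1 h2 h3
  rw [h1, h2, h3, smul'_apply]

theorem mulR_toLp (χ f : 𝓢(E d, ℂ)) :
    mulR χ (f.toLp (exR d) volume) = (smul' χ f).toLp 2 volume := by
  apply Lp.ext
  filter_upwards [coeFn_mulR χ (f.toLp (exR d) volume), f.coeFn_toLp (exR d) volume,
    (smul' χ f).coeFn_toLp 2 volume] with x h1 h2 h3
  rw [h1, h2, h3, smul'_apply]

theorem mulLp_mulR (η χ : 𝓢(E d, ℂ)) (f : LR d) : mulLp η (mulR χ f) = mulR (smul' η χ) f := by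
  apply Lp.ext
  filter_upwards [coeFn_mulLp η (mulR χ f), coeFn_mulR χ f, coeFn_mulR (smul' η χ) f]
    with x h1 h2 h3
  rw [h1, h2, h3, smul'_apply, mul_assoc]

theorem mulLp_mulLp {p : ℝ≥0∞} [Fact (1 ≤ p)] (η χ : 𝓢(E d, ℂ))
    (f : Lp ℂ p (volume : Measure (E d))) : mulLp η (mulLp χ f) = mulLp (smul' η χ) f := by
  apply Lp.ext
  filter_upwards [coeFn_mulLp η (mulLp χ f), coeFn_mulLp χ f, coeFn_mulLp (smul' η χ) f]
    with x h1 h2 h3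
  rw [h1, h2, h3, smul'_apply, mul_assoc]

theorem smul'_comm (f g : 𝓢(E d, ℂ)) : smul' f g = smul' g f := by
  ext x; rw [smul'_apply, smul'_apply, mul_comm]

/-- The bilinear pairing of `L^{2d/(d+2)}` and `L^{2d/(d-2)}`. -/
noncomputable def pairR : LR' d →L[ℂ] LR d →L[ℂ] ℂ :=
  (ContinuousLinearMap.mul ℂ ℂ).lpPairing volume (exR' d) (exR d)

theorem pairR_apply (g : LR' d) (f : LR d) : pairR g f = ∫ x, g x * f x :=
  (ContinuousLinearMap.mul ℂ ℂ).lpPairing_eq_integral g f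

theorem pairR_toLp_right (g : LR' d) (φ : 𝓢(E d, ℂ)) :
    pairR g (φ.toLp (exR d) volume) = ∫ x, g x * φ x := by
  rw [pairR_apply]
  refine integral_congr_ae ?_
  filter_upwards [φ.coeFn_toLp (exR d) volume] with x hx
  rw [hx]

theorem pairR_toLp_left (φ : 𝓢(E d, ℂ)) (f : LR d) :
    pairR (φ.toLp (exR' d) volume) f = ∫ x, f x * φ x := by
  rw [pairR_apply]
  refine integral_congr_ae ?_
  filter_upwards [φ.coeFn_toLp (exR' d) volume] with x hx
  rw [hx, mul_comm]

/-! ### Pointwise estimates of the nonlinearity -/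

/-- By homogeneity this is `|z^s - 1| ≤ |z - 1|` for `z = x/y ≥ 0` and exponent at most one. The
factor `y` removes the singularity at `y = 0`. It is here that `4/(d-2) ≤ 1`, that is `d ≥ 6`,
enters. -/
theorem mul_abs_rpow_sub_le {x y s : ℝ} (hx : 0 ≤ x) (hy : 0 ≤ y) (hs : 0 < s) (hs1 : s ≤ 1) :
    y * |x ^ s - y ^ s| ≤ y ^ s * |x - y| := by
  rcases hy.eq_or_lt with rfl | hy
  · simp [Real.zero_rpow hs.ne']
  have key : |(x / y) ^ s - 1| ≤ |x / y - 1| := by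
    have hz : 0 ≤ x / y := by positivity
    rcases le_total (x / y) 1 with h | h
    · rw [abs_of_nonpos (by linarith [Real.rpow_le_one hz h hs.le]), abs_of_nonpos (by linarith)]
      have := Real.rpow_le_rpow_of_exponent_ge' hz h hs.le hs1
      rw [Real.rpow_one] at this; linarith
    · rw [abs_of_nonneg (by linarith [Real.one_le_rpow h hs.le]), abs_of_nonneg (by linarith)]
      have := Real.rpow_le_rpow_of_exponent_le h hs1
      rw [Real.rpow_one] at this; linarith
  have e1 : x ^ s - y ^ s = y ^ s * ((x / y) ^ s - 1) := by
    rw [Real.div_rpow hx hy.le, mul_sub, mul_div_cancel₀ _ (Real.rpow_pos_of_pos hy s).ne', mul_one]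
  have e2 : x - y = y * (x / y - 1) := by rw [mul_sub, mul_div_cancel₀ _ hy.ne', mul_one]
  have h3 := Real.rpow_pos_of_pos hy s
  rw [e1, e2, abs_mul, abs_mul, abs_of_pos h3, abs_of_pos hy]
  calc y * (y ^ s * |(x / y) ^ s - 1|) = y ^ s * (y * |(x / y) ^ s - 1|) := by ring
    _ ≤ _ := by gcongr

theorem nonlin_sub (v u : ℂ) : nonlin d v - nonlin d u =
    ((‖v‖ ^ alpha d : ℝ) : ℂ) * (v - u) + ((‖v‖ ^ alpha d - ‖u‖ ^ alpha d : ℝ) : ℂ) * u := by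
  rw [nonlin_eq, nonlin_eq]; push_cast; ring

theorem norm_nonlin_sub_aux (v u : ℂ) :
    ‖((‖v‖ ^ alpha d - ‖u‖ ^ alpha d : ℝ) : ℂ) * u‖ ≤ ‖u‖ ^ alpha d * ‖v - u‖ := by
  rw [norm_mul, Complex.norm_real, Real.norm_eq_abs, mul_comm]
  refine (mul_abs_rpow_sub_le (norm_nonneg v) (norm_nonneg u) alpha_pos alpha_le_one).trans ?_
  gcongr
  exact abs_norm_sub_norm_le v u

theorem norm_nonlin_sub_le (v u : ℂ) :
    ‖nonlin d v - nonlin d u‖ ≤ (‖v‖ ^ alpha d + ‖u‖ ^ alpha d) * ‖v - u‖ := by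
  rw [nonlin_sub, add_mul]
  refine (norm_add_le _ _).trans (add_le_add (le_of_eq ?_) (norm_nonlin_sub_aux v u))
  rw [norm_mul, Complex.norm_real, Real.norm_of_nonneg (by positivity)]

/-- In the splitting `nonlin_sub` the part with `|v|^α` contributes the real number `|v|^α |v -
u|²`. Only `|u|^α` survives in the imaginary part, so only one of the two solutions has to be
bounded. -/
theorem abs_im_nonlin_sub_le (v u : ℂ) :
    |((nonlin d v - nonlin d u) * conj (v - u)).im| ≤ ‖u‖ ^ alpha d * ‖v - u‖ ^ 2 := by
  rw [nonlin_sub, add_mul, Complex.add_im]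
  have h1 : (((‖v‖ ^ alpha d : ℝ) : ℂ) * (v - u) * conj (v - u)).im = 0 := by
    rw [mul_assoc, Complex.mul_conj, ← Complex.ofReal_mul, Complex.ofReal_im]
  rw [h1, zero_add]
  refine (Complex.abs_im_le_norm _).trans ?_
  rw [norm_mul, Complex.norm_conj, pow_two, ← mul_assoc]
  gcongr
  exact norm_nonlin_sub_aux v u

theorem continuous_nonlin : Continuous (nonlin d) := by
  have h : Continuous fun z : ℂ => ‖z‖ ^ alpha d :=
    continuous_norm.rpow_const fun _ => Or.inr alpha_pos.le
  exact (Complex.continuous_ofReal.comp h).mul continuous_id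

theorem nonlin_zero : nonlin d 0 = 0 := by simp [nonlin]

theorem exH_mul_alpha : exH d * ENNReal.ofReal (alpha d) = exR d := by
  have h6 := six_le_cast (d := d)
  have h : (d : ℝ) - 2 ≠ 0 := by linarith
  rw [exH, exR, ← ENNReal.ofReal_mul (by positivity)]
  congr 1
  unfold alpha
  field_simp
  ring

theorem one_le_exH : 1 ≤ exH d := by
  have h6 := six_le_cast (d := d)
  rw [exH, ENNReal.one_le_ofReal]; linarith

/-- Hölder with exponents `d/2` and `2d/(d-2)`: the power `α` of a function in `L^{2d/(d-2)}` is in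
`L^{d/2}`. -/
theorem eLpNorm_nonlin_sub_le {f g : E d → ℂ} (hf : AEStronglyMeasurable f volume)
    (hg : AEStronglyMeasurable g volume) :
    eLpNorm (fun x => nonlin d (f x) - nonlin d (g x)) (exR' d) volume ≤
      (eLpNorm f (exR d) volume ^ alpha d + eLpNorm g (exR d) volume ^ alpha d) *
        eLpNorm (fun x => f x - g x) (exR d) volume := by
  have m1 : ∀ {f : E d → ℂ}, AEStronglyMeasurable f volume →
      AEStronglyMeasurable (fun x => ‖f x‖ ^ alpha d) volume := fun hf =>
    (Real.continuous_rpow_const alpha_pos.le).comp_aestronglyMeasurable hf.norm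
  have h1 : eLpNorm (fun x => nonlin d (f x) - nonlin d (g x)) (exR' d) volume ≤
      eLpNorm ((fun x => ‖f x‖ ^ alpha d + ‖g x‖ ^ alpha d) • fun x => f x - g x) (exR' d) volume := by
    refine eLpNorm_mono fun x => ?_
    simp only [Pi.smul_apply', norm_smul]
    rw [Real.norm_of_nonneg (by positivity)]
    exact norm_nonlin_sub_le _ _
  refine h1.trans ((eLpNorm_smul_le_mul_eLpNorm (p := exH d) (q := exR d) (hf.sub hg)
    ((m1 hf).add (m1 hg))).trans ?_)
  refine mul_le_mul' ?_ le_rfl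
  refine (eLpNorm_add_le (m1 hf) (m1 hg) one_le_exH).trans (le_of_eq ?_)
  rw [eLpNorm_norm_rpow f alpha_pos, eLpNorm_norm_rpow g alpha_pos, exH_mul_alpha]

theorem memLp_nonlin {f : E d → ℂ} (hf : MemLp f (exR d) volume) :
    MemLp (fun x => nonlin d (f x)) (exR' d) volume := by
  refine ⟨continuous_nonlin.comp_aestronglyMeasurable hf.1, ?_⟩
  have := eLpNorm_nonlin_sub_le hf.1 (aestronglyMeasurable_const (b := (0 : ℂ)))
  simp only [nonlin_zero, sub_zero] at this
  refine lt_of_le_of_lt this (ENNReal.mul_lt_top (ENNReal.add_lt_top.mpr ⟨?_, ?_⟩) hf.2)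
  · exact ENNReal.rpow_lt_top_of_nonneg alpha_pos.le hf.2.ne
  · exact ENNReal.rpow_lt_top_of_nonneg alpha_pos.le (by simp)

/-- The nonlinearity as a map from `L^{2d/(d-2)}` to `L^{2d/(d+2)}`. -/
noncomputable def nlR (f : LR d) : LR' d := (memLp_nonlin (Lp.memLp f)).toLp

theorem coeFn_nlR (f : LR d) : nlR f =ᵐ[volume] fun x => nonlin d (f x) := MemLp.coeFn_toLp _

theorem norm_nlR_sub_le (f g : LR d) :
    ‖nlR f - nlR g‖ ≤ (‖f‖ ^ alpha d + ‖g‖ ^ alpha d) * ‖f - g‖ := by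
  have h := eLpNorm_nonlin_sub_le (Lp.aestronglyMeasurable f) (Lp.aestronglyMeasurable g)
  have e1 : eLpNorm (fun x => nonlin d (f x) - nonlin d (g x)) (exR' d) volume =
      ‖nlR f - nlR g‖ₑ := by
    rw [Lp.enorm_def]
    refine eLpNorm_congr_ae ?_
    filter_upwards [coeFn_nlR f, coeFn_nlR g, Lp.coeFn_sub (nlR f) (nlR g)] with x h1 h2 h3
    rw [h3, Pi.sub_apply, h1, h2]
  have e2 : eLpNorm (fun x => f x - g x) (exR d) volume = ‖f - g‖ₑ := by
    rw [Lp.enorm_def]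
    exact eLpNorm_congr_ae (Lp.coeFn_sub f g).symm
  rw [e1, e2, ← Lp.enorm_def, ← Lp.enorm_def, ← ofReal_norm_eq_enorm, ← ofReal_norm_eq_enorm,
    ← ofReal_norm_eq_enorm, ← ofReal_norm_eq_enorm,
    ENNReal.ofReal_rpow_of_nonneg (norm_nonneg _) alpha_pos.le,
    ENNReal.ofReal_rpow_of_nonneg (norm_nonneg _) alpha_pos.le,
    ← ENNReal.ofReal_add (by positivity) (by positivity),
    ← ENNReal.ofReal_mul (by positivity)] at h
  exact (ENNReal.ofReal_le_ofReal_iff (by positivity)).mp h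

theorem continuous_nlR : Continuous (nlR (d := d)) := by
  rw [continuous_iff_continuousAt]
  intro f
  rw [ContinuousAt, tendsto_iff_norm_sub_tendsto_zero]
  refine squeeze_zero (fun _ => norm_nonneg _) (fun g => norm_nlR_sub_le g f) ?_
  have hc : Continuous fun g : LR d => (‖g‖ ^ alpha d + ‖f‖ ^ alpha d) * ‖g - f‖ :=
    ((continuous_norm.rpow_const fun _ => Or.inr alpha_pos.le).add continuous_const).mul
      (continuous_id.sub continuous_const).norm
  have := hc.tendsto f
  simpa using this

end EnergyCriticalNLS

namespace EnergyCriticalNLS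

variable {d : ℕ} [hd : Fact (6 ≤ d)]

open scoped FourierTransform

/-! ### Density of Schwartz functions in the Sobolev space of order one -/

/-- The inverse of the symbol `1 + |ξ|²` is again a multiplier on Schwartz functions. Surjectivity
provides enough test functions for the orthogonality argument in `exists_seq_schwartz`. -/
theorem bessel_surjective (g : 𝓢(E d, ℂ)) : ∃ f, bessel f = g := by
  have ht : Function.HasTemperateGrowth
      (fun ξ : E d => (((1 + ‖ξ‖ ^ 2) ^ (-(1 : ℝ)) : ℝ) : ℂ)) := by fun_prop
  refine ⟨𝓕⁻ (SchwartzMap.smulLeftCLM ℂ (fun ξ : E d => (((1 + ‖ξ‖ ^ 2) ^ (-(1 : ℝ)) : ℝ) : ℂ))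
    (𝓕 g)), ?_⟩
  have key : ∀ f : 𝓢(E d, ℂ), 𝓕 (bessel f) = 𝓕 g → bessel f = g := by
    intro f hf
    have h : 𝓕⁻ (𝓕 (bessel f)) = 𝓕⁻ (𝓕 g) := by rw [hf]
    rwa [FourierTransform.fourierInv_fourier_eq, FourierTransform.fourierInv_fourier_eq] at h
  apply key
  ext ξ
  rw [fourier_bessel_apply, FourierTransform.fourier_fourierInv_eq,
    SchwartzMap.smulLeftCLM_apply_apply ht, smul_eq_mul, ← mul_assoc, ← Complex.ofReal_mul,
    Real.rpow_neg_one, mul_inv_cancel₀ (by positivity), Complex.ofReal_one, one_mul]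

theorem eq_zero_of_inner_toLp {g : LTwo d}
    (h : ∀ φ : 𝓢(E d, ℂ), inner ℂ (φ.toLp 2 volume) g = 0) : g = 0 := by
  have hd' : DenseRange (SchwartzMap.toLpCLM ℝ ℂ 2 (volume : Measure (E d))) :=
    SchwartzMap.denseRange_toLpCLM (by simp)
  have : inner ℂ g g = 0 :=
    hd'.induction_on (p := fun a => inner ℂ a g = 0) g
      (isClosed_eq (by fun_prop) continuous_const) fun φ => h φ
  exact inner_self_eq_zero.mp this

theorem integral_toLp_der (j : Fin d) (f φ : 𝓢(E d, ℂ)) :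
    inner ℂ (φ.toLp 2 volume) ((der j f).toLp 2 volume) =
      -inner ℂ ((der j φ).toLp 2 volume) (f.toLp 2 volume) := by
  have h1 := integral_der_mul j f (conjS φ)
  rw [conjS_der] at h1
  rw [integral_mul_eq_inner, integral_mul_eq_inner, conjS_conjS, conjS_conjS] at h1
  exact h1

/-- Tuples of `d + 1` functions in `L²`. -/
abbrev LTwoTuple (d : ℕ) : Type := PiLp 2 fun _ : Option (Fin d) => LTwo d

/-- Functions in `L²` with a weak gradient in `L²` are limits of Schwartz functions. -/
theorem exists_seq_schwartz {ψ : LTwo d} {g : Fin d → LTwo d}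
    (h : ∀ (j : Fin d) (φ : 𝓢(E d, ℂ)), inner ℂ (φ.toLp 2 volume) (g j) =
      -inner ℂ ((der j φ).toLp 2 volume) ψ) :
    ∃ f : ℕ → 𝓢(E d, ℂ), Tendsto (fun n => (f n).toLp 2 volume) atTop (𝓝 ψ) ∧
      ∀ j, Tendsto (fun n => (der j (f n)).toLp 2 volume) atTop (𝓝 (g j)) := by
  -- This scaling of the gradient makes pairing with `J f` produce the operator `bessel`.
  let c : ℂ := (((2 * Real.pi)⁻¹ : ℝ) : ℂ)
  have hc : c ≠ 0 := by simp [c, Real.pi_ne_zero]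
  have hcc : conj c = c := Complex.conj_ofReal _
  let T2 := SchwartzMap.toLpCLM ℂ ℂ 2 (volume : Measure (E d))
  let J : 𝓢(E d, ℂ) →ₗ[ℂ] LTwoTuple d :=
    { toFun := fun f => WithLp.toLp 2 fun o => o.elim (T2 f) fun j => c • T2 (der j f)
      map_add' := fun f f' => by
        ext1 o
        rw [PiLp.add_apply]
        cases o <;> simp
      map_smul' := fun a f => by
        ext1 o
        rw [PiLp.smul_apply]
        cases o
        · simp
        · simp [smul_comm a c] }
  let K := (LinearMap.range J).topologicalClosure
  let H : LTwoTuple d := WithLp.toLp 2 fun o => o.elim ψ fun j => c • g j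
  haveI : CompleteSpace K := (Submodule.isClosed_topologicalClosure _).completeSpace_coe
  obtain ⟨y, hy, z, hz, hyz⟩ := K.exists_add_mem_mem_orthogonal H
  -- `R` says that the last components are the scaled weak gradient of the first. It is a closed
  -- linear condition, so the component `z` orthogonal to the Schwartz graphs inherits it.
  let R : LTwoTuple d → Prop := fun a => ∀ (j : Fin d) (φ : 𝓢(E d, ℂ)),
    inner ℂ (φ.toLp 2 volume) (a (some j)) = -(c * inner ℂ ((der j φ).toLp 2 volume) (a none))
  have hRH : R H := fun j φ => by
    change inner ℂ (φ.toLp 2 volume) (c • g j) = -(c * inner ℂ _ ψ)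
    rw [inner_smul_right, h j φ, mul_neg]
  have hRJ : ∀ f, R (J f) := fun f j φ => by
    change inner ℂ (φ.toLp 2 volume) (c • (der j f).toLp 2 volume) =
      -(c * inner ℂ _ (f.toLp 2 volume))
    rw [inner_smul_right, integral_toLp_der, mul_neg]
  have hRcl : IsClosed {a : LTwoTuple d | R a} := by
    simp only [R, Set.setOf_forall]
    refine isClosed_iInter fun j => isClosed_iInter fun φ => isClosed_eq ?_ ?_ <;> fun_prop
  have hRy : R y := by
    have : (K : Set (LTwoTuple d)) ⊆ {a | R a} := by
      refine closure_minimal ?_ hRcl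
      rintro _ ⟨f, rfl⟩
      exact hRJ f
    exact this hy
  have hRz : R z := fun j φ => by
    have e : z = H - y := by rw [hyz]; abel
    have e1 : ∀ o, z o = H o - y o := fun o => by rw [e]; rfl
    rw [e1, e1, inner_sub_right, inner_sub_right, hRH j φ, hRy j φ]
    ring
  -- Orthogonality to every `J f`, rewritten through `R`, reads `⟨bessel f, z none⟩ = 0`, and
  -- `bessel` is onto.
  have hz0 : z none = 0 := by
    refine eq_zero_of_inner_toLp fun φ => ?_
    obtain ⟨f, rfl⟩ := bessel_surjective φ
    have h1 : inner ℂ (J f) z = 0 :=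
      (Submodule.mem_orthogonal K z).mp hz _ (Submodule.le_topologicalClosure _ ⟨f, rfl⟩)
    rw [PiLp.inner_apply, Fintype.sum_option] at h1
    have h2 : ∀ j, inner ℂ ((J f) (some j)) (z (some j)) =
        -(c * c * inner ℂ ((der j (der j f)).toLp 2 volume) (z none)) := fun j => by
      change inner ℂ (c • (der j f).toLp 2 volume) _ = _
      rw [inner_smul_left, hRz j, hcc]; ring
    have h3 : inner ℂ ((J f) none) (z none) = inner ℂ (f.toLp 2 volume) (z none) := rfl
    rw [h3, Finset.sum_congr rfl fun j _ => h2 j, Finset.sum_neg_distrib, ← Finset.mul_sum,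
      ← sum_inner] at h1
    have h4 : (bessel f).toLp 2 volume = f.toLp 2 volume -
        (c * c) • ∑ j, (der j (der j f)).toLp 2 (volume : Measure (E d)) := by
      have : bessel f = f - (c * c) • ∑ j, der j (der j f) := by
        rw [bessel, laplacian_eq_der]
        ext x
        have : (c * c) = ((((2 * Real.pi) ^ 2)⁻¹ : ℝ) : ℂ) := by
          simp only [c]; push_cast; ring
        rw [this]
        simp
      rw [this]
      change T2 _ = T2 f - (c * c) • ∑ j, T2 _
      simp
    rw [h4, inner_sub_left, inner_smul_left, map_mul, hcc]
    rw [sub_eq_add_neg]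
    exact h1
  have hzj : ∀ j, z (some j) = 0 := fun j => eq_zero_of_inner_toLp fun φ => by
    rw [hRz j φ, hz0]; simp
  have hz' : z = 0 := by
    ext1 o
    cases o with
    | none => exact hz0
    | some j => exact hzj j
  have hH : H ∈ K := by rw [hyz, hz', add_zero]; exact hy
  obtain ⟨u, hu, hlim⟩ := mem_closure_iff_seq_limit.mp
    (show H ∈ closure (LinearMap.range J : Set (LTwoTuple d)) from hH)
  choose f hf using hu
  have hlim' : ∀ o, Tendsto (fun n => u n o) atTop (𝓝 (H o)) := fun o =>
    ((PiLp.continuous_apply 2 _ o).tendsto H).comp hlim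
  refine ⟨f, ?_, fun j => ?_⟩
  · have := hlim' none
    simp only [← hf] at this
    exact this
  · have := (hlim' (some j)).const_smul c⁻¹
    simp only [← hf] at this
    change Tendsto (fun n => c⁻¹ • c • (der j (f n)).toLp 2 volume) atTop (𝓝 (c⁻¹ • c • g j)) at this
    simpa only [inv_smul_smul₀ hc] using this

/-! ### The Sobolev inequality for test functions -/

/-- A Sobolev constant. -/
noncomputable def sobC (d : ℕ) : ℝ :=
  (SNormLESNormFDerivOfEqConst ℂ (volume : Measure (E d)) 2 : ℝ)

theorem norm_toLp_exR_le {f : 𝓢(E d, ℂ)} (hf : HasCompactSupport f) :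
    ‖f.toLp (exR d) volume‖ ≤ sobC d * ∑ j, ‖(der j f).toLp 2 volume‖ := by
  have h6 := six_le_cast (d := d)
  have hr : 0 ≤ 2 * (d : ℝ) / ((d : ℝ) - 2) := div_nonneg (by linarith) (by linarith)
  have h1 := eLpNorm_le_eLpNorm_fderiv_of_eq (volume : Measure (E d)) (u := f)
    (f.smooth 1) hf (p := 2) (p' := (2 * (d : ℝ) / ((d : ℝ) - 2)).toNNReal) (by norm_num)
    (by simp; linarith [hd.out]) (by
      have h : (d : ℝ) - 2 ≠ 0 := by linarith
      have h' : (d : ℝ) ≠ 0 := by linarith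
      rw [Real.coe_toNNReal _ hr]
      simp
      field_simp)
  have h2 : eLpNorm (fderiv ℝ f) ((2 : NNReal) : ℝ≥0∞) (volume : Measure (E d)) ≤
      ENNReal.ofReal (∑ j, ‖(der j f).toLp 2 volume‖) := by
    have h3 : eLpNorm (fderiv ℝ f) 2 (volume : Measure (E d)) ≤
        eLpNorm (∑ j, fun x => ‖der j f x‖) 2 volume := by
      refine eLpNorm_mono_real fun x => ?_
      rw [Finset.sum_apply]
      refine ContinuousLinearMap.opNorm_le_bound _ (by positivity) fun y => ?_
      have hy : y = ∑ j, y j • EuclideanSpace.single j (1 : ℝ) := by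
        have := (EuclideanSpace.basisFun (Fin d) ℝ).sum_repr y
        simpa using this.symm
      conv_lhs => rw [hy]
      rw [map_sum, Finset.sum_mul]
      refine (norm_sum_le _ _).trans (Finset.sum_le_sum fun j _ => ?_)
      rw [map_smul, norm_smul, der_apply, mul_comm]
      gcongr
      exact PiLp.norm_apply_le y j
    refine h3.trans ((eLpNorm_sum_le (fun j _ => ((der j f).continuous.norm).aestronglyMeasurable)
      (by norm_num)).trans ?_)
    rw [ENNReal.ofReal_sum_of_nonneg fun _ _ => norm_nonneg _]
    refine Finset.sum_le_sum fun j _ => ?_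
    rw [eLpNorm_norm, SchwartzMap.norm_toLp, ENNReal.ofReal_toReal ((der j f).memLp 2 volume).2.ne]
  rw [SchwartzMap.norm_toLp]
  refine ENNReal.toReal_le_of_le_ofReal (mul_nonneg (NNReal.coe_nonneg _)
    (Finset.sum_nonneg fun _ _ => norm_nonneg _)) ?_
  refine (h1.trans (mul_le_mul' le_rfl h2)).trans (le_of_eq ?_)
  rw [sobC, ENNReal.ofReal_mul (NNReal.coe_nonneg _), ENNReal.ofReal_coe_nnreal]
  rfl

end EnergyCriticalNLS

namespace EnergyCriticalNLS

variable {d : ℕ} [hd : Fact (6 ≤ d)]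

/-! ### Weak gradients -/

/-- Complex conjugation on `L^{2d/(d-2)}`. -/
noncomputable def conjLR : LR d →L[ℝ] LR d :=
  (Complex.conjCLE : ℂ →L[ℝ] ℂ).compLpL (exR d) volume

theorem coeFn_conjLR (f : LR d) : conjLR f =ᵐ[volume] fun x => conj (f x) :=
  ContinuousLinearMap.coeFn_compLpL (p := exR d) (Complex.conjCLE : ℂ →L[ℝ] ℂ) f

theorem conjLR_toLp (φ : 𝓢(E d, ℂ)) :
    conjLR (φ.toLp (exR d) volume) = (conjS φ).toLp (exR d) volume := by
  apply Lp.ext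
  filter_upwards [coeFn_conjLR (φ.toLp (exR d) volume), φ.coeFn_toLp (exR d) volume,
    (conjS φ).coeFn_toLp (exR d) volume] with x h1 h2 h3
  rw [h1, h2, h3, conjS_apply]

/-- `G` is the weak gradient of `f`. -/
def IsGrad (f : LR d) (G : Fin d → LTwo d) : Prop :=
  ∀ (j : Fin d) (φ : 𝓢(E d, ℂ)), HasCompactSupport φ →
    ∫ x, G j x * φ x = -∫ x, f x * der j φ x

theorem isGrad_iff {f : LR d} {G : Fin d → LTwo d} : IsGrad f G ↔
    ∀ (j : Fin d) (φ : 𝓢(E d, ℂ)), HasCompactSupport φ →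
      inner ℂ ((conjS φ).toLp 2 volume) (G j) = -pairR ((der j φ).toLp (exR' d) volume) f := by
  simp only [IsGrad, integral_lp_mul, pairR_toLp_left]

theorem IsGrad.sub {f f' : LR d} {G G' : Fin d → LTwo d} (h : IsGrad f G) (h' : IsGrad f' G') :
    IsGrad (f - f') (G - G') := by
  rw [isGrad_iff] at *
  intro j φ hφ
  rw [Pi.sub_apply, inner_sub_right, h j φ hφ, h' j φ hφ, map_sub]; ring

theorem IsGrad.add {f f' : LR d} {G G' : Fin d → LTwo d} (h : IsGrad f G) (h' : IsGrad f' G') :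
    IsGrad (f + f') (G + G') := by
  rw [isGrad_iff] at *
  intro j φ hφ
  rw [Pi.add_apply, inner_add_right, h j φ hφ, h' j φ hφ, map_add]; ring

theorem toLp_add {p : ℝ≥0∞} [Fact (1 ≤ p)] (f g : 𝓢(E d, ℂ)) :
    (f + g).toLp p (volume : Measure (E d)) = f.toLp p volume + g.toLp p volume :=
  map_add (SchwartzMap.toLpCLM ℂ ℂ p (volume : Measure (E d))) f g

theorem toLp_sub {p : ℝ≥0∞} [Fact (1 ≤ p)] (f g : 𝓢(E d, ℂ)) :
    (f - g).toLp p (volume : Measure (E d)) = f.toLp p volume - g.toLp p volume :=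
  map_sub (SchwartzMap.toLpCLM ℂ ℂ p (volume : Measure (E d))) f g

theorem toLp_sum {p : ℝ≥0∞} [Fact (1 ≤ p)] {ι : Type*} (s : Finset ι) (f : ι → 𝓢(E d, ℂ)) :
    (∑ i ∈ s, f i).toLp p (volume : Measure (E d)) = ∑ i ∈ s, (f i).toLp p volume :=
  map_sum (SchwartzMap.toLpCLM ℂ ℂ p (volume : Measure (E d))) f s

theorem inner_mulLp (φ χ : 𝓢(E d, ℂ)) (g : LTwo d) :
    inner ℂ (φ.toLp 2 volume) (mulLp χ g) = ∫ x, g x * smul' χ (conjS φ) x := by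
  rw [L2.inner_def]
  refine integral_congr_ae ?_
  filter_upwards [φ.coeFn_toLp 2 volume, coeFn_mulLp χ g] with x h1 h2
  rw [h1, h2, smul'_apply, conjS_apply]
  simp; ring

theorem inner_mulR (φ χ : 𝓢(E d, ℂ)) (f : LR d) :
    inner ℂ (φ.toLp 2 volume) (mulR χ f) = ∫ x, f x * smul' χ (conjS φ) x := by
  rw [L2.inner_def]
  refine integral_congr_ae ?_
  filter_upwards [φ.coeFn_toLp 2 volume, coeFn_mulR χ f] with x h1 h2
  rw [h1, h2, smul'_apply, conjS_apply]
  simp; ring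

theorem integral_LR_add (f : LR d) (φ ψ : 𝓢(E d, ℂ)) :
    ∫ x, f x * (φ + ψ) x = (∫ x, f x * φ x) + ∫ x, f x * ψ x := by
  rw [← pairR_toLp_left, ← pairR_toLp_left, ← pairR_toLp_left, toLp_add, map_add, _root_.add_apply]

theorem hasCompactSupport_smul' {χ : 𝓢(E d, ℂ)} (hχ : HasCompactSupport χ) (φ : 𝓢(E d, ℂ)) :
    HasCompactSupport (smul' χ φ) := by
  have : (smul' χ φ : E d → ℂ) = (χ : E d → ℂ) * φ := by ext x; simp [smul'_apply]
  rw [this]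
  exact hχ.mul_right

theorem hasCompactSupport_conjS {χ : 𝓢(E d, ℂ)} (hχ : HasCompactSupport χ) :
    HasCompactSupport (conjS χ) := by
  have : (conjS χ : E d → ℂ) = (fun z => conj z) ∘ χ := by ext x; simp [conjS_apply]
  rw [this]
  exact hχ.comp_left (map_zero _)

theorem hasCompactSupport_der {χ : 𝓢(E d, ℂ)} (hχ : HasCompactSupport χ) (j : Fin d) :
    HasCompactSupport (der j χ) := by
  have : (der j χ : E d → ℂ) = fun x => fderiv ℝ χ x (EuclideanSpace.single j 1) := by
    ext x; rw [der_apply]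
  rw [this]
  exact hχ.fderiv_apply ℝ (EuclideanSpace.single j 1)

/-- The weak gradient of a localized function. -/
theorem IsGrad.localize {f : LR d} {G : Fin d → LTwo d} (h : IsGrad f G) {χ : 𝓢(E d, ℂ)}
    (hχ : HasCompactSupport χ) (j : Fin d) (φ : 𝓢(E d, ℂ)) :
    inner ℂ (φ.toLp 2 volume) (mulLp χ (G j) + mulR (der j χ) f) =
      -inner ℂ ((der j φ).toLp 2 volume) (mulR χ f) := by
  rw [inner_add_right, inner_mulLp, inner_mulR, inner_mulR,
    h j _ (hasCompactSupport_smul' hχ _), der_smul', conjS_der, integral_LR_add]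
  ring

/-- Localized functions with a weak gradient in `L²` are approximated by test functions. -/
theorem IsGrad.exists_seq {f : LR d} {G : Fin d → LTwo d} (h : IsGrad f G) {χ : 𝓢(E d, ℂ)}
    (hχ : HasCompactSupport χ) (hre : conjS χ = χ) :
    ∃ F : ℕ → 𝓢(E d, ℂ), (∀ n, HasCompactSupport (F n)) ∧
      Tendsto (fun n => (F n).toLp (exR d) volume) atTop (𝓝 (mulLp (smul' χ χ) f)) ∧
      (∀ j, Tendsto (fun n => (der j (F n)).toLp 2 volume) atTop
        (𝓝 (mulLp (smul' χ χ) (G j) + (2 : ℂ) • mulR (smul' χ (der j χ)) f))) ∧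
      ∀ g : LR d, Tendsto (fun n => ∫ x, g x * conjS (F n) x) atTop
        (𝓝 (inner ℂ (mulR χ f) (mulR χ g))) := by
  -- The function `χ f` and its weak gradient are in `L²` and can be approximated. A second factor
  -- `χ` restores compact support, which is why the square of `χ` appears.
  obtain ⟨a, ha, hda⟩ := exists_seq_schwartz (h.localize hχ)
  have hcs : ∀ φ, HasCompactSupport (smul' χ φ) := hasCompactSupport_smul' hχ
  have h2 : ∀ j, Tendsto (fun n => (der j (smul' χ (a n))).toLp 2 volume) atTop
      (𝓝 (mulLp (smul' χ χ) (G j) + (2 : ℂ) • mulR (smul' χ (der j χ)) f)) := by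
    intro j
    have l1 := ((mulLp (p := 2) (der j χ)).continuous.tendsto _).comp ha
    have l2 := ((mulLp (p := 2) χ).continuous.tendsto _).comp (hda j)
    have l3 := l1.add l2
    have e : mulLp (der j χ) (mulR χ f) + mulLp χ (mulLp χ (G j) + mulR (der j χ) f) =
        mulLp (smul' χ χ) (G j) + (2 : ℂ) • mulR (smul' χ (der j χ)) f := by
      rw [map_add, mulLp_mulR, mulLp_mulR, mulLp_mulLp, smul'_comm (der j χ) χ, two_smul]
      abel
    rw [e] at l3
    refine l3.congr fun n => ?_
    simp only [Function.comp_apply]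
    rw [mulLp_toLp, mulLp_toLp, der_smul', toLp_add]
  have h0 : Tendsto (fun n => (smul' χ (a n)).toLp 2 volume) atTop
      (𝓝 (mulLp χ (mulR χ f))) := by
    refine (((mulLp (p := 2) χ).continuous.tendsto _).comp ha).congr fun n => ?_
    simp only [Function.comp_apply, mulLp_toLp]
  refine ⟨fun n => smul' χ (a n), fun n => hcs _, ?_, h2, fun g => ?_⟩
  -- Convergence of the gradients and the Sobolev inequality for test functions give a limit in
  -- `L^{2d/(d-2)}`. It is identified through the `L²` limit by convergence in measure.
  · have hcau : CauchySeq fun n => (smul' χ (a n)).toLp (exR d) volume := by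
      have hc : ∀ j, CauchySeq fun n => (der j (smul' χ (a n))).toLp 2 volume :=
        fun j => (h2 j).cauchySeq
      rw [Metric.cauchySeq_iff]
      intro ε hε
      let δ := ε / (sobC d * d + 1)
      have hs : 0 ≤ sobC d := NNReal.coe_nonneg _
      have hδ : 0 < δ := by positivity
      choose N hN using fun j => Metric.cauchySeq_iff.mp (hc j) δ hδ
      refine ⟨Finset.univ.sup N, fun i hi k hk => ?_⟩
      rw [dist_eq_norm, ← toLp_sub]
      have hcs' : HasCompactSupport (smul' χ (a i) - smul' χ (a k)) := by
        have : smul' χ (a i) - smul' χ (a k) = smul' χ (a i - a k) := by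
          ext x; simp [smul'_apply, mul_sub]
        rw [this]; exact hcs _
      refine (norm_toLp_exR_le hcs').trans_lt ?_
      have hb : ∑ j, ‖(der j (smul' χ (a i) - smul' χ (a k))).toLp 2 (volume : Measure (E d))‖ ≤
          d * δ := by
        have : ∑ j : Fin d, δ = d * δ := by simp
        rw [← this]
        refine Finset.sum_le_sum fun j _ => ?_
        have := hN j i ((Finset.le_sup (Finset.mem_univ j)).trans hi) k
          ((Finset.le_sup (Finset.mem_univ j)).trans hk)
        rw [map_sub, toLp_sub, ← dist_eq_norm]
        exact this.le
      calc _ ≤ sobC d * (d * δ) := by gcongr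
        _ < (sobC d * d + 1) * δ := by nlinarith
        _ = ε := by simp only [δ]; field_simp
    obtain ⟨L, hL⟩ := cauchySeq_tendsto_of_complete hcau
    have e : L = mulLp (smul' χ χ) f := by
      apply Lp.ext
      have m1 := (tendstoInMeasure_of_tendsto_Lp hL).congr_left
        fun n => (smul' χ (a n)).coeFn_toLp (exR d) volume
      have m2 := (tendstoInMeasure_of_tendsto_Lp h0).congr_left
        fun n => (smul' χ (a n)).coeFn_toLp 2 volume
      filter_upwards [tendstoInMeasure_ae_unique m1 m2, coeFn_mulLp (smul' χ χ) f,
        coeFn_mulLp χ (mulR χ f), coeFn_mulR χ f] with x h1 h2 h3 h4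
      rw [h1, h2, h3, h4, smul'_apply, mul_assoc]
    rwa [e] at hL
  · have l1 : Tendsto (fun n => inner ℂ ((a n).toLp 2 volume) (mulR χ g)) atTop
        (𝓝 (inner ℂ (mulR χ f) (mulR χ g))) := ha.inner tendsto_const_nhds
    refine l1.congr fun n => ?_
    rw [inner_mulR]
    congr 1
    ext x
    have hx : conj (χ x) = χ x := by rw [← conjS_apply, hre]
    rw [conjS_apply, smul'_apply, smul'_apply, map_mul, conjS_apply, hx]

theorem IsGrad.norm_localize_le {f : LR d} {G : Fin d → LTwo d} (h : IsGrad f G) {χ : 𝓢(E d, ℂ)}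
    (hχ : HasCompactSupport χ) (hre : conjS χ = χ) :
    ‖mulLp (smul' χ χ) f‖ ≤ sobC d *
      ∑ j, ‖mulLp (smul' χ χ) (G j) + (2 : ℂ) • mulR (smul' χ (der j χ)) f‖ := by
  obtain ⟨F, hF, h1, h2, -⟩ := h.exists_seq hχ hre
  exact le_of_tendsto_of_tendsto' h1.norm
    ((tendsto_finsetSum _ fun j _ => (h2 j).norm).const_mul _) fun n => norm_toLp_exR_le (hF n)

/-! ### Cutoff functions -/

/-- A smooth bump function. -/
noncomputable def bump0 (d : ℕ) : ContDiffBump (0 : E d) := ⟨1, 2, one_pos, one_lt_two⟩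

/-- The rescaled bump function. -/
noncomputable def bumpR (R : ℝ) (x : E d) : ℂ := ((bump0 d (R⁻¹ • x) : ℝ) : ℂ)

theorem isTest_bumpR {R : ℝ} (hR : 0 < R) : IsTest (bumpR R : E d → ℂ) := by
  constructor
  · exact Complex.ofRealCLM.contDiff.comp ((bump0 d).contDiff.comp (contDiff_const_smul R⁻¹))
  · have h1 : HasCompactSupport fun x : E d => bump0 d (R⁻¹ • x) :=
      (bump0 d).hasCompactSupport.comp_smul (inv_ne_zero hR.ne')
    exact h1.comp_left (g := fun r : ℝ => (r : ℂ)) rfl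

/-- The cutoff function at radius `n + 1`. -/
noncomputable def cut (d : ℕ) [Fact (6 ≤ d)] (n : ℕ) : 𝓢(E d, ℂ) :=
  testS (isTest_bumpR (d := d) (R := n + 1) (by positivity))

theorem cut_apply (n : ℕ) (x : E d) : cut d n x = ((bump0 d (((n : ℝ) + 1)⁻¹ • x) : ℝ) : ℂ) := rfl

theorem hasCompactSupport_cut (n : ℕ) : HasCompactSupport (cut d n) :=
  (isTest_bumpR (d := d) (R := n + 1) (by positivity)).2

theorem conjS_cut (n : ℕ) : conjS (cut d n) = cut d n := by
  ext x; rw [conjS_apply, cut_apply, Complex.conj_ofReal]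

theorem norm_cut_le (n : ℕ) (x : E d) : ‖cut d n x‖ ≤ 1 := by
  rw [cut_apply, Complex.norm_real, Real.norm_of_nonneg (bump0 d).nonneg]
  exact (bump0 d).le_one

theorem cut_eq_one {n : ℕ} {x : E d} (hx : ‖x‖ ≤ n + 1) : cut d n x = 1 := by
  rw [cut_apply, (bump0 d).one_of_mem_closedBall, Complex.ofReal_one]
  rw [mem_closedBall_zero_iff, norm_smul, Real.norm_of_nonneg (by positivity),
    inv_mul_le_iff₀ (by positivity)]
  simpa [bump0] using hx

theorem cut_eq_zero {n : ℕ} {x : E d} (hx : 2 * ((n : ℝ) + 1) ≤ ‖x‖) : cut d n x = 0 := by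
  rw [cut_apply, (bump0 d).zero_of_le_dist, Complex.ofReal_zero]
  rw [dist_zero_right, norm_smul, Real.norm_of_nonneg (by positivity),
    le_inv_mul_iff₀ (by positivity)]
  simp only [bump0]; linarith

theorem norm_cut_le_cut {n N : ℕ} (h : 2 * (n + 1) ≤ N + 1) (x : E d) :
    ‖cut d n x‖ ≤ ‖cut d N x‖ := by
  have h' : 2 * ((n : ℝ) + 1) ≤ N + 1 := by exact_mod_cast h
  rcases le_total ‖x‖ (N + 1) with hx | hx
  · rw [cut_eq_one hx, norm_one]; exact norm_cut_le n x
  · rw [cut_eq_zero (h'.trans hx), norm_zero]; exact norm_nonneg _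

theorem der_cut_apply (j : Fin d) (n : ℕ) (x : E d) :
    der j (cut d n) x = (((n : ℝ) + 1)⁻¹ : ℝ) * der j (cut d 0) (((n : ℝ) + 1)⁻¹ • x) := by
  have e : (cut d n : E d → ℂ) = fun x => cut d 0 (((n : ℝ) + 1)⁻¹ • x) := by
    ext x; simp [cut_apply]
  rw [der_apply, der_apply, e]
  have h1 := (cut d 0).hasFDerivAt (((n : ℝ) + 1)⁻¹ • x)
  have h2 : HasFDerivAt (fun x : E d => ((n : ℝ) + 1)⁻¹ • x)
      (((n : ℝ) + 1)⁻¹ • ContinuousLinearMap.id ℝ (E d)) x :=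
    (((n : ℝ) + 1)⁻¹ • ContinuousLinearMap.id ℝ (E d)).hasFDerivAt
  have h3 : HasFDerivAt (fun x : E d => cut d 0 (((n : ℝ) + 1)⁻¹ • x)) _ x := h1.comp x h2
  rw [h3.fderiv]
  simp

theorem exists_norm_der_cut_le (d : ℕ) [Fact (6 ≤ d)] :
    ∃ C, 0 ≤ C ∧ ∀ (j : Fin d) (n : ℕ) (x : E d), ‖der j (cut d n) x‖ ≤ C * ((n : ℝ) + 1)⁻¹ := by
  have hb : ∀ j : Fin d, ∃ C, ∀ x, ‖der j (cut d 0) x‖ ≤ C := fun j => by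
    obtain ⟨C, hC⟩ := (hasCompactSupport_der (hasCompactSupport_cut 0) j).exists_bound_of_continuous
      (der j (cut d 0)).continuous
    exact ⟨C, hC⟩
  choose C hC using hb
  have hC0 : ∀ j, 0 ≤ C j := fun j => (norm_nonneg _).trans (hC j 0)
  refine ⟨∑ j, C j, Finset.sum_nonneg fun j _ => hC0 j, fun j n x => ?_⟩
  rw [der_cut_apply, norm_mul, Complex.norm_real, Real.norm_of_nonneg (by positivity), mul_comm]
  gcongr
  exact (hC j _).trans (Finset.single_le_sum (fun j _ => hC0 j) (Finset.mem_univ j))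

/-- The `L^d` norm of a gradient is invariant under dilation. -/
theorem norm_toLp_der_cut (j : Fin d) (n : ℕ) :
    ‖(der j (cut d n)).toLp (exD d) (volume : Measure (E d))‖ =
      ‖(der j (cut d 0)).toLp (exD d) (volume : Measure (E d))‖ := by
  have h6 := six_le_cast (d := d)
  have h0 : exD d ≠ 0 := by
    rw [exD, Ne, ENNReal.ofReal_eq_zero]; linarith
  have ht : exD d ≠ ⊤ := by simp [exD]
  rw [SchwartzMap.norm_toLp' h0 ht, SchwartzMap.norm_toLp' h0 ht]
  have e : (exD d).toReal = d := by simp [exD]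
  rw [e]
  congr 1
  have h1 := Measure.integral_comp_inv_smul_of_nonneg (volume : Measure (E d))
    (fun x => ‖der j (cut d 0) x‖ ^ (d : ℝ)) (R := (n : ℝ) + 1) (by positivity)
  have h2 : ∀ x : E d, ‖der j (cut d n) x‖ ^ (d : ℝ) = (((n : ℝ) + 1) ^ d)⁻¹ *
      ‖der j (cut d 0) (((n : ℝ) + 1)⁻¹ • x)‖ ^ (d : ℝ) := fun x => by
    rw [der_cut_apply, norm_mul, Complex.norm_real, Real.norm_of_nonneg (by positivity),
      Real.mul_rpow (by positivity) (by positivity), Real.rpow_natCast, inv_pow]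
  simp only [h2]
  rw [integral_const_mul, h1]
  simp
  field_simp

theorem tendsto_zero_of_denseRange {X Y Z : Type*} [NormedAddCommGroup X] [NormedSpace ℂ X]
    [NormedAddCommGroup Y] [NormedSpace ℂ Y] {T : ℕ → X →L[ℂ] Y} {C : ℝ} (hT : ∀ n x, ‖T n x‖ ≤ C * ‖x‖)
    {e : Z → X} (he : DenseRange e) (h : ∀ z, Tendsto (fun n => T n (e z)) atTop (𝓝 0)) (x : X) :
    Tendsto (fun n => T n x) atTop (𝓝 0) := by
  rw [NormedAddCommGroup.tendsto_nhds_zero]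
  intro ε hε
  let δ := ε / 2 / (|C| + 1)
  have hδ : 0 < δ := by positivity
  obtain ⟨z, hz⟩ := Metric.denseRange_iff.mp he x δ hδ
  filter_upwards [NormedAddCommGroup.tendsto_nhds_zero.mp (h z) (ε / 2) (by positivity)] with n hn
  have h1 : T n x = T n (x - e z) + T n (e z) := by rw [map_sub]; abel
  rw [h1]
  have h2 : ‖T n (x - e z)‖ ≤ ε / 2 := by
    refine (hT n _).trans ?_
    rw [← dist_eq_norm]
    calc C * dist x (e z) ≤ (|C| + 1) * δ := by
          have := le_abs_self C
          have h0 : 0 ≤ dist x (e z) := dist_nonneg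
          have h3 : 0 ≤ |C| := abs_nonneg C
          nlinarith
      _ = ε / 2 := by simp only [δ]; field_simp
  linarith [norm_add_le (T n (x - e z)) (T n (e z))]

/-- Scale invariance bounds the operators uniformly in `n`; on Schwartz functions they are `O(1/n)`,
and density gives the general case. -/
theorem tendsto_mulR_der_cut (j : Fin d) (f : LR d) :
    Tendsto (fun n => mulR (der j (cut d n)) f) atTop (𝓝 0) := by
  refine tendsto_zero_of_denseRange (T := fun n => mulR (der j (cut d n)))
    (C := ‖(der j (cut d 0)).toLp (exD d) (volume : Measure (E d))‖) (fun n x => ?_)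
    (e := SchwartzMap.toLpCLM ℝ ℂ (exR d) (volume : Measure (E d)))
    (SchwartzMap.denseRange_toLpCLM (by simp [exR])) (fun φ => ?_) f
  · rw [← norm_toLp_der_cut j n]; exact norm_mulR_le _ _
  · obtain ⟨C, hC0, hC⟩ := exists_norm_der_cut_le d
    have hb : ∀ n, ‖mulR (der j (cut d n)) (φ.toLp (exR d) volume)‖ ≤
        C * ‖φ.toLp 2 (volume : Measure (E d))‖ * (1 / ((n : ℝ) + 1)) := fun n => by
      rw [mulR_toLp, ← mulLp_toLp]
      refine (norm_mulLp_le (hC j n) _).trans (le_of_eq ?_)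
      ring
    refine squeeze_zero_norm hb ?_
    simpa using tendsto_one_div_add_atTop_nhds_zero_nat.const_mul
      (C * ‖φ.toLp 2 (volume : Measure (E d))‖)

theorem norm_cut_sq_le (n : ℕ) (x : E d) : ‖smul' (cut d n) (cut d n) x‖ ≤ 1 := by
  rw [smul'_apply, norm_mul]
  exact mul_le_one₀ (norm_cut_le n x) (norm_nonneg _) (norm_cut_le n x)

/-- The Sobolev inequality. -/
theorem IsGrad.norm_le {f : LR d} {G : Fin d → LTwo d} (h : IsGrad f G) :
    ‖f‖ ≤ sobC d * ∑ j, ‖G j‖ := by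
  have hs : 0 ≤ sobC d := NNReal.coe_nonneg _
  -- The localized inequality passes to the limit by Fatou's lemma on the left, while the terms with
  -- a derivative of the cutoff tend to zero on the right.
  have hfat := Lp.eLpNorm_lim_le_liminf_eLpNorm (p := exR d) (μ := (volume : Measure (E d)))
    (f := fun n => (mulLp (smul' (cut d n) (cut d n)) f : E d → ℂ))
    (fun n => Lp.aestronglyMeasurable _) f (by
      filter_upwards [ae_all_iff.mpr fun n => coeFn_mulLp (smul' (cut d n) (cut d n)) f] with x hx
      refine tendsto_const_nhds.congr' ?_
      filter_upwards [eventually_ge_atTop ⌈‖x‖⌉₊] with n hn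
      have hx1 : ‖x‖ ≤ n + 1 := by
        have : ‖x‖ ≤ n := Nat.ceil_le.mp hn
        linarith
      rw [hx, smul'_apply, cut_eq_one hx1, one_mul, one_mul])
  have hlim : Tendsto (fun n => ENNReal.ofReal (sobC d * ∑ j, (‖G j‖ +
      2 * ‖mulR (der j (cut d n)) f‖))) atTop (𝓝 (ENNReal.ofReal (sobC d * ∑ j, ‖G j‖))) := by
    refine ENNReal.tendsto_ofReal (Tendsto.const_mul _ (tendsto_finsetSum _ fun j _ => ?_))
    have := ((tendsto_mulR_der_cut j f).norm.const_mul 2).const_add ‖G j‖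
    simpa using this
  have hle : ∀ n, eLpNorm (mulLp (smul' (cut d n) (cut d n)) f : E d → ℂ) (exR d) volume ≤
      ENNReal.ofReal (sobC d * ∑ j, (‖G j‖ + 2 * ‖mulR (der j (cut d n)) f‖)) := fun n => by
    rw [← Lp.enorm_def, ← ofReal_norm_eq_enorm]
    refine ENNReal.ofReal_le_ofReal ((h.norm_localize_le (hasCompactSupport_cut n)
      (conjS_cut n)).trans ?_)
    gcongr with j
    refine (norm_add_le _ _).trans (add_le_add ?_ ?_)
    · simpa using norm_mulLp_le (norm_cut_sq_le n) (G j)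
    · rw [norm_smul, ← mulLp_mulR]
      have := norm_mulLp_le (norm_cut_le n) (mulR (der j (cut d n)) f)
      simp at this ⊢
      exact this
  have hfin := hfat.trans ((liminf_le_liminf (Eventually.of_forall hle)).trans_eq hlim.liminf_eq)
  rw [← Lp.enorm_def, ← ofReal_norm_eq_enorm] at hfin
  exact (ENNReal.ofReal_le_ofReal_iff (by positivity)).mp hfin

end EnergyCriticalNLS

namespace EnergyCriticalNLS

variable {d : ℕ} [hd : Fact (6 ≤ d)]

/-! ### Solutions as curves in Lebesgue spaces -/

theorem ae_eq_of_test {f g : E d → ℂ} (hf : LocallyIntegrable f volume)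
    (hg : LocallyIntegrable g volume)
    (h : ∀ φ : E d → ℂ, IsTest φ → ∫ x, f x * φ x = ∫ x, g x * φ x) : f =ᵐ[volume] g := by
  refine ae_eq_of_integral_contDiff_smul_eq hf hg fun φ hφ hc => ?_
  have := h (fun x => (φ x : ℂ)) ⟨Complex.ofRealCLM.contDiff.comp hφ,
    hc.comp_left (g := fun r : ℝ => (r : ℂ)) rfl⟩
  simpa only [Complex.real_smul, mul_comm] using this

theorem norm_le_sqrt_sum {ι : Type*} [Fintype ι] (g : ι → ℂ) (i : ι) :
    ‖g i‖ ≤ √(∑ s, ‖g s‖ ^ 2) := by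
  rw [← Real.sqrt_sq (norm_nonneg (g i))]
  exact Real.sqrt_le_sqrt (Finset.single_le_sum (f := fun s => ‖g s‖ ^ 2)
    (fun _ _ => by positivity) (Finset.mem_univ i))

theorem exists_isGrad {f : E d → ℂ} (hf : MemHDot f) :
    ∃ (U : LR d) (G : Fin d → LTwo d), U =ᵐ[volume] f ∧ IsGrad U G := by
  obtain ⟨hL, hg⟩ := hf
  simp only [hDotNorm, gradNorm, iInf_lt_iff] at hg
  obtain ⟨G, hG, hfin⟩ := hg
  have hmem : ∀ j : Fin d, MemLp (G fun _ => j) 2 volume := fun j => by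
    refine ⟨(hG fun _ => j).2.1.aestronglyMeasurable, lt_of_le_of_lt (eLpNorm_mono fun x => ?_) hfin⟩
    rw [one_mul, Real.norm_of_nonneg (Real.sqrt_nonneg _)]
    exact norm_le_sqrt_sum (fun s => G s x) _
  refine ⟨MemLp.toLp f hL, fun j => (hmem j).toLp, MemLp.coeFn_toLp _, fun j φ hφ => ?_⟩
  have h1 := (hG fun _ => j).2.2 φ ⟨φ.smooth ⊤, hφ⟩
  simp only [iterPartial_one, pow_one, neg_one_mul] at h1
  rw [integral_congr_ae (g := fun x => G (fun _ => j) x * φ x), h1]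
  · congr 1
    refine integral_congr_ae ?_
    filter_upwards [MemLp.coeFn_toLp hL] with x hx
    change _ = (MemLp.toLp f hL : E d → ℂ) x * _
    rw [hx]
  · filter_upwards [MemLp.coeFn_toLp (hmem j)] with x hx
    rw [hx]

/-- Weak derivatives are unique almost everywhere, so every competitor in the infimum gives the same
number. This transfers continuity in `hDotNorm` to the `L²` gradients. -/
theorem IsGrad.enorm_le {f : E d → ℂ} {U : LR d} {G : Fin d → LTwo d} (h : IsGrad U G)
    (hU : U =ᵐ[volume] f) (j : Fin d) : ‖G j‖ₑ ≤ hDotNorm f := by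
  refine le_iInf₂ fun G' hG' => ?_
  have hae : (G j : E d → ℂ) =ᵐ[volume] G' fun _ => j := by
    refine ae_eq_of_test ((Lp.memLp (G j)).locallyIntegrable (by norm_num)) (hG' _).2.1 fun φ hφ => ?_
    have h1 := (hG' fun _ => j).2.2 φ hφ
    have h2 := h j (testS hφ) hφ.2
    rw [h1]
    rw [testS_coe hφ] at h2
    rw [h2, pow_one, neg_one_mul]
    congr 1
    refine integral_congr_ae ?_
    filter_upwards [hU] with x hx
    rw [hx, ← iterPartial_one (fun _ => j), testS_coe]
  rw [Lp.enorm_def, eLpNorm_congr_ae hae]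
  refine eLpNorm_mono fun x => ?_
  rw [one_mul, Real.norm_of_nonneg (Real.sqrt_nonneg _)]
  exact norm_le_sqrt_sum (fun s => G' s x) _

/-- `w` solves `i w_t + Δ w + N = 0` on `[T, ∞)` and has the weak gradient `G`. -/
structure IsWeakEvol (T : ℝ) (w : ℝ → LR d) (G : ℝ → Fin d → LTwo d) (N : ℝ → LR' d) : Prop where
  grad : ∀ t ≥ T, IsGrad (w t) (G t)
  cont : ContinuousOn w (Set.Ici T)
  cont_grad : ContinuousOn G (Set.Ici T)
  cont_nl : ContinuousOn N (Set.Ici T)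
  equation : ∀ φ : 𝓢(E d, ℂ), HasCompactSupport φ → ∀ t₁ ≥ T, ∀ t₂ ≥ T,
    Complex.I * (∫ x, (w t₂ - w t₁ : LR d) x * φ x) +
      ((-∑ j, inner ℂ ((conjS (der j φ)).toLp 2 volume) (∫ t in t₁..t₂, G t j)) +
        pairR (∫ t in t₁..t₂, N t) (φ.toLp (exR d) volume)) = 0

theorem uIcc_subset_Ici {T t₁ t₂ : ℝ} (h₁ : t₁ ≥ T) (h₂ : t₂ ≥ T) : Set.uIcc t₁ t₂ ⊆ Set.Ici T :=
  fun _ ht => (le_min h₁ h₂).trans ht.1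

theorem IsWeakEvol.sub {T : ℝ} {w w' : ℝ → LR d} {G G' : ℝ → Fin d → LTwo d} {N N' : ℝ → LR' d}
    (h : IsWeakEvol T w G N) (h' : IsWeakEvol T w' G' N') :
    IsWeakEvol T (fun t => w t - w' t) (fun t => G t - G' t) (fun t => N t - N' t) where
  grad t ht := (h.grad t ht).sub (h'.grad t ht)
  cont := h.cont.sub h'.cont
  cont_grad := h.cont_grad.sub h'.cont_grad
  cont_nl := h.cont_nl.sub h'.cont_nl
  equation φ hφ t₁ ht₁ t₂ ht₂ := by
    have e1 := h.equation φ hφ t₁ ht₁ t₂ ht₂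
    have e2 := h'.equation φ hφ t₁ ht₁ t₂ ht₂
    have hs := uIcc_subset_Ici ht₁ ht₂
    have cj : ∀ {G : ℝ → Fin d → LTwo d}, ContinuousOn G (Set.Ici T) → ∀ j,
        IntervalIntegrable (fun t => G t j) volume t₁ t₂ := fun hG j =>
      (((continuous_apply j).comp_continuousOn hG).mono hs).intervalIntegrable
    have iG : ∀ j, ∫ t in t₁..t₂, (G t - G' t) j =
        (∫ t in t₁..t₂, G t j) - ∫ t in t₁..t₂, G' t j := fun j =>
      intervalIntegral.integral_sub (cj h.cont_grad j) (cj h'.cont_grad j)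
    have iN : ∫ t in t₁..t₂, (N t - N' t) = (∫ t in t₁..t₂, N t) - ∫ t in t₁..t₂, N' t :=
      intervalIntegral.integral_sub (h.cont_nl.mono hs).intervalIntegrable
        (h'.cont_nl.mono hs).intervalIntegrable
    simp only [← pairR_toLp_left] at e1 e2 ⊢
    simp only [iG, iN, inner_sub_right, Finset.sum_sub_distrib, map_sub, _root_.sub_apply] at e1 e2 ⊢
    linear_combination e1 - e2

theorem integral_neg_sum_add {L : Fin d → LTwo d →L[ℂ] ℂ} {P : LR' d →L[ℂ] ℂ}
    {G : ℝ → Fin d → LTwo d} {N : ℝ → LR' d} {t₁ t₂ : ℝ}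
    (cj : ∀ j, IntervalIntegrable (fun t => G t j) volume t₁ t₂)
    (cN : IntervalIntegrable N volume t₁ t₂) :
    ∫ t in t₁..t₂, ((-∑ j, L j (G t j)) + P (N t)) =
      (-∑ j, L j (∫ t in t₁..t₂, G t j)) + P (∫ t in t₁..t₂, N t) := by
  have i1 : ∀ j, IntervalIntegrable (fun t => L j (G t j)) volume t₁ t₂ := fun j =>
    ⟨(L j).integrable_comp (cj j).1, (L j).integrable_comp (cj j).2⟩
  have i2 : IntervalIntegrable (fun t => P (N t)) volume t₁ t₂ :=
    ⟨P.integrable_comp cN.1, P.integrable_comp cN.2⟩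
  have i3 : IntervalIntegrable (fun t => ∑ j, L j (G t j)) volume t₁ t₂ := by
    have := IntervalIntegrable.sum Finset.univ fun j _ => i1 j
    simpa only [Finset.sum_fn] using this
  have i4 : IntervalIntegrable (fun t => -∑ j, L j (G t j)) volume t₁ t₂ := i3.neg
  rw [intervalIntegral.integral_add i4 i2, intervalIntegral.integral_neg,
    intervalIntegral.integral_finsetSum fun j _ => i1 j, P.intervalIntegral_comp_comm cN]
  simp only [fun j => (L j).intervalIntegral_comp_comm (cj j)]

/-- Continuity of the gradients in `L²` gives continuity in `L^{2d/(d-2)}` by the Sobolev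
inequality, and then continuity of the nonlinearity in the dual space. The equation thereby becomes
one between Bochner integrals. -/
theorem IsSolutionOn.exists_isWeakEvol {T : ℝ} {u : ℝ → E d → ℂ} (hu : IsSolutionOn (Set.Ici T) u) :
    ∃ (U : ℝ → LR d) (G : ℝ → Fin d → LTwo d), (∀ t ≥ T, U t =ᵐ[volume] u t) ∧
      IsWeakEvol T U G fun t => nlR (U t) := by
  have hex : ∀ t, ∃ (U : LR d) (G : Fin d → LTwo d), t ≥ T → U =ᵐ[volume] u t ∧ IsGrad U G := by
    intro t
    by_cases ht : t ≥ T
    · obtain ⟨U, G, h1, h2⟩ := exists_isGrad (hu.mem t ht)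
      exact ⟨U, G, fun _ => ⟨h1, h2⟩⟩
    · exact ⟨0, 0, fun h => absurd h ht⟩
  choose U G hUG using hex
  have hU := fun t ht => (hUG t ht).1
  have hG := fun t ht => (hUG t ht).2
  have hGj : ∀ j, ∀ t₀ ∈ Set.Ici T,
      Tendsto (fun t => ‖G t j - G t₀ j‖) (𝓝[Set.Ici T] t₀) (𝓝 0) := by
    intro j t₀ ht₀
    have h1 : Tendsto (fun t => ‖G t j - G t₀ j‖ₑ) (𝓝[Set.Ici T] t₀) (𝓝 0) := by
      refine tendsto_of_tendsto_of_tendsto_of_le_of_le' tendsto_const_nhds (hu.cont t₀ ht₀)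
        (Eventually.of_forall fun _ => zero_le) ?_
      filter_upwards [self_mem_nhdsWithin] with t ht
      refine ((hG t ht).sub (hG t₀ ht₀)).enorm_le ?_ j
      filter_upwards [Lp.coeFn_sub (U t) (U t₀), hU t ht, hU t₀ ht₀] with x h1 h2 h3
      rw [h1, Pi.sub_apply, Pi.sub_apply, h2, h3]
    have h2 := (ENNReal.tendsto_toReal ENNReal.zero_ne_top).comp h1
    simpa only [Function.comp_def, toReal_enorm, ENNReal.toReal_zero] using h2
  have hcU : ContinuousOn U (Set.Ici T) := by
    intro t₀ ht₀
    rw [ContinuousWithinAt, tendsto_iff_norm_sub_tendsto_zero]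
    have hlim : Tendsto (fun t => sobC d * ∑ j, ‖G t j - G t₀ j‖) (𝓝[Set.Ici T] t₀) (𝓝 0) := by
      simpa using (tendsto_finsetSum Finset.univ fun j _ => hGj j t₀ ht₀).const_mul (sobC d)
    refine squeeze_zero' (Eventually.of_forall fun _ => norm_nonneg _) ?_ hlim
    filter_upwards [self_mem_nhdsWithin] with t ht
    exact ((hG t ht).sub (hG t₀ ht₀)).norm_le
  have hcG : ContinuousOn G (Set.Ici T) := by
    refine continuousOn_pi.mpr fun j t₀ ht₀ => ?_
    rw [ContinuousWithinAt, tendsto_iff_norm_sub_tendsto_zero]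
    exact hGj j t₀ ht₀
  have hcN : ContinuousOn (fun t => nlR (U t)) (Set.Ici T) := continuous_nlR.comp_continuousOn hcU
  refine ⟨U, G, hU, hG, hcU, hcG, hcN, fun φ hφ t₁ ht₁ t₂ ht₂ => ?_⟩
  have hs := uIcc_subset_Ici ht₁ ht₂
  have e := hu.equation φ ⟨φ.smooth ⊤, hφ⟩ t₁ ht₁ t₂ ht₂
  have p1 : ∀ t ≥ T, ∀ ψ : 𝓢(E d, ℂ), ∫ x, u t x * ψ x = pairR (ψ.toLp (exR' d) volume) (U t) := by
    intro t ht ψ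
    rw [pairR_toLp_left]
    refine integral_congr_ae ?_
    filter_upwards [hU t ht] with x hx
    rw [hx]
  have p2 : ∀ t ≥ T, ∫ x, nonlin d (u t x) * φ x = pairR (nlR (U t)) (φ.toLp (exR d) volume) := by
    intro t ht
    rw [pairR_toLp_right]
    refine integral_congr_ae ?_
    filter_upwards [hU t ht, coeFn_nlR (U t)] with x h1 h2
    rw [h2, h1]
  have p3 : ∀ t ≥ T, ∫ x, u t x * (Δ (φ : E d → ℂ)) x =
      -∑ j, inner ℂ ((conjS (der j φ)).toLp 2 volume) (G t j) := by
    intro t ht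
    simp only [← SchwartzMap.laplacian_apply]
    rw [p1 t ht, laplacian_eq_der, toLp_sum, map_sum, _root_.sum_apply, ← Finset.sum_neg_distrib]
    refine Finset.sum_congr rfl fun j _ => ?_
    rw [isGrad_iff.mp (hG t ht) j _ (hasCompactSupport_der hφ j), neg_neg]
  rw [p1 t₁ ht₁, p1 t₂ ht₂, ← map_sub, pairR_toLp_left] at e
  rw [intervalIntegral.integral_congr (g := fun t =>
    (-∑ j, inner ℂ ((conjS (der j φ)).toLp 2 volume) (G t j)) +
      pairR (nlR (U t)) (φ.toLp (exR d) volume)) (fun t ht => by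
        simp only [p2 t (hs ht), p3 t (hs ht)])] at e
  have cj : ∀ j, IntervalIntegrable (fun t => G t j) volume t₁ t₂ := fun j =>
    (((continuous_apply j).comp_continuousOn hcG).mono hs).intervalIntegrable
  have cN : IntervalIntegrable (fun t => nlR (U t)) volume t₁ t₂ :=
    (hcN.mono hs).intervalIntegrable
  let L : Fin d → LTwo d →L[ℂ] ℂ := fun j => innerSL ℂ ((conjS (der j φ)).toLp 2 volume)
  let P : LR' d →L[ℂ] ℂ := pairR.flip (φ.toLp (exR d) volume)
  rw [← e]
  congr 1
  exact (integral_neg_sum_add (L := L) (P := P) cj cN).symm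

end EnergyCriticalNLS

namespace EnergyCriticalNLS

variable {d : ℕ} [hd : Fact (6 ≤ d)]

/-! ### The localized mass -/

/-- The pairing of `Δ w + N` with `χ² f`, where `g` and `F` are the gradients of `w` and `f`. -/
noncomputable def flux (χ : 𝓢(E d, ℂ)) (f : LR d) (F g : Fin d → LTwo d) (n : LR' d) : ℂ :=
  (-∑ j, inner ℂ (mulLp (smul' χ χ) (F j) + (2 : ℂ) • mulR (smul' χ (der j χ)) f) (g j)) +
    pairR n (conjLR (mulLp (smul' χ χ) f))

theorem continuousOn_flux {X : Type*} [TopologicalSpace X] {s : Set X} (χ : 𝓢(E d, ℂ))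
    {f : X → LR d} {F g : X → Fin d → LTwo d} {n : X → LR' d} (hf : ContinuousOn f s)
    (hF : ContinuousOn F s) (hg : ContinuousOn g s) (hn : ContinuousOn n s) :
    ContinuousOn (fun p => flux χ (f p) (F p) (g p) (n p)) s := by
  have h1 : ∀ j, ContinuousOn (fun p => mulLp (smul' χ χ) (F p j)) s := fun j =>
    (mulLp (p := 2) (smul' χ χ)).continuous.comp_continuousOn (continuousOn_pi.mp hF j)
  have h2 : ∀ j, ContinuousOn (fun p => (2 : ℂ) • mulR (smul' χ (der j χ)) (f p)) s := fun j =>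
    ((2 : ℂ) • mulR (smul' χ (der j χ))).continuous.comp_continuousOn hf
  have h3 : ∀ j, ContinuousOn (fun p => inner ℂ (mulLp (smul' χ χ) (F p j) +
      (2 : ℂ) • mulR (smul' χ (der j χ)) (f p)) (g p j)) s := fun j =>
    ((h1 j).add (h2 j)).inner (continuousOn_pi.mp hg j)
  have h4 : ContinuousOn (fun p => conjLR (mulLp (smul' χ χ) (f p))) s :=
    (conjLR (d := d)).continuous.comp_continuousOn
      ((mulLp (p := exR d) (smul' χ χ)).continuous.comp_continuousOn hf)
  have h5 : ContinuousOn (fun p => pairR (n p)) s :=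
    (pairR (d := d)).continuous.comp_continuousOn hn
  exact (continuousOn_finsetSum _ fun j _ => h3 j).neg.add (h5.clm_apply h4)

theorem IsWeakEvol.intervalIntegrable_grad {T : ℝ} {w : ℝ → LR d} {G : ℝ → Fin d → LTwo d}
    {N : ℝ → LR' d} (h : IsWeakEvol T w G N) {t₁ t₂ : ℝ} (ht₁ : t₁ ≥ T) (ht₂ : t₂ ≥ T) (j : Fin d) :
    IntervalIntegrable (fun t => G t j) volume t₁ t₂ :=
  (((continuous_apply j).comp_continuousOn h.cont_grad).mono
    (uIcc_subset_Ici ht₁ ht₂)).intervalIntegrable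

/-- The weak equation extends by density from test functions to `χ² conj f`, with `f` of finite
gradient norm. Holding `f` fixed in time avoids differentiating the test function. -/
theorem IsWeakEvol.inner_eq {T : ℝ} {w : ℝ → LR d} {G : ℝ → Fin d → LTwo d} {N : ℝ → LR' d}
    (h : IsWeakEvol T w G N) {χ : 𝓢(E d, ℂ)} (hχ : HasCompactSupport χ) (hre : conjS χ = χ)
    {f : LR d} {F : Fin d → LTwo d} (hF : IsGrad f F) {t₁ t₂ : ℝ} (ht₁ : t₁ ≥ T) (ht₂ : t₂ ≥ T) :
    inner ℂ (mulR χ f) (mulR χ (w t₂ - w t₁)) =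
      Complex.I * ∫ t in t₁..t₂, flux χ f F (G t) (N t) := by
  have hint : ∫ t in t₁..t₂, flux χ f F (G t) (N t) =
      flux χ f F (fun j => ∫ t in t₁..t₂, G t j) (∫ t in t₁..t₂, N t) :=
    integral_neg_sum_add (L := fun j => innerSL ℂ
      (mulLp (smul' χ χ) (F j) + (2 : ℂ) • mulR (smul' χ (der j χ)) f))
      (P := pairR.flip (conjLR (mulLp (smul' χ χ) f))) (h.intervalIntegrable_grad ht₁ ht₂)
      ((h.cont_nl.mono (uIcc_subset_Ici ht₁ ht₂)).intervalIntegrable)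
  obtain ⟨a, ha, l1, l2, l3⟩ := hF.exists_seq hχ hre
  have key : Complex.I * inner ℂ (mulR χ f) (mulR χ (w t₂ - w t₁)) +
      flux χ f F (fun j => ∫ t in t₁..t₂, G t j) (∫ t in t₁..t₂, N t) = 0 := by
    have m1 := (l3 (w t₂ - w t₁)).const_mul Complex.I
    have m2 := tendsto_finsetSum Finset.univ fun j _ =>
      ((l2 j).inner (𝕜 := ℂ) (tendsto_const_nhds (x := ∫ t in t₁..t₂, G t j)))
    have m3 := ((pairR (∫ t in t₁..t₂, N t)).continuous.tendsto _).comp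
      ((conjLR.continuous.tendsto _).comp l1)
    refine tendsto_nhds_unique (m1.add (m2.neg.add m3)) (tendsto_const_nhds.congr fun n => ?_)
    have e := h.equation (conjS (a n)) (hasCompactSupport_conjS (ha n)) t₁ ht₁ t₂ ht₂
    simp only [conjS_der, conjS_conjS] at e
    rw [← e]
    simp only [Function.comp_apply, conjLR_toLp]
  rw [hint]
  linear_combination (-Complex.I) * key + (inner ℂ (mulR χ f) (mulR χ (w t₂ - w t₁))) * Complex.I_mul_I

theorem norm_sq_sub (a b : LTwo d) : ‖b‖ ^ 2 - ‖a‖ ^ 2 = (inner ℂ (a + b) (b - a)).re := by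
  have h : (inner ℂ b a).re = (inner ℂ a b).re := by
    rw [← inner_conj_symm a b, Complex.conj_re]
  rw [inner_add_left, inner_sub_right, inner_sub_right, inner_self_eq_norm_sq_to_K,
    inner_self_eq_norm_sq_to_K]
  simp [← Complex.ofReal_pow]
  linarith

/-- The derivative of the localized mass. -/
theorem IsWeakEvol.hasDerivWithinAt {T : ℝ} {w : ℝ → LR d} {G : ℝ → Fin d → LTwo d} {N : ℝ → LR' d}
    (h : IsWeakEvol T w G N) {χ : 𝓢(E d, ℂ)} (hχ : HasCompactSupport χ) (hre : conjS χ = χ)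
    {x : ℝ} (hx : x ≥ T) :
    HasDerivWithinAt (fun t => ‖mulR χ (w t)‖ ^ 2)
      (Complex.I * flux χ (w x + w x) (G x + G x) (G x) (N x)).re (Set.Ici T) x := by
  rw [hasDerivWithinAt_iff_isLittleO, Asymptotics.isLittleO_iff]
  intro c hc
  -- The identity `‖b‖² - ‖a‖² = Re ⟨a + b, b - a⟩` allows the test function `w x + w z`. In `A`,
  -- the first variable is this endpoint `z` and the second the time of integration; joint
  -- continuity at `(x, x)` yields the derivative.
  let A : ℝ × ℝ → ℂ := fun p => flux χ (w x + w p.1) (G x + G p.1) (G p.2) (N p.2)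
  have hA : ContinuousOn A (Set.Ici T ×ˢ Set.Ici T) := by
    have f1 : Set.MapsTo (Prod.fst : ℝ × ℝ → ℝ) (Set.Ici T ×ˢ Set.Ici T) (Set.Ici T) := fun p hp => hp.1
    have f2 : Set.MapsTo (Prod.snd : ℝ × ℝ → ℝ) (Set.Ici T ×ˢ Set.Ici T) (Set.Ici T) := fun p hp => hp.2
    have c1 : ContinuousOn (fun p : ℝ × ℝ => w x + w p.1) (Set.Ici T ×ˢ Set.Ici T) :=
      continuousOn_const.add (h.cont.comp continuousOn_fst f1)
    have c2 : ContinuousOn (fun p : ℝ × ℝ => G x + G p.1) (Set.Ici T ×ˢ Set.Ici T) :=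
      continuousOn_const.add (h.cont_grad.comp continuousOn_fst f1)
    have c3 : ContinuousOn (fun p : ℝ × ℝ => G p.2) (Set.Ici T ×ˢ Set.Ici T) :=
      h.cont_grad.comp continuousOn_snd f2
    have c4 : ContinuousOn (fun p : ℝ × ℝ => N p.2) (Set.Ici T ×ˢ Set.Ici T) :=
      h.cont_nl.comp continuousOn_snd f2
    exact continuousOn_flux χ c1 c2 c3 c4
  obtain ⟨δ, hδ, hball⟩ := Metric.continuousOn_iff.mp hA (x, x) ⟨hx, hx⟩ c hc
  filter_upwards [self_mem_nhdsWithin, mem_nhdsWithin_of_mem_nhds (Metric.ball_mem_nhds x hδ)]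
    with z hz hzx
  have hgrad := (h.grad x hx).add (h.grad z hz)
  have e1 : ‖mulR χ (w z)‖ ^ 2 - ‖mulR χ (w x)‖ ^ 2 =
      (Complex.I * ∫ t in x..z, A (z, t)).re := by
    rw [norm_sq_sub, ← map_add, ← map_sub, h.inner_eq hχ hre hgrad hx hz]
  have hs := uIcc_subset_Ici hx hz
  have hi : IntervalIntegrable (fun t => A (z, t)) volume x z := by
    refine ContinuousOn.intervalIntegrable (hA.comp (by fun_prop) fun t ht => ⟨hz, hs ht⟩)
  have e2 : ‖(∫ t in x..z, A (z, t)) - ((z - x : ℝ) : ℂ) * A (x, x)‖ ≤ c * |z - x| := by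
    have : ((z - x : ℝ) : ℂ) * A (x, x) = ∫ t in x..z, A (x, x) := by
      rw [intervalIntegral.integral_const, Complex.real_smul]
    rw [this, ← intervalIntegral.integral_sub hi intervalIntegrable_const]
    refine intervalIntegral.norm_integral_le_of_norm_le_const fun t ht => ?_
    have ht' := Set.uIoc_subset_uIcc ht
    have htx : dist t x < δ := by
      rw [Real.dist_eq]
      refine (Set.abs_sub_left_of_mem_uIcc ht').trans_lt ?_
      rwa [Metric.mem_ball, Real.dist_eq] at hzx
    have := hball (z, t) ⟨hz, hs ht'⟩ (by rw [Prod.dist_eq]; exact max_lt hzx htx)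
    rw [← dist_eq_norm]
    exact this.le
  rw [e1]
  have e3 : (Complex.I * ∫ t in x..z, A (z, t)).re -
      (z - x) • (Complex.I * flux χ (w x + w x) (G x + G x) (G x) (N x)).re =
      (Complex.I * ((∫ t in x..z, A (z, t)) - ((z - x : ℝ) : ℂ) * A (x, x))).re := by
    simp only [A, Complex.mul_re, Complex.mul_im, Complex.sub_re, Complex.sub_im, Complex.ofReal_re,
      Complex.ofReal_im, Complex.I_re, Complex.I_im, smul_eq_mul]
    ring
  rw [e3, Real.norm_eq_abs, Real.norm_eq_abs]
  refine (Complex.abs_re_le_norm _).trans ?_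
  rwa [norm_mul, Complex.norm_I, one_mul]

theorem flux_add_self (χ : 𝓢(E d, ℂ)) (f : LR d) (F g : Fin d → LTwo d) (n : LR' d) :
    flux χ (f + f) (F + F) g n = 2 * flux χ f F g n := by
  simp only [flux, map_add, Pi.add_apply, smul_add, inner_add_left, Finset.sum_add_distrib]
  ring

theorem im_inner_mulLp_sq (χ : 𝓢(E d, ℂ)) (hre : conjS χ = χ) (g : LTwo d) :
    (inner ℂ (mulLp (smul' χ χ) g) g).im = 0 := by
  have : inner ℂ (mulLp (smul' χ χ) g) g = inner ℂ (mulLp χ g) (mulLp χ g) := by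
    rw [L2.inner_def, L2.inner_def]
    refine integral_congr_ae ?_
    filter_upwards [coeFn_mulLp (smul' χ χ) g, coeFn_mulLp χ g] with x h1 h2
    have hx : conj (χ x) = χ x := by rw [← conjS_apply, hre]
    rw [h1, h2, smul'_apply]
    simp only [RCLike.inner_apply, map_mul, hx]
    ring
  rw [this]
  exact inner_self_im (𝕜 := ℂ) _

/-- The nonlinear contribution to the localized mass. -/
theorem abs_im_pairR_le {V U : LR d} {B : ℝ} (hB : ∀ᵐ x, ‖U x‖ ≤ B) (χ : 𝓢(E d, ℂ))
    (hre : conjS χ = χ) :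
    |(pairR (nlR V - nlR U) (conjLR (mulLp (smul' χ χ) (V - U)))).im| ≤
      B ^ alpha d * ‖mulR χ (V - U)‖ ^ 2 := by
  have hn : ‖mulR χ (V - U)‖ ^ 2 = ∫ x, ‖mulR χ (V - U) x‖ ^ 2 := by
    have h1 := L2.inner_def (𝕜 := ℂ) (mulR χ (V - U)) (mulR χ (V - U))
    rw [inner_self_eq_norm_sq_to_K] at h1
    simp only [inner_self_eq_norm_sq_to_K] at h1
    have h2 : ((‖mulR χ (V - U)‖ ^ 2 : ℝ) : ℂ) = ((∫ x, ‖mulR χ (V - U) x‖ ^ 2 : ℝ) : ℂ) := by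
      rw [← integral_complex_ofReal]
      push_cast
      exact h1
    exact_mod_cast h2
  have hmem : Integrable (fun x => ‖mulR χ (V - U) x‖ ^ 2) volume :=
    (memLp_two_iff_integrable_sq_norm (Lp.aestronglyMeasurable _)).mp (Lp.memLp (mulR χ (V - U)))
  rw [hn, ← integral_const_mul, pairR_apply]
  have hpt : ∀ᵐ x : E d, |((nlR V - nlR U : LR' d) x *
      (conjLR (mulLp (smul' χ χ) (V - U)) : LR d) x).im| ≤ B ^ alpha d * ‖mulR χ (V - U) x‖ ^ 2 := by
    filter_upwards [hB, Lp.coeFn_sub (nlR V) (nlR U), coeFn_nlR V, coeFn_nlR U,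
      coeFn_conjLR (mulLp (smul' χ χ) (V - U)), coeFn_mulLp (smul' χ χ) (V - U), Lp.coeFn_sub V U,
      coeFn_mulR χ (V - U)] with x h0 h1 h2 h3 h4 h5 h6 h7
    have hx : conj (χ x) = χ x := by rw [← conjS_apply, hre]
    obtain ⟨r, hr⟩ := Complex.conj_eq_iff_real.mp hx
    rw [h1, h4, h5, h7, h6, Pi.sub_apply, h2, h3, smul'_apply, Pi.sub_apply, hr, map_mul, map_mul,
      Complex.conj_ofReal]
    have e : (nonlin d (V x) - nonlin d (U x)) * ((r : ℂ) * (r : ℂ) * conj (V x - U x)) =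
        ((r * r : ℝ) : ℂ) * ((nonlin d (V x) - nonlin d (U x)) * conj (V x - U x)) := by
      push_cast; ring
    rw [e, Complex.im_ofReal_mul, abs_mul, abs_of_nonneg (mul_self_nonneg r), norm_mul, mul_pow,
      Complex.norm_real, Real.norm_eq_abs, sq_abs]
    have h8 := abs_im_nonlin_sub_le (d := d) (V x) (U x)
    have h9 : ‖U x‖ ^ alpha d ≤ B ^ alpha d :=
      Real.rpow_le_rpow (norm_nonneg _) h0 alpha_pos.le
    have h10 := mul_self_nonneg r
    calc _ ≤ r * r * (‖U x‖ ^ alpha d * ‖V x - U x‖ ^ 2) := by gcongr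
      _ ≤ r * r * (B ^ alpha d * ‖V x - U x‖ ^ 2) := by gcongr
      _ = _ := by ring
  have hint : Integrable (fun x => (nlR V - nlR U : LR' d) x *
      (conjLR (mulLp (smul' χ χ) (V - U)) : LR d) x) volume :=
    (Lp.memLp _).integrable_mul (Lp.memLp _)
  have him := integral_im hint
  simp only [RCLike.im_to_complex] at him
  rw [← him, ← Real.norm_eq_abs]
  refine (norm_integral_le_of_norm_le (hmem.const_mul _) ?_)
  filter_upwards [hpt] with x hx
  exact hx

/-- The pairing of the gradient with `χ²` times itself is real and drops out. With `e` the localized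
norm, the cross term with the gradient of `χ` is at most `4 C M e ≤ e² + 4 (C M)²`. -/
theorem abs_re_flux_le {V U : LR d} {F : Fin d → LTwo d} {B C M : ℝ} (hB : ∀ᵐ x, ‖U x‖ ≤ B)
    {χ : 𝓢(E d, ℂ)} (hre : conjS χ = χ) (hC : ∀ j x, ‖der j χ x‖ ≤ C) (hM : ∑ j, ‖F j‖ ≤ M) :
    |(Complex.I * flux χ ((V - U) + (V - U)) (F + F) F (nlR V - nlR U)).re| ≤
      (2 * B ^ alpha d + 1) * ‖mulR χ (V - U)‖ ^ 2 + 4 * (C * M) ^ 2 := by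
  have hC0 : 0 ≤ C := (norm_nonneg _).trans (hC ⟨0, by have := hd.out; omega⟩ 0)
  set e := ‖mulR χ (V - U)‖
  have h1 := abs_im_pairR_le (V := V) hB χ hre
  have h2 : ∀ j, |(inner ℂ (mulLp (smul' χ χ) (F j) +
      (2 : ℂ) • mulR (smul' χ (der j χ)) (V - U)) (F j)).im| ≤ 2 * (C * e) * ‖F j‖ := fun j => by
    rw [inner_add_left, Complex.add_im, im_inner_mulLp_sq χ hre, zero_add]
    refine (Complex.abs_im_le_norm _).trans ((norm_inner_le_norm _ _).trans ?_)
    gcongr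
    rw [norm_smul, smul'_comm, ← mulLp_mulR]
    rw [Complex.norm_two]
    gcongr
    exact norm_mulLp_le (hC j) (mulR χ (V - U))
  have h3 : |(∑ j, inner ℂ (mulLp (smul' χ χ) (F j) +
      (2 : ℂ) • mulR (smul' χ (der j χ)) (V - U)) (F j)).im| ≤ 2 * (C * e) * M := by
    rw [Complex.im_sum]
    refine (Finset.abs_sum_le_sum_abs _ _).trans ((Finset.sum_le_sum fun j _ => h2 j).trans ?_)
    rw [← Finset.mul_sum]
    gcongr
  rw [flux_add_self, flux]
  have h4 : ∀ a b : ℂ, (Complex.I * (2 * (-a + b))).re = 2 * a.im - 2 * b.im := fun a b => by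
    simp; ring
  rw [h4]
  refine (abs_sub _ _).trans ?_
  rw [abs_mul, abs_mul, abs_two]
  nlinarith [sq_nonneg (e - 2 * (C * M))]

end EnergyCriticalNLS

namespace EnergyCriticalNLS

variable {d : ℕ} [hd : Fact (6 ≤ d)]

/-! ### Uniqueness -/

section

variable {T B : ℝ} {U V : ℝ → LR d} {F G : ℝ → Fin d → LTwo d}

/-- Grönwall backwards in time: `e^{Kt}` times the localized mass plus `δ` is nondecreasing, where
`K δ` is the cutoff error. The constant may depend on `a` and `b`, but not on the cutoff. -/
theorem exists_mass_le (hU : IsWeakEvol T U F fun t => nlR (U t))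
    (hV : IsWeakEvol T V G fun t => nlR (V t)) (hB0 : 0 ≤ B)
    (hB : ∀ t ≥ T, ∀ᵐ x, ‖U t x‖ ≤ B) {a b : ℝ} (ha : a ≥ T) (hab : a ≤ b) :
    ∃ C, ∀ n : ℕ, ‖mulR (cut d n) (V a - U a)‖ ^ 2 ≤
      Real.exp ((2 * B ^ alpha d + 1) * (b - a)) *
        (‖mulR (cut d n) (V b - U b)‖ ^ 2 + C * (1 / ((n : ℝ) + 1)) ^ 2) := by
  have hW := hV.sub hU
  obtain ⟨C, hC0, hC⟩ := exists_norm_der_cut_le d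
  have hcont : ContinuousOn (fun t => ∑ j, ‖(G t - F t) j‖) (Set.Icc a b) :=
    continuousOn_finsetSum _ fun j _ => (continuousOn_pi.mp
      (hW.cont_grad.mono fun t ht => ha.le.trans ht.1) j).norm
  obtain ⟨M, hM⟩ := isCompact_Icc.bddAbove_image hcont
  set K := 2 * B ^ alpha d + 1 with hK
  have hK0 : 0 < K := by positivity
  refine ⟨4 * (C * M) ^ 2 / K, fun n => ?_⟩
  set e : ℝ → ℝ := fun t => ‖mulR (cut d n) (V t - U t)‖ ^ 2
  set δ := 4 * (C * M) ^ 2 / K * (1 / ((n : ℝ) + 1)) ^ 2 with hδ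
  let D : ℝ → ℝ := fun x => (Complex.I * flux (cut d n) ((V x - U x) + (V x - U x))
    ((G x - F x) + (G x - F x)) (G x - F x) (nlR (V x) - nlR (U x))).re
  have hder : ∀ x ≥ T, HasDerivWithinAt e (D x) (Set.Ici T) x := fun x hx =>
    hW.hasDerivWithinAt (hasCompactSupport_cut n) (conjS_cut n) hx
  have hD : ∀ x ∈ Set.Icc a b, -(K * (e x + δ)) ≤ D x := fun x hx => by
    have h1 := abs_re_flux_le (V := V x) (F := G x - F x) (hB x (ha.le.trans hx.1)) (conjS_cut n)
      (fun j y => hC j n y) (hM (Set.mem_image_of_mem _ hx))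
    have h2 : K * δ = 4 * (C * ((n : ℝ) + 1)⁻¹ * M) ^ 2 := by
      rw [hδ]; field_simp
    have h3 := (abs_le.mp h1).1
    rw [mul_add, h2]
    exact h3
  let g : ℝ → ℝ := fun t => Real.exp (K * t) * (e t + δ)
  have hexp : ∀ x, HasDerivAt (fun t => Real.exp (K * t)) (Real.exp (K * x) * K) x := fun x => by
    have := ((hasDerivAt_id x).const_mul K).exp
    simpa using this
  have hgder : ∀ x ≥ T, HasDerivWithinAt g
      (Real.exp (K * x) * K * (e x + δ) + Real.exp (K * x) * D x) (Set.Ici T) x := fun x hx =>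
    (hexp x).hasDerivWithinAt.mul ((hder x hx).add_const δ)
  have hmono : MonotoneOn g (Set.Icc a b) := by
    have hat : ∀ x ∈ interior (Set.Icc a b), HasDerivAt g
        (Real.exp (K * x) * K * (e x + δ) + Real.exp (K * x) * D x) x := fun x hx => by
      rw [interior_Icc] at hx
      exact (hgder x (ha.le.trans hx.1.le)).hasDerivAt (Ici_mem_nhds (ha.le.trans_lt hx.1))
    refine monotoneOn_of_deriv_nonneg (convex_Icc a b) (fun x hx => ?_)
      (fun x hx => (hat x hx).differentiableAt.differentiableWithinAt) fun x hx => ?_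
    · exact (hgder x (ha.le.trans hx.1)).continuousWithinAt.mono fun t ht => ha.le.trans ht.1
    · rw [(hat x hx).deriv]
      have h1 := hD x (interior_subset hx)
      have h2 := Real.exp_pos (K * x)
      nlinarith
  have hδ0 : 0 ≤ δ := by positivity
  have hfin := hmono (Set.left_mem_Icc.mpr hab) (Set.right_mem_Icc.mpr hab) hab
  simp only [g] at hfin
  have hsplit : Real.exp (K * b) = Real.exp (K * a) * Real.exp (K * (b - a)) := by
    rw [← Real.exp_add]; ring_nf
  rw [hsplit, mul_assoc] at hfin
  have := le_of_mul_le_mul_left hfin (Real.exp_pos _)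
  change e a ≤ Real.exp (K * (b - a)) * (e b + δ)
  linarith

/-- At fixed `b` the cutoff is removed first. What remains is at most a constant times `e^{K(b-a)}
e^{-2κb}`, which tends to zero as `b` grows because `K < 2κ`. -/
theorem eq_of_decay (hU : IsWeakEvol T U F fun t => nlR (U t))
    (hV : IsWeakEvol T V G fun t => nlR (V t)) (hB0 : 0 ≤ B)
    (hB : ∀ t ≥ T, ∀ᵐ x, ‖U t x‖ ≤ B) {κ D b₀ : ℝ} (hκ : 2 * B ^ alpha d + 1 < 2 * κ)
    (hdec : ∀ b ≥ b₀, ∀ n, ‖mulR (cut d n) (V b - U b)‖ ≤ D * Real.exp (-(κ * b)))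
    {a : ℝ} (ha : a ≥ T) : V a = U a := by
  have hzero : ∀ n, mulR (cut d n) (V a - U a) = 0 := by
    intro n
    set K := 2 * B ^ alpha d + 1 with hK
    have h1 : ∀ b ≥ max a b₀, ‖mulR (cut d n) (V a - U a)‖ ^ 2 ≤
        D ^ 2 * Real.exp (-(K * a)) * Real.exp (-((2 * κ - K) * b)) := by
      intro b hb
      obtain ⟨C, hC⟩ := exists_mass_le hU hV hB0 hB ha ((le_max_left a b₀).trans hb)
      have h2 : ∀ᶠ N : ℕ in atTop, ‖mulR (cut d n) (V a - U a)‖ ^ 2 ≤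
          Real.exp (K * (b - a)) * ((D * Real.exp (-(κ * b))) ^ 2 + C * (1 / ((N : ℝ) + 1)) ^ 2) := by
        filter_upwards [eventually_ge_atTop (2 * (n + 1))] with N hN
        have h3 : ‖mulR (cut d n) (V a - U a)‖ ≤ ‖mulR (cut d N) (V a - U a)‖ := by
          refine Lp.norm_le_norm_of_ae_le ?_
          filter_upwards [coeFn_mulR (cut d n) (V a - U a), coeFn_mulR (cut d N) (V a - U a)]
            with x e1 e2
          rw [e1, e2, norm_mul, norm_mul]
          gcongr
          exact norm_cut_le_cut (by omega) x
        have h4 := hdec b ((le_max_right a b₀).trans hb) N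
        calc _ ≤ ‖mulR (cut d N) (V a - U a)‖ ^ 2 := by gcongr
          _ ≤ _ := hC N
          _ ≤ _ := by gcongr
      have h5 : Tendsto (fun N : ℕ => Real.exp (K * (b - a)) *
          ((D * Real.exp (-(κ * b))) ^ 2 + C * (1 / ((N : ℝ) + 1)) ^ 2)) atTop
          (𝓝 (Real.exp (K * (b - a)) * ((D * Real.exp (-(κ * b))) ^ 2 + C * 0 ^ 2))) :=
        (((tendsto_one_div_add_atTop_nhds_zero_nat.pow 2).const_mul C).const_add _).const_mul _
      refine (ge_of_tendsto h5 h2).trans (le_of_eq ?_)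
      rw [mul_pow, ← Real.exp_nat_mul]
      have : Real.exp (K * (b - a)) * Real.exp (((2 : ℕ) : ℝ) * -(κ * b)) =
          Real.exp (-(K * a)) * Real.exp (-((2 * κ - K) * b)) := by
        rw [← Real.exp_add, ← Real.exp_add]; push_cast; ring_nf
      linear_combination D ^ 2 * this
    have h6 : Tendsto (fun b => D ^ 2 * Real.exp (-(K * a)) * Real.exp (-((2 * κ - K) * b)))
        atTop (𝓝 0) := by
      have : Tendsto (fun b => Real.exp (-((2 * κ - K) * b))) atTop (𝓝 0) :=
        Real.tendsto_exp_neg_atTop_nhds_zero.comp (tendsto_id.const_mul_atTop (by linarith))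
      simpa using this.const_mul (D ^ 2 * Real.exp (-(K * a)))
    have h7 : ‖mulR (cut d n) (V a - U a)‖ ^ 2 ≤ 0 :=
      ge_of_tendsto h6 (by filter_upwards [eventually_ge_atTop (max a b₀)] with b hb using h1 b hb)
    exact norm_eq_zero.mp (pow_eq_zero_iff two_ne_zero |>.mp (le_antisymm h7 (by positivity)))
  rw [← sub_eq_zero]
  apply Lp.ext
  have hz : ∀ n, ∀ᵐ x : E d, cut d n x * (V a - U a : LR d) x = 0 := fun n => by
    have h0 := hzero n
    filter_upwards [coeFn_mulR (cut d n) (V a - U a), Lp.coeFn_zero ℂ 2 (volume : Measure (E d))]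
      with x e1 e2
    rw [← e1, h0, e2]; rfl
  filter_upwards [ae_all_iff.mpr hz, Lp.coeFn_zero ℂ (exR d) (volume : Measure (E d))] with x hx h0
  have hx1 : ‖x‖ ≤ (⌈‖x‖⌉₊ : ℝ) + 1 := (Nat.le_ceil _).trans (by linarith)
  have := hx ⌈‖x‖⌉₊
  rw [cut_eq_one hx1, one_mul] at this
  rw [this, h0]; rfl

end

theorem IsSolutionOn.mono {I J : Set ℝ} {u : ℝ → E d → ℂ} (hu : IsSolutionOn J u) (h : I ⊆ J) :
    IsSolutionOn I u where
  mem t ht := hu.mem t (h ht)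
  cont t ht := (hu.cont t (h ht)).mono_left (nhdsWithin_mono _ h)
  scattering_size K hK := hu.scattering_size K (hK.trans h)
  equation φ hφ t₁ h₁ t₂ h₂ := hu.equation φ hφ t₁ (h h₁) t₂ (h h₂)

/-- Two solutions which approach each other fast enough agree, if one of them is bounded. -/
theorem IsSolutionOn.ae_eq_of_decay {T B : ℝ} {u v : ℝ → E d → ℂ} (hu : IsSolutionOn (Set.Ici T) u)
    (hv : IsSolutionOn (Set.Ici T) v) (hB0 : 0 ≤ B) (hB : ∀ t ≥ T, ∀ x, ‖u t x‖ ≤ B) {κ D : ℝ}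
    (hκ : 2 * B ^ alpha d + 1 < 2 * κ)
    (hdec : ∀ᶠ b in atTop, eLpNorm (v b - u b) 2 volume ≤ ENNReal.ofReal (D * Real.exp (-(κ * b))))
    {t : ℝ} (ht : T ≤ t) : v t =ᵐ[volume] u t := by
  obtain ⟨U, F, hUu, hU⟩ := hu.exists_isWeakEvol
  obtain ⟨V, G, hVv, hV⟩ := hv.exists_isWeakEvol
  obtain ⟨b₀, hb₀⟩ := eventually_atTop.mp hdec
  have key : V t = U t := by
    refine eq_of_decay hU hV hB0 (fun t ht => ?_) hκ (D := |D|) (b₀ := max T b₀) (fun b hb n => ?_) ht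
    · filter_upwards [hUu t ht] with x hx
      rw [hx]; exact hB t ht x
    · have hbT : b ≥ T := (le_max_left _ _).trans hb
      have h1 : eLpNorm (mulR (cut d n) (V b - U b) : E d → ℂ) 2 volume ≤
          ENNReal.ofReal (|D| * Real.exp (-(κ * b))) := by
        refine le_trans (eLpNorm_mono_ae ?_) ((hb₀ b ((le_max_right _ _).trans hb)).trans
          (ENNReal.ofReal_le_ofReal (by gcongr; exact le_abs_self D)))
        filter_upwards [coeFn_mulR (cut d n) (V b - U b), Lp.coeFn_sub (V b) (U b), hUu b hbT,
          hVv b hbT] with x e1 e2 e3 e4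
        rw [e1, e2, Pi.sub_apply, Pi.sub_apply, e3, e4, norm_mul]
        exact mul_le_of_le_one_left (norm_nonneg _) (norm_cut_le n x)
      rw [← Lp.enorm_def, ← ofReal_norm_eq_enorm] at h1
      exact (ENNReal.ofReal_le_ofReal_iff (by positivity)).mp h1
  filter_upwards [hUu t ht, hVv t ht] with x h1 h2
  rw [← h1, ← h2, key]

/-! ### Comparison of the weighted Sobolev norm with `L²`, and its invariance under null sets -/

theorem one_le_bracket (x : E d) : 1 ≤ bracket x := by
  rw [bracket, Real.one_le_sqrt]; nlinarith [sq_nonneg ‖x‖]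

/-- The summand of order zero is enough: a weak derivative of order zero is the function itself
almost everywhere, and its weight is at least one. -/
theorem eLpNorm_le_hmmNorm (m : ℕ) (f : E d → ℂ) : eLpNorm f 2 volume ≤ hmmNorm m f := by
  have h0 : gradNorm (fun x : E d => bracket x ^ (m - 0)) 0 f ≤ hmmNorm m f :=
    Finset.single_le_sum (f := fun j => gradNorm (fun x : E d => bracket x ^ (m - j)) j f)
      (fun _ _ => zero_le) (Finset.mem_range.mpr (Nat.succ_pos m))
  refine le_trans (le_iInf₂ fun G hG => ?_) h0
  have hae : f =ᵐ[volume] G default := by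
    refine ae_eq_of_test (hG default).1 (hG default).2.1 fun φ hφ => ?_
    have := (hG default).2.2 φ hφ
    simp only [iterPartial, iteratedFDeriv_zero_apply, pow_zero, one_mul] at this
    exact this.symm
  rw [eLpNorm_congr_ae hae]
  refine eLpNorm_mono fun x => ?_
  have h1 : 1 ≤ bracket x ^ (m - 0) := one_le_pow₀ (one_le_bracket x)
  have h2 := norm_le_sqrt_sum (fun s => G s x) default
  rw [Real.norm_of_nonneg (by positivity)]
  nlinarith [Real.sqrt_nonneg (∑ s, ‖G s x‖ ^ 2)]

theorem gradNorm_congr_ae {f f' : E d → ℂ} (h : f =ᵐ[volume] f') (ρ : E d → ℝ) (j : ℕ) :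
    gradNorm ρ j f = gradNorm ρ j f' := by
  have key : ∀ {f f' : E d → ℂ}, f =ᵐ[volume] f' → ∀ (s : Fin j → Fin d) (g : E d → ℂ),
      IsWeakDeriv s f g → IsWeakDeriv s f' g := by
    intro f f' h s g hg
    refine ⟨(locallyIntegrable_congr h).mp hg.1, hg.2.1, fun φ hφ => ?_⟩
    rw [hg.2.2 φ hφ]
    congr 1
    refine integral_congr_ae ?_
    filter_upwards [h] with x hx
    rw [hx]
  have hiff : ∀ (s : Fin j → Fin d) (g : E d → ℂ), IsWeakDeriv s f g ↔ IsWeakDeriv s f' g :=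
    fun s g => ⟨key h s g, key h.symm s g⟩
  simp only [gradNorm, hiff]

theorem hmmNorm_congr_ae {f f' : E d → ℂ} (h : f =ᵐ[volume] f') (m : ℕ) :
    hmmNorm m f = hmmNorm m f' := by
  simp only [hmmNorm, gradNorm_congr_ae h]

end EnergyCriticalNLS

namespace EnergyCriticalNLS

variable {d : ℕ} [hd : Fact (6 ≤ d)] {m : ℕ}

/-! ### The main theorem -/

theorem norm_nearA_sub_le (Φ : ℕ → 𝓢(E d, ℂ)) {k l : ℕ} (hl : l ≤ k) {s : ℝ} (hs0 : 0 ≤ s)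
    (hs1 : s ≤ 1) : ‖nearA m Φ k s - nearA m Φ l s‖ ≤
      (∑ j ∈ Finset.Ioc l k, ‖iota m (Φ j)‖) * s ^ (l + 1) := by
  have hI : ∀ n : ℕ, Finset.Icc 1 n = Finset.Ioc 0 n := fun n => by ext; simp [Nat.succ_le_iff]
  have e : nearA m Φ k s - nearA m Φ l s = ∑ j ∈ Finset.Ioc l k, s ^ j • iota m (Φ j) := by
    rw [nearA, nearA, hI, hI, ← Finset.sum_Ioc_consecutive _ (Nat.zero_le l) hl]
    abel
  rw [e, Finset.sum_mul]
  refine (norm_sum_le _ _).trans (Finset.sum_le_sum fun j hj => ?_)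
  rw [norm_smul, Real.norm_of_nonneg (by positivity), mul_comm]
  gcongr ?_ * ?_
  exact pow_le_pow_of_le_one hs0 hs1 (Finset.mem_Ioc.mp hj).1

/-- For `l < k` the omitted terms are `O(e^{-(l+1)e₀t})`, and the spare factor `e^{-e₀t/2}` absorbs
all constants. For `l = k` there is no room, and the exact normalization `C ρ = 1` is used. -/
theorem eventually_norm_sub_nearA_le {e₀ : ℝ} (he : 0 < e₀) (Φ : ℕ → 𝓢(E d, ℂ)) {k l : ℕ}
    (hl : l ≤ k) {C ρ T : ℝ} (hC : 0 < C) (hρ : C * ρ = 1) {v : ℝ → Alg d m}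
    (hv : ∀ t ≥ T, ‖v t‖ ≤ ρ * Real.exp (-((k + 1 / 2) * e₀ * t))) :
    ∀ᶠ t in atTop, C * ‖nearA m Φ k (Real.exp (-(e₀ * t))) + v t -
      nearA m Φ l (Real.exp (-(e₀ * t)))‖ ≤ Real.exp (-((l + 1 / 2) * e₀ * t)) := by
  rcases hl.eq_or_lt with rfl | hlt
  · filter_upwards [eventually_ge_atTop T] with t ht
    rw [add_sub_cancel_left]
    calc C * ‖v t‖ ≤ C * (ρ * Real.exp (-((l + 1 / 2) * e₀ * t))) := by gcongr; exact hv t ht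
      _ = _ := by rw [← mul_assoc, hρ, one_mul]
  have hρ0 : 0 < ρ := by
    by_contra h
    nlinarith [mul_nonneg hC.le (neg_nonneg.mpr (not_lt.mp h))]
  set S := ∑ j ∈ Finset.Ioc l k, ‖iota m (Φ j)‖
  have hS : 0 ≤ S := Finset.sum_nonneg fun _ _ => norm_nonneg _
  have hlim : Tendsto (fun t => C * (S + ρ) * Real.exp (-(e₀ / 2 * t))) atTop (𝓝 0) := by
    have : Tendsto (fun t => Real.exp (-(e₀ / 2 * t))) atTop (𝓝 0) :=
      Real.tendsto_exp_neg_atTop_nhds_zero.comp (tendsto_id.const_mul_atTop (by linarith))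
    simpa using this.const_mul (C * (S + ρ))
  filter_upwards [eventually_ge_atTop T, eventually_ge_atTop 0,
    hlim.eventually (ge_mem_nhds one_pos)] with t ht ht0 hsm
  have hs1 : Real.exp (-(e₀ * t)) ≤ 1 := Real.exp_le_one_iff.mpr (by nlinarith)
  have h1 := norm_nearA_sub_le (m := m) Φ hl (Real.exp_pos (-(e₀ * t))).le hs1
  have h2 : Real.exp (-(e₀ * t)) ^ (l + 1) =
      Real.exp (-(e₀ / 2 * t)) * Real.exp (-((l + 1 / 2) * e₀ * t)) := by
    rw [← Real.exp_nat_mul, ← Real.exp_add]; push_cast; ring_nf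
  have h3 : Real.exp (-((k + 1 / 2) * e₀ * t)) ≤
      Real.exp (-(e₀ / 2 * t)) * Real.exp (-((l + 1 / 2) * e₀ * t)) := by
    rw [← Real.exp_add, Real.exp_le_exp]
    have : (l : ℝ) + 1 ≤ k := by exact_mod_cast hlt
    have h4 : 0 ≤ e₀ * t := by positivity
    nlinarith
  have h5 : nearA m Φ k (Real.exp (-(e₀ * t))) + v t - nearA m Φ l (Real.exp (-(e₀ * t))) =
      (nearA m Φ k (Real.exp (-(e₀ * t))) - nearA m Φ l (Real.exp (-(e₀ * t)))) + v t := by abel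
  rw [h5]
  rw [h2] at h1
  have h6 := (hv t ht).trans (mul_le_mul_of_nonneg_left h3 hρ0.le)
  set A := Real.exp (-(e₀ / 2 * t))
  set A' := Real.exp (-((l + 1 / 2) * e₀ * t)) with hA'
  calc _ ≤ C * (S * (A * A') + ρ * (A * A')) := by
        gcongr
        exact (norm_add_le _ _).trans (add_le_add h1 h6)
    _ = (C * (S + ρ) * A) * A' := by ring
    _ ≤ 1 * A' := by gcongr
    _ = A' := one_mul _

theorem solFn_sub_Wk (e₀ : ℝ) (Φ : ℕ → 𝓢(E d, ℂ)) (l : ℕ) (t : ℝ) (z : Alg d m) :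
    solFn z - Wk e₀ Φ l t = fn m (z - nearA m Φ l (Real.exp (-(e₀ * t)))) := by
  ext x
  rw [Pi.sub_apply, solFn, Wk_eq m, fn_sub]
  ring

theorem continuous_Wk (e₀ : ℝ) (Φ : ℕ → 𝓢(E d, ℂ)) (l : ℕ) (t : ℝ) :
    Continuous (Wk e₀ Φ l t) := by
  have : Wk e₀ Φ l t = solFn (nearA 0 Φ l (Real.exp (-(e₀ * t)))) := by
    ext x; rw [Wk_eq 0, solFn]
  rw [this]; exact continuous_solFn _

end EnergyCriticalNLS

open EnergyCriticalNLS in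
theorem proposition3p5 (d : ℕ) (hd : 6 ≤ d)
    (e₀ : ℝ) (Y : SchwartzMap (EnergyCriticalNLS.E d) ℂ)
    (hY : EnergyCriticalNLS.IsUnstableMode e₀ Y)
    (a : ℝ) (Φ : ℕ → SchwartzMap (EnergyCriticalNLS.E d) ℂ)
    (hΦ : EnergyCriticalNLS.IsNearSolutionFamily e₀ Y a Φ)
    (m : ℕ) (hm : 3 * d ≤ m) :
    ∃ k₀ : ℕ, 0 < k₀ ∧
      ∃ (T : ℝ) (Wa : ℝ → EnergyCriticalNLS.E d → ℂ),
        -- `Wa` is a solution on `[T, ∞)` approximated by the near solutions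
        EnergyCriticalNLS.IsSolutionOn (Set.Ici T) Wa ∧
        EnergyCriticalNLS.IsApproximated m e₀ Φ k₀ Wa ∧
        -- any other such solution agrees with `Wa` at all times at which both are defined
        (∀ (T' : ℝ) (v : ℝ → EnergyCriticalNLS.E d → ℂ),
          EnergyCriticalNLS.IsSolutionOn (Set.Ici T') v →
          EnergyCriticalNLS.IsApproximated m e₀ Φ k₀ v →
          ∀ t, T ≤ t → T' ≤ t → v t =ᵐ[MeasureTheory.volume] Wa t) ∧
        -- the first-order expansion, for all large times
        (∃ t₀ : ℝ, ∀ t ≥ t₀,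
          EnergyCriticalNLS.hmmNorm m
              (fun x => Wa t x - (EnergyCriticalNLS.W d x : ℂ)
                - (a : ℂ) * ((Real.exp (-(e₀ * t)) : ℝ) : ℂ) * Y x)
            ≤ ENNReal.ofReal (Real.exp (-(3 / 2 * e₀ * t)))) := by
  haveI : Fact (6 ≤ d) := ⟨hd⟩
  have he := hY.pos
  obtain ⟨C, hC0, hC⟩ := exists_hmmNorm_fn_le (d := d) m
  have herr : ∀ k : ℕ, 1 ≤ k → ∃ C : ℝ, ∀ᶠ t : ℝ in atTop, ∀ x : E d,
      ‖nearError e₀ Φ k t x‖ ≤ C * Real.exp (-((k + 1) * e₀ * t)) := fun k hk => by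
    obtain ⟨C, hC⟩ := hΦ.error k hk 0 0
    refine ⟨C, hC.mono fun t ht x => ?_⟩
    have := ht x
    rwa [pow_zero, one_mul, norm_iteratedFDeriv_zero] at this
  -- The radius `C⁻¹` makes the required bound hold with constant one after passing to `hmmNorm`.
  obtain ⟨k₁, hk₁, hex⟩ := exists_algSolution (m := m) he herr C⁻¹ (inv_pos.mpr hC0)
  have hev := evalConst_nonneg (d := d) m
  set B := 1 + evalConst d m
  have hB0 : 0 ≤ B := by positivity
  -- The second threshold lets the decay rate at level `k₀` dominate the Grönwall rate of a solution
  -- bounded by `B`.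
  obtain ⟨k₂, hk₂⟩ := exists_nat_gt ((2 * B ^ alpha d + 1) / (2 * e₀))
  set k₀ := max k₁ k₂
  have hκ : 2 * B ^ alpha d + 1 < 2 * ((k₀ + 1 / 2) * e₀) := by
    have h1 : (k₂ : ℝ) ≤ k₀ := by exact_mod_cast le_max_right k₁ k₂
    rw [div_lt_iff₀ (by positivity)] at hk₂
    nlinarith
  have hhmm : ∀ {k l : ℕ} {T : ℝ} {v : ℝ → Alg d m}, l ≤ k →
      (∀ t ≥ T, ‖v t‖ ≤ C⁻¹ * Real.exp (-((k + 1 / 2) * e₀ * t))) →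
      ∀ᶠ t in atTop, hmmNorm m (solFn (nearA m Φ k (Real.exp (-(e₀ * t))) + v t) - Wk e₀ Φ l t) ≤
        ENNReal.ofReal (Real.exp (-((l + 1 / 2) * e₀ * t))) := by
    intro k l T v hl hv
    filter_upwards [eventually_norm_sub_nearA_le he Φ hl hC0 (mul_inv_cancel₀ hC0.ne') hv] with t ht
    rw [solFn_sub_Wk]
    exact (hC _).trans (ENNReal.ofReal_le_ofReal ht)
  obtain ⟨T, hT0, v, hv, hsol⟩ := hex k₀ (le_max_left _ _)
  set Wa : ℝ → E d → ℂ := fun t => solFn (nearA m Φ k₀ (Real.exp (-(e₀ * t))) + v t) with hWa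
  have hm1 : 1 ≤ m := by omega
  have hWsol : IsSolutionOn (Set.Ici T) Wa := isSolutionOn_solFn hm1 hsol
  -- Closeness at the single level `k₀` already forces agreement; this is used both for uniqueness
  -- and for identifying the solutions built at higher levels.
  have huniq : ∀ (T' : ℝ) (u : ℝ → E d → ℂ), IsSolutionOn (Set.Ici T') u →
      (∀ᶠ t in atTop, hmmNorm m (u t - Wk e₀ Φ k₀ t) ≤
        ENNReal.ofReal (Real.exp (-((k₀ + 1 / 2) * e₀ * t)))) →
      ∀ t, T ≤ t → T' ≤ t → u t =ᵐ[volume] Wa t := by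
    intro T' u hu hap t ht ht'
    have hTT : Set.Ici (max T T') ⊆ Set.Ici T := Set.Ici_subset_Ici.mpr (le_max_left _ _)
    have hTT' : Set.Ici (max T T') ⊆ Set.Ici T' := Set.Ici_subset_Ici.mpr (le_max_right _ _)
    refine (hWsol.mono hTT).ae_eq_of_decay (hu.mono hTT') hB0 (fun t ht x => ?_) hκ (D := 2) ?_
      (max_le ht ht')
    · exact norm_solFn_le' (hsol.small t (hTT ht)) x
    · filter_upwards [hap, hhmm le_rfl hv, eventually_ge_atTop T'] with b h1 h2 hb
      have m1 : AEStronglyMeasurable (u b - Wk e₀ Φ k₀ b) volume :=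
        (hu.mem b hb).1.1.sub (continuous_Wk e₀ Φ k₀ b).aestronglyMeasurable
      have m2 : AEStronglyMeasurable (Wa b - Wk e₀ Φ k₀ b) volume :=
        (continuous_solFn _).aestronglyMeasurable.sub (continuous_Wk e₀ Φ k₀ b).aestronglyMeasurable
      have e1 : u b - Wa b = (u b - Wk e₀ Φ k₀ b) - (Wa b - Wk e₀ Φ k₀ b) := by abel
      rw [e1]
      refine (eLpNorm_sub_le m1 m2 (by norm_num)).trans ((add_le_add
        ((eLpNorm_le_hmmNorm m _).trans h1) ((eLpNorm_le_hmmNorm m _).trans h2)).trans ?_)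
      rw [← ENNReal.ofReal_add (by positivity) (by positivity), two_mul]
  refine ⟨k₀, lt_of_lt_of_le hk₁ (le_max_left _ _), T, Wa, hWsol, ?_, ?_, ?_⟩
  · intro k hk
    -- The solution built at level `k` is also close to the near solution of order `k₀`, hence
    -- equals `Wa` almost everywhere at common times and hands over its better approximation.
    obtain ⟨Tk, hTk0, vk, hvk, hsolk⟩ := hex k ((le_max_left _ _).trans hk)
    have hae := huniq Tk _ (isSolutionOn_solFn hm1 hsolk) (hhmm hk hvk)
    obtain ⟨t₁, ht₁⟩ := eventually_atTop.mp (hhmm le_rfl hvk)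
    refine ⟨max (max T Tk) t₁, le_max_of_le_left (le_max_of_le_left hT0), fun t ht => ?_⟩
    have h1 := hae t ((le_max_left _ _).trans ((le_max_left _ _).trans ht))
      ((le_max_right _ _).trans ((le_max_left _ _).trans ht))
    have h2 : Wa t - Wk e₀ Φ k t =ᵐ[volume]
        solFn (nearA m Φ k (Real.exp (-(e₀ * t))) + vk t) - Wk e₀ Φ k t := by
      filter_upwards [h1] with x hx
      rw [Pi.sub_apply, Pi.sub_apply, hx]
    rw [hmmNorm_congr_ae h2]
    exact ht₁ t ((le_max_right _ _).trans ht)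
  · intro T' u hu hap t ht ht'
    obtain ⟨t₁, -, h1⟩ := hap k₀ le_rfl
    exact huniq T' u hu (eventually_atTop.mpr ⟨t₁, h1⟩) t ht ht'
  -- Comparison at level `l = 1`, allowed since `k₀ ≥ 1`, gives the rate `(1 + 1/2) e₀`.
  · obtain ⟨t₁, ht₁⟩ := eventually_atTop.mp
      (hhmm (l := 1) (lt_of_lt_of_le hk₁ (le_max_left _ _) : 1 ≤ k₀) hv)
    refine ⟨t₁, fun t ht => ?_⟩
    have h1 := ht₁ t ht
    have e1 : (fun x => Wa t x - (W d x : ℂ) - (a : ℂ) * ((Real.exp (-(e₀ * t)) : ℝ) : ℂ) * Y x) =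
        Wa t - Wk e₀ Φ 1 t := by
      ext x
      simp only [Pi.sub_apply, Wk, Finset.Icc_self, Finset.sum_singleton, hΦ.first, Nat.cast_one,
        one_mul, SchwartzMap.smul_apply, smul_eq_mul]
      ring
    rw [e1]
    refine h1.trans (le_of_eq ?_)
    norm_num
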